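/- **Setting.** Let $n\ge 1$, $1=\sigma_1\le\cdots\le\sigma_n$ and $\delta_\lambda(x)=(\lambda^{\sigma_1}x_1,\dots,\lambda^{\sigma_n}x_n)$, $\lambda>0$. Let $X_1,\dots,X_m$ be smooth vector fields on $\mathbb R^n$, linearly independent as vector fields, $\delta_\lambda$-homogeneous of degree $1$, i.e. $X_i(f\circ\delta_\lambda)=\lambda\,(X_if)\circ\delta_\lambda$ for all $\lambda>0$ and $f\in C^\infty(\mathbb R^n)$, and such that $\{X(0):X\in\mathfrak a\}=\mathbb R^n$, where $\mathfrak a=\mathrm{Lie}\{X_1,\dots,X_m\}$. Put $\mathfrak a_1=\mathrm{span}\{X_1,\dots,X_m\}$, $\mathfrak a_{k+1}=[\mathfrak a_1,\mathfrak a_k]$. **Construction.** Choose a basis $X_1,\dots,X_m,X_{m+1},\dots,X_N$ of $\mathfrak a$ (where $N=n+p=\dim\mathfrak a$) and degrees $s_1\le\dots\le s_N$ such that $\mathfrak a_k=\mathrm{span}\{X_i:s_i=k\}$ for every $k\geq 1$ (and every $s_i\ge1$), and indices $i_1<\dots<i_n$ such that $X_{i_1}(0),\dots,X_{i_n}(0)$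 is a basis of $\mathbb R^n$; let $j_1<\dots<j_p$ be the remaining indices. Write $a\cdot X=\sum_i a_iX_i$ for $a\in\mathbb R^N$. Let $\diamond$ be the Campbell–Baker–Hausdorff operation $X\diamond Y=X+Y+\tfrac12[X,Y]+\cdots$ of the nilpotent Lie algebra $\mathfrak a$, and define $*$ on $\mathbb R^N$ by $(a*b)\cdot X=(a\cdot X)\diamond(b\cdot X)$. Let $J_i(a)=\frac{d}{dt}\big|_{t=0}\,a*(te_i)$, let $\pi(a)\in\mathbb R^n$ be the value at time $1$ of the integral curve of $a\cdot X$ starting from $0$, and let $T(a)=(\pi(a),a_{j_1},\dots,a_{j_p})$, a diffeomorphism of $\mathbb R^N$ onto $\mathbb R^n\times\mathbb R^p$, whose points are denoted by $(x,\xi)$. Finally put $u\star v=T(T^{-1}(u)*T^{-1}(v))$, $Z_i=dT(J_i)$, $\sigma^*_k=s_{j_k}$, $\delta^*_\lambda(\xi)=(\lambda^{\sigma_1^*}\xi_1,\dots,\lambda^{\sigma_p^*}\xi_p)$, $d_\lambda(x,\xi)=(\delta_\lambda(x),\delta^*_\lambda(\xi))$, and $$\mathcal L=\sum_{k=1}^mX_k^2,\qquad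 \mathcal L_{\mathbb G}=\sum_{k=1}^mZ_k^2,\qquad \mathbb G=(\mathbb R^n\times\mathbb R^p,\star,d_\lambda).$$ **Saturable liftings.** Let $P$ and $\widetilde P$ be linear partial differential operators with smooth coefficients on $\mathbb R^n$ and on $\mathbb R^n\times\mathbb R^p$, respectively. $\widetilde P$ is a *lifting* of $P$ if $\widetilde P(f\circ \mathrm{pr})(x,\xi)=(Pf)(x)$ for all $f\in C^\infty(\mathbb R^n)$, where $\mathrm{pr}(x,\xi)=x$; equivalently, $\widetilde P=P+R$ with $R=\sum_{\beta\ne0}r_{\alpha,\beta}(x,\xi)D_x^\alpha D_\xi^\beta$ (a finite sum with smooth coefficients). It is a *saturable lifting* if moreover * (S.1) the formal adjoint of $R$ has the form $R^*=\sum_{\beta\neq0}r^*_{\alpha,\beta}(x,\xi)D_x^\alpha D_\xi^\beta$ (a finite sum with smooth coefficients); * (S.2) there is a sequence $\theta_j\in C_0^\infty(\mathbb R^p,[0,1])$, $j\in\mathbb N$, such that the sets $\{\theta_j=1\}$ increase with $j$ and have union $\mathbb R^p$, and such that for every compact $K\subset\mathbb R^n$ and every coefficient $r^*_{\alpha,\beta}$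 of $R^*$ there is a constant $C_{\alpha,\beta}(K)$ with $|r^*_{\alpha,\beta}(x,\xi)\,D^\beta\theta_j(\xi)|\le C_{\alpha,\beta}(K)$ for all $x\in K$, $\xi\in\mathbb R^p$, $j\in\mathbb N$. **Theorem.** The choices in the construction are possible. For every such choice, $Z_1,\dots,Z_m$ are the left-invariant fields $Z_k(u)=\frac{d}{dt}\big|_{t=0}u\star T(te_k)$ of $\mathbb G$ and are $d_\lambda$-homogeneous of degree $1$, and $\mathcal L_{\mathbb G}$ is a saturable lifting of $\mathcal L$. Moreover, let $N(\xi)=\sum_{k=1}^p|\xi_k|^{1/\sigma^*_k}$. There are functions $\theta\in C_0^\infty(\mathbb R^p,[0,1])$ with $\mathrm{supp}\,\theta\subseteq\{N\le2\}$ and $\theta=1$ on $\{N<1\}$, and for every such $\theta$ the cut-offs $\theta_j=\theta\circ\delta^*_{2^{-j}}$, $j=0,1,2,\dots$, satisfy (S.2) for $R=\mathcal L_{\mathbb G}-\mathcal L$. -/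

import Mathlib

open scoped ContDiff

noncomputable section

namespace Saturation

/-! ## Linear partial differential operators with smooth coefficients -/

section PDO

variable {ι : Type} [Fintype ι] [DecidableEq ι]

/-- The partial derivative `∂f/∂x_i`. -/
def pd (i : ι) (f : (ι → ℝ) → ℝ) : (ι → ℝ) → ℝ :=
  fun x => fderiv ℝ f x (Pi.single i 1)

/-- The higher order derivative `D^α f`, for a multi-index `α` (on smooth functions the partial
derivatives commute, so that the order in which they are taken is irrelevant). -/
def mderiv (α : ι → ℕ) (f : (ι → ℝ) → ℝ) : (ι → ℝ) → ℝ :=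
  (Finset.univ : Finset ι).toList.foldr (fun i g => (pd i)^[α i] g) f

variable (ι) in
/-- A linear partial differential operator `∑ a_α(x) D^α` (finite sum) with smooth real
coefficients on `ℝ^ι`, given by its coefficient functions. -/
structure PDO where
  coeff : (ι → ℕ) →₀ ((ι → ℝ) → ℝ)
  smooth : ∀ α, ContDiff ℝ ∞ (coeff α)

/-- `(P f)(x) = ∑ a_α(x) D^α f(x)`. -/
def PDO.apply (P : PDO ι) (f : (ι → ℝ) → ℝ) : (ι → ℝ) → ℝ :=
  fun x => P.coeff.sum fun α a => a x * mderiv α f x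

/-- The formal adjoint, `(P^* f)(x) = ∑ (-1)^{|α|} D^α (a_α f)(x)`. -/
def PDO.adjointApply (P : PDO ι) (f : (ι → ℝ) → ℝ) : (ι → ℝ) → ℝ :=
  fun x => P.coeff.sum fun α a => (-1) ^ (∑ i, α i) * mderiv α (fun y => a y * f y) x

/-- The operator `A`, acting on smooth functions, is the PDO with the coefficients of `P`. -/
def PDO.Represents (P : PDO ι) (A : ((ι → ℝ) → ℝ) → ((ι → ℝ) → ℝ)) : Prop :=
  ∀ f : (ι → ℝ) → ℝ, ContDiff ℝ ∞ f → A f = P.apply f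

/-- The operator `A`, acting on smooth functions, is a linear PDO with smooth coefficients. -/
def IsPDO (A : ((ι → ℝ) → ℝ) → ((ι → ℝ) → ℝ)) : Prop :=
  ∃ P : PDO ι, P.Represents A

/-- `Q` is (the coefficient form of) the formal adjoint of `P`. -/
def PDO.IsFormalAdjoint (Q P : PDO ι) : Prop :=
  Q.Represents P.adjointApply

/-- A vector field `V` as a first-order differential operator, `(V f)(x) = df_x(V(x))`. -/
def act (V : (ι → ℝ) → (ι → ℝ)) (f : (ι → ℝ) → ℝ) : (ι → ℝ) → ℝ :=
  fun x => fderiv ℝ f x (V x)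

/-- The sum of squares `∑_k V_k²`. -/
def sumSq {m : ℕ} (V : Fin m → (ι → ℝ) → (ι → ℝ)) (f : (ι → ℝ) → ℝ) : (ι → ℝ) → ℝ :=
  fun x => ∑ k, act (V k) (act (V k) f) x

/-- The non-isotropic dilation `x ↦ (lam^{σ_k} x_k)_k`. -/
def dil (σ : ι → ℝ) (lam : ℝ) (x : ι → ℝ) : ι → ℝ :=
  fun k => lam ^ σ k * x k

/-- The vector field `V` is homogeneous of degree `1` with respect to the dilations `dil σ`:
`V (f ∘ δ_lam) = lam (V f) ∘ δ_lam` for all `lam > 0` and all smooth `f`. -/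
def IsHomogeneousOne (σ : ι → ℝ) (V : (ι → ℝ) → (ι → ℝ)) : Prop :=
  ∀ lam : ℝ, 0 < lam → ∀ f : (ι → ℝ) → ℝ, ContDiff ℝ ∞ f →
    ∀ x, act V (f ∘ dil σ lam) x = lam * act V f (dil σ lam x)

end PDO

/-! ## Saturable liftings

The points of `ℝ^n × ℝ^p` are the functions `z : Fin n ⊕ Fin p → ℝ`; the point `(x, ξ)` is
`Sum.elim x ξ`, and conversely `x = z ∘ Sum.inl`, `ξ = z ∘ Sum.inr`. A multi-index
`γ : Fin n ⊕ Fin p → ℕ` is a pair `(α, β) = (γ ∘ Sum.inl, γ ∘ Sum.inr)`, so that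
`mderiv γ = D_x^α D_ξ^β`. -/

section Lifting

variable {n p : ℕ}

/-- An operator `A` on `ℝ^n` regarded as an operator on `ℝ^n × ℝ^p` acting in `x` only. -/
def inX (A : ((Fin n → ℝ) → ℝ) → ((Fin n → ℝ) → ℝ)) (u : (Fin n ⊕ Fin p → ℝ) → ℝ) :
    (Fin n ⊕ Fin p → ℝ) → ℝ :=
  fun z => A (fun x => u (Sum.elim x (z ∘ Sum.inr))) (z ∘ Sum.inl)

/-- `At` is a lifting of `A`: it is a PDO with smooth coefficients on `ℝ^n × ℝ^p` and
`At (f ∘ π)(x, ξ) = (A f)(x)` for every smooth `f`, where `π (x, ξ) = x`. -/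
def IsLifting (A : ((Fin n → ℝ) → ℝ) → ((Fin n → ℝ) → ℝ))
    (At : ((Fin n ⊕ Fin p → ℝ) → ℝ) → ((Fin n ⊕ Fin p → ℝ) → ℝ)) : Prop :=
  IsPDO At ∧ ∀ f : (Fin n → ℝ) → ℝ, ContDiff ℝ ∞ f →
    ∀ x ξ, At (fun z => f (z ∘ Sum.inl)) (Sum.elim x ξ) = A f x

/-- Every summand of the operator acts at least once in the `ξ` variables: `β ≠ 0` in every
nonzero term `r_{α,β} D_x^α D_ξ^β`. -/
def ActsInXi (R : PDO (Fin n ⊕ Fin p)) : Prop :=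
  ∀ γ : Fin n ⊕ Fin p → ℕ, R.coeff γ ≠ 0 → γ ∘ Sum.inr ≠ 0

/-- `θ_j ∈ C_0^∞(ℝ^p, [0,1])` for every `j`, and the sets `{θ_j = 1}` increase to `ℝ^p`. -/
structure IsCutoffSeq (θ : ℕ → (Fin p → ℝ) → ℝ) : Prop where
  smooth : ∀ j, ContDiff ℝ ∞ (θ j)
  compact : ∀ j, HasCompactSupport (θ j)
  mem_Icc : ∀ j ξ, θ j ξ ∈ Set.Icc (0 : ℝ) 1
  mono : ∀ j, {ξ | θ j ξ = 1} ⊆ {ξ | θ (j + 1) ξ = 1}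
  exhaust : ⋃ j, {ξ | θ j ξ = 1} = Set.univ

/-- For every coefficient `r_{α,β}` and every compact `K ⊆ ℝ^n`, the functions
`r_{α,β}(x,ξ) D^β θ_j(ξ)` are bounded on `K × ℝ^p`, uniformly in `j`. -/
def UniformBounds (R : PDO (Fin n ⊕ Fin p)) (θ : ℕ → (Fin p → ℝ) → ℝ) : Prop :=
  ∀ K : Set (Fin n → ℝ), IsCompact K → ∀ γ : Fin n ⊕ Fin p → ℕ, ∃ C : ℝ,
    ∀ x ∈ K, ∀ (ξ : Fin p → ℝ) (j : ℕ),
      |R.coeff γ (Sum.elim x ξ) * mderiv (γ ∘ Sum.inr) (θ j) ξ| ≤ C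

/-- `At = A + R` is a saturable lifting of `A`, the sequence `θ` being a witness of the cut-off
condition: all the summands of the remainder `R` and of its formal adjoint `R^*` act in the `ξ`
variables, and the coefficients of `R^*` satisfy the uniform bounds along `θ`. -/
def IsSaturableLiftingVia (A : ((Fin n → ℝ) → ℝ) → ((Fin n → ℝ) → ℝ))
    (At : ((Fin n ⊕ Fin p → ℝ) → ℝ) → ((Fin n ⊕ Fin p → ℝ) → ℝ))
    (θ : ℕ → (Fin p → ℝ) → ℝ) : Prop :=
  IsPDO A ∧ IsLifting A At ∧
    ∃ R Rstar : PDO (Fin n ⊕ Fin p),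
      R.Represents (fun u z => At u z - inX A u z) ∧ ActsInXi R ∧
      Rstar.IsFormalAdjoint R ∧ ActsInXi Rstar ∧
      IsCutoffSeq θ ∧ UniformBounds Rstar θ

/-- `At` is a saturable lifting of `A`. -/
def IsSaturableLifting (A : ((Fin n → ℝ) → ℝ) → ((Fin n → ℝ) → ℝ))
    (At : ((Fin n ⊕ Fin p → ℝ) → ℝ) → ((Fin n ⊕ Fin p → ℝ) → ℝ)) : Prop :=
  ∃ θ : ℕ → (Fin p → ℝ) → ℝ, IsSaturableLiftingVia A At θ

end Lifting

/-! ## The Lie algebra of smooth vector fields -/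

/-- The smooth vector fields on `ℝ^n`. -/
def smoothVF (n : ℕ) : Submodule ℝ ((Fin n → ℝ) → (Fin n → ℝ)) where
  carrier := {V | ContDiff ℝ ∞ V}
  add_mem' := fun {V W} (hV : ContDiff ℝ ∞ V) (hW : ContDiff ℝ ∞ W) => hV.add hW
  zero_mem' := (contDiff_const : ContDiff ℝ ∞ fun _ : Fin n → ℝ => (0 : Fin n → ℝ))
  smul_mem' := fun c V (hV : ContDiff ℝ ∞ V) => hV.const_smul c

theorem smoothVF_contDiff {n : ℕ} (V : smoothVF n) : ContDiff ℝ ∞ V.1 := V.2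

theorem smoothVF_differentiableAt {n : ℕ} (V : smoothVF n) (x : Fin n → ℝ) :
    DifferentiableAt ℝ V.1 x :=
  (smoothVF_contDiff V).differentiable (by simp) x

/-- The bracket is the commutator of vector fields, `[V, W] = V W - W V` as operators, which is
Mathlib's `VectorField.lieBracket`. -/
instance instLieRingSmoothVF (n : ℕ) : LieRing (smoothVF n) where
  bracket V W := ⟨VectorField.lieBracket ℝ V.1 W.1,
    ContDiff.lieBracket_vectorField (n := ∞) (m := ∞) (smoothVF_contDiff V)
      (smoothVF_contDiff W) (by rfl)⟩
  add_lie U V W := by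
    ext1; funext x
    exact VectorField.lieBracket_add_left (smoothVF_differentiableAt U x)
      (smoothVF_differentiableAt V x)
  lie_add U V W := by
    ext1; funext x
    exact VectorField.lieBracket_add_right (smoothVF_differentiableAt V x)
      (smoothVF_differentiableAt W x)
  lie_self V := by
    ext1
    exact VectorField.lieBracket_self
  leibniz_lie U V W := by
    ext1; funext x
    exact VectorField.leibniz_identity_lieBracket (n := ∞)
      (by rw [minSmoothness_of_isRCLikeNormedField]; exact WithTop.coe_le_coe.2 le_top)
      (smoothVF_contDiff U).contDiffAt
      (smoothVF_contDiff V).contDiffAt (smoothVF_contDiff W).contDiffAt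

instance instLieAlgebraSmoothVF (n : ℕ) : LieAlgebra ℝ (smoothVF n) where
  lie_smul c V W := by
    ext1; funext x
    exact VectorField.lieBracket_const_smul_right (smoothVF_differentiableAt W x)

section Algebra

variable {n m : ℕ}

/-- `𝔞 = Lie{X_1, …, X_m}`, the smallest Lie algebra of smooth vector fields containing the
`X_i`. -/
def lieHull (X : Fin m → smoothVF n) : LieSubalgebra ℝ (smoothVF n) :=
  LieSubalgebra.lieSpan ℝ (smoothVF n) (Set.range X)

/-- The layers `𝔞_1 = span{X_1, …, X_m}`, `𝔞_{k+1} = [𝔞_1, 𝔞_k]` (and `𝔞_0 = 0`). -/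
def layer (X : Fin m → smoothVF n) : ℕ → Submodule ℝ (smoothVF n)
  | 0 => ⊥
  | 1 => Submodule.span ℝ (Set.range X)
  | k + 2 => Submodule.span ℝ
      {W | ∃ U ∈ Submodule.span ℝ (Set.range X), ∃ V ∈ layer X (k + 1), W = ⁅U, V⁆}

end Algebra

/-! ## The Campbell-Baker-Hausdorff operation -/

section CBH

variable {L : Type*} [LieRing L] [LieAlgebra ℝ L]

/-- The right-nested bracket `[a_1, [a_2, … [a_{k-1}, a_k] … ]]` of a word. -/
def nested : List L → L
  | [] => 0
  | [a] => a
  | a :: b :: l => ⁅a, nested (b :: l)⁆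

/-- The homogeneous component of degree `k` of the Campbell-Baker-Hausdorff series, in Dynkin's
form: the sum over all `1 ≤ l ≤ k` and all `(a_1,b_1), …, (a_l,b_l)` in `ℕ²` with `a_i + b_i ≥ 1`
for every `i` and `∑ (a_i + b_i) = k` of
`(-1)^{l+1} / (l · k · ∏ a_i! b_i!) · [X^{a_1} Y^{b_1} ⋯ X^{a_l} Y^{b_l}]`. -/
def dynkinTerm (X Y : L) (k : ℕ) : L :=
  ∑ l ∈ Finset.Icc 1 k,
    ∑ c ∈ Fintype.piFinset (fun _ : Fin l => Finset.range (k + 1) ×ˢ Finset.range (k + 1)) with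
        (∀ i, 1 ≤ (c i).1 + (c i).2) ∧ ∑ i, ((c i).1 + (c i).2) = k,
      ((-1 : ℝ) ^ (l + 1) /
          ((l : ℝ) * (k : ℝ) *
            ∏ i, (((c i).1.factorial : ℝ) * ((c i).2.factorial : ℝ)))) •
        nested ((List.finRange l).flatMap fun i =>
          List.replicate (c i).1 X ++ List.replicate (c i).2 Y)

/-- The Campbell-Baker-Hausdorff operation `X ⋄ Y = X + Y + ½[X,Y] + ⋯` of a nilpotent Lie algebra
(where only finitely many terms of the sum are nonzero). -/
def cbh (X Y : L) : L :=
  ∑ᶠ k : ℕ, dynkinTerm X Y k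

end CBH

/-! ## The lifting construction -/

section Construction

variable {n m p : ℕ}

/-- The point `Ψ^V_1(x)`, where `t ↦ Ψ^V_t(x)` is the (global) integral curve of `V` with
`Ψ^V_0(x) = x`; meaningful when `V` is complete. -/
def flowOne (V : (Fin n → ℝ) → (Fin n → ℝ)) (x : Fin n → ℝ) : Fin n → ℝ :=
  Classical.epsilon (fun γ : ℝ → Fin n → ℝ =>
    γ 0 = x ∧ IsIntegralCurve γ (fun _ => V)) 1

/-- The choices in the construction (`N = n + p` is the dimension of `𝔞`): an ordered basis of `𝔞`
which begins with `X_1, …, X_m` and is adapted to the stratification, and indices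
`i_1 < ⋯ < i_n` such that the values at `0` of the corresponding elements of the basis form a
basis of `ℝ^n`, the other indices being `j_1 < ⋯ < j_p`. -/
structure Frame (X : Fin m → smoothVF n) (p : ℕ) where
  /-- The basis `X_1, …, X_N` of `𝔞`. -/
  basis : Module.Basis (Fin (n + p)) ℝ (lieHull X)
  le : m ≤ n + p
  basis_castLE : ∀ i : Fin m, (basis (Fin.castLE le i) : smoothVF n) = X i
  /-- The degrees `s_1 ≤ ⋯ ≤ s_N`: the `i`-th element of the basis lies in `𝔞_{s_i}`. -/
  deg : Fin (n + p) → ℕ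
  deg_mono : Monotone deg
  span_layer : ∀ k, Submodule.span ℝ
    {W : smoothVF n | ∃ i, deg i = k ∧ W = (basis i : smoothVF n)} = layer X k
  /-- The indices: `i_k = idx (inl k)` and `j_k = idx (inr k)`. -/
  idx : Fin n ⊕ Fin p ≃ Fin (n + p)
  idx_inl_strictMono : StrictMono (fun k => idx (Sum.inl k))
  idx_inr_strictMono : StrictMono (fun k => idx (Sum.inr k))
  linearIndependent_zero :
    LinearIndependent ℝ fun k => (basis (idx (Sum.inl k)) : smoothVF n).1 0

namespace Frame

variable {X : Fin m → smoothVF n} (F : Frame X p)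

/-- The linear isomorphism `Φ(a) = a · X = ∑ a_i X_i` of `ℝ^N` onto `𝔞`. -/
def Phi : (Fin (n + p) → ℝ) ≃ₗ[ℝ] lieHull X :=
  F.basis.equivFun.symm

/-- The group law `a * b = Φ⁻¹(Φ(a) ⋄ Φ(b))` on `ℝ^N`. -/
def mul (a b : Fin (n + p) → ℝ) : Fin (n + p) → ℝ :=
  F.Phi.symm (cbh (F.Phi a) (F.Phi b))

/-- The left-invariant vector field `J_i` of `(ℝ^N, *)` which is `∂/∂a_i` at `0`:
`J_i(a) = d/dt|_{t = 0} (a * (t e_i))`. -/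
def J (i : Fin (n + p)) (a : Fin (n + p) → ℝ) : Fin (n + p) → ℝ :=
  deriv (fun t : ℝ => F.mul a (t • Pi.single i 1)) 0

/-- The map `π(a) = Ψ^{a·X}_1(0)` from `ℝ^N` to `ℝ^n`. -/
def proj (a : Fin (n + p) → ℝ) : Fin n → ℝ :=
  flowOne (F.Phi a : smoothVF n).1 0

/-- The change of variable `T(a) = (π(a), a_{j_1}, …, a_{j_p})`. -/
def T (a : Fin (n + p) → ℝ) : Fin n ⊕ Fin p → ℝ :=
  Sum.elim (F.proj a) (fun k => a (F.idx (Sum.inr k)))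

/-- The law `u ⋆ v = T(T⁻¹(u) * T⁻¹(v))` of the group `𝔾` on `ℝ^n × ℝ^p`. -/
def star (u v : Fin n ⊕ Fin p → ℝ) : Fin n ⊕ Fin p → ℝ :=
  F.T (F.mul (Function.invFun F.T u) (Function.invFun F.T v))

/-- The vector field `Z_i = dT(J_i)` on `ℝ^n × ℝ^p`, the push-forward of `J_i` under the
diffeomorphism `T`. -/
def Z (i : Fin (n + p)) (u : Fin n ⊕ Fin p → ℝ) : Fin n ⊕ Fin p → ℝ :=
  fderiv ℝ F.T (Function.invFun F.T u) (F.J i (Function.invFun F.T u))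

/-- The sub-Laplacian `L_𝔾 = ∑_{k ≤ m} Z_k²`. -/
def subLaplacian : ((Fin n ⊕ Fin p → ℝ) → ℝ) → ((Fin n ⊕ Fin p → ℝ) → ℝ) :=
  sumSq fun k : Fin m => F.Z (Fin.castLE F.le k)

/-- The exponents `σ*_k = s_{j_k}` of the dilations `δ*_lam` of `ℝ^p`. -/
def sigmaStar (k : Fin p) : ℝ :=
  (F.deg (F.idx (Sum.inr k)) : ℝ)

/-- The exponents of the dilations `d_lam(x, ξ) = (δ_lam(x), δ*_lam(ξ))` of `𝔾`. -/
def sigmaProd (σ : Fin n → ℝ) : Fin n ⊕ Fin p → ℝ :=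
  Sum.elim σ F.sigmaStar

/-- The vector fields `Z_1, …, Z_m` are the infinitesimal generators of the right translations
`u ↦ u ⋆ T(t e_k)` of `𝔾` (that is, `Z_k` is the left-invariant vector field determined by the
curve `t ↦ T(t e_k)`), and they are homogeneous of degree `1` for the dilations of `𝔾`. -/
def GeneratesFirstLayer (σ : Fin n → ℝ) : Prop :=
  ∀ k : Fin m,
    (∀ u, HasDerivAt (fun t : ℝ => F.star u (F.T (t • Pi.single (Fin.castLE F.le k) 1)))
      (F.Z (Fin.castLE F.le k) u) 0) ∧
    IsHomogeneousOne (F.sigmaProd σ) (F.Z (Fin.castLE F.le k))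

/-- The homogeneous function `N(ξ) = ∑ |ξ_k|^{1/σ*_k}` on `ℝ^p`. -/
def homNorm (ξ : Fin p → ℝ) : ℝ :=
  ∑ k, |ξ k| ^ (1 / F.sigmaStar k)

/-- The profiles of the cut-offs: `θ ∈ C_0^∞(ℝ^p, [0,1])`, with support in `{N ≤ 2}`, and equal to
`1` on `{N < 1}`. -/
structure IsCutoffProfile (θ : (Fin p → ℝ) → ℝ) : Prop where
  smooth : ContDiff ℝ ∞ θ
  compact : HasCompactSupport θ
  mem_Icc : ∀ ξ, θ ξ ∈ Set.Icc (0 : ℝ) 1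
  support : tsupport θ ⊆ {ξ | F.homNorm ξ ≤ 2}
  eq_one : ∀ ξ, F.homNorm ξ < 1 → θ ξ = 1

/-- The cut-offs `θ_j = θ ∘ δ*_{2^{-j}}`. -/
def cutoff (θ : (Fin p → ℝ) → ℝ) (j : ℕ) : (Fin p → ℝ) → ℝ :=
  fun ξ => θ (dil F.sigmaStar ((2 : ℝ) ^ (-(j : ℤ))) ξ)

end Frame

end Construction

end Saturation

end

/-! The engine is `Homog.eq_zero_of_neg`: as all weights are positive, a continuous function
homogeneous of negative degree vanishes. A partial derivative lowers the degree by the weight of its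
variable, so a smooth homogeneous function of degree d involves only variables of weight at most d
(`Homog.eq_of_agree`). A general element of 𝔞 is not homogeneous, hence functions are filtered by
degree (`fil`), and every element of 𝔞 lowers the filtration by one (`lieHull_le_filVF`). Long
brackets therefore vanish (`nested_eq_zero`), the fields a·X are triangular and have global integral
curves (`exists_integralCurve`), and Taylor's formula along these curves is a finite sum
(`apply_integralCurve`). In particular π is polynomial in a.

Lifting. Differentiating that finite sum gives dπ_a(c) as the value at π(a) of φ(ad(a·X))(c·X),
where φ(z) = (1 - e^{-z})/z (`fderiv_proj`). Differentiating Dynkin's formula for (a·X) ⋄ tX_i at t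
= 0 shows that J_i(a)·X is obtained from X_i by the series z/(1 - e^{-z}) in ad(a·X)
(`hasDerivAt_cbh`). Only words with a single second letter contribute, and generating functions
count them (`coeff_sum_headSeries`). The two series are inverse to each other, so dπ(J_i) = X_i ∘ π
(`fderiv_proj_J`). The map T commutes with the dilations and has invertible differential at 0;
dilations spread the local inverse to the whole space. So Z_k is X_k plus a part in the ξ
directions, and its i-th component is homogeneous of degree w_i - 1.

Saturability. Expand Z_k² over pairs of variables (`act_act_eq_sum`). The (x,x) pairs rebuild the
square of X_k, and the others form R. In R^* the zero-order terms have negative degree, so they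
vanish. A pure x-derivative would carry ∂/∂ξ_j of the product of a component of X_k and the
ξ_j-component of Z_k; this is zero, because the first factor is free of ξ and the derivative of the
second has degree -1. Every remaining coefficient has degree at most the weight of the ξ-derivative
it accompanies, possibly after a factor depending on x alone is split off, and scaling gives the
uniform bound (`termBound_of_homog`).

Existence of the choices. The layers lie in eigenspaces, for distinct eigenvalues, of the
push-forward by one fixed dilation. They are thus independent, finite-dimensional and zero beyond
the largest weight, and bases of them can be concatenated. -/

open scoped ContDiff

noncomputable section
namespace Saturation

/-! ## Dilations and homogeneous functions -/

section Homogeneous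

variable {ι : Type} [Fintype ι] [DecidableEq ι]

/-- The function `f` is homogeneous of degree `d` for the dilations `dil w`. -/
def Homog (w : ι → ℝ) (d : ℝ) (f : (ι → ℝ) → ℝ) : Prop :=
  ∀ lam : ℝ, 0 < lam → ∀ x, f (dil w lam x) = lam ^ d * f x

omit [DecidableEq ι] [Fintype ι] in
theorem dil_apply (w : ι → ℝ) (lam : ℝ) (x : ι → ℝ) (i : ι) : dil w lam x i = lam ^ w i * x i :=
  rfl

omit [DecidableEq ι] [Fintype ι] in
theorem dil_add (w : ι → ℝ) (lam : ℝ) (x y : ι → ℝ) :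
    dil w lam (x + y) = dil w lam x + dil w lam y := by
  funext i; simp [dil, mul_add]

omit [DecidableEq ι] [Fintype ι] in
theorem dil_smul (w : ι → ℝ) (lam c : ℝ) (x : ι → ℝ) :
    dil w lam (c • x) = c • dil w lam x := by
  funext i; simp [dil, mul_left_comm]

omit [DecidableEq ι] [Fintype ι] in
theorem dil_zero (w : ι → ℝ) (lam : ℝ) : dil w lam 0 = 0 := by
  funext i; simp [dil]

/-- The dilation as a continuous linear map. -/
def dilL (w : ι → ℝ) (lam : ℝ) : (ι → ℝ) →L[ℝ] (ι → ℝ) :=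
  LinearMap.toContinuousLinearMap
    { toFun := dil w lam
      map_add' := dil_add w lam
      map_smul' := fun c x => dil_smul w lam c x }

omit [DecidableEq ι] in
@[simp] theorem dilL_apply (w : ι → ℝ) (lam : ℝ) (x : ι → ℝ) : dilL w lam x = dil w lam x := rfl

omit [DecidableEq ι] in
theorem contDiff_dil (w : ι → ℝ) (lam : ℝ) : ContDiff ℝ ∞ (dil w lam) :=
  (dilL w lam).contDiff

omit [DecidableEq ι] in
theorem hasFDerivAt_dil (w : ι → ℝ) (lam : ℝ) (x : ι → ℝ) :
    HasFDerivAt (dil w lam) (dilL w lam) x :=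
  (dilL w lam).hasFDerivAt

omit [Fintype ι] in
theorem dil_single (w : ι → ℝ) (lam : ℝ) (i : ι) :
    dil w lam (Pi.single i 1) = lam ^ w i • Pi.single i (1 : ℝ) := by
  funext j
  by_cases h : j = i
  · subst h; simp [dil]
  · simp [dil, h]

omit [DecidableEq ι] [Fintype ι] in
theorem dil_dil (w : ι → ℝ) {a b : ℝ} (ha : 0 < a) (hb : 0 < b) (x : ι → ℝ) :
    dil w a (dil w b x) = dil w (a * b) x := by
  funext i
  simp only [dil, Real.mul_rpow ha.le hb.le]; ring

omit [DecidableEq ι] [Fintype ι] in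
theorem dil_one (w : ι → ℝ) (x : ι → ℝ) : dil w 1 x = x := by
  funext i; simp [dil]

omit [DecidableEq ι] [Fintype ι] in
theorem dil_inv_dil (w : ι → ℝ) {a : ℝ} (ha : 0 < a) (x : ι → ℝ) :
    dil w a⁻¹ (dil w a x) = x := by
  rw [dil_dil w (inv_pos.2 ha) ha, inv_mul_cancel₀ ha.ne', dil_one]

omit [DecidableEq ι] [Fintype ι] in
theorem dil_dil_inv (w : ι → ℝ) {a : ℝ} (ha : 0 < a) (x : ι → ℝ) :
    dil w a (dil w a⁻¹ x) = x := by
  rw [dil_dil w ha (inv_pos.2 ha), mul_inv_cancel₀ ha.ne', dil_one]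

open Filter Topology in
omit [DecidableEq ι] [Fintype ι] in
theorem tendsto_dil_zero {w : ι → ℝ} (hw : ∀ i, 0 < w i) (x : ι → ℝ) :
    Tendsto (fun lam : ℝ => dil w lam x) (𝓝[>] 0) (𝓝 0) := by
  rw [tendsto_pi_nhds]
  intro i
  have h1 : Tendsto (fun lam : ℝ => lam ^ w i) (𝓝[>] 0) (𝓝 0) := by
    have := (Real.continuousAt_rpow_const (0 : ℝ) (w i) (Or.inr (hw i).le)).tendsto
    rw [Real.zero_rpow (hw i).ne'] at this
    exact this.mono_left nhdsWithin_le_nhds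
  simpa [dil] using h1.mul_const (x i)

open Filter Topology in
omit [DecidableEq ι] [Fintype ι] in
/-- A continuous homogeneous function of negative degree vanishes. -/
theorem Homog.eq_zero_of_neg {w : ι → ℝ} (hw : ∀ i, 0 < w i) {d : ℝ} (hd : d < 0)
    {f : (ι → ℝ) → ℝ} (hf : Continuous f) (h : Homog w d f) : f = 0 := by
  funext x
  -- By homogeneity this expression is constantly f(x); since -d > 0 it also tends to 0 · f(0).
  have h1 : Tendsto (fun lam : ℝ => lam ^ (-d) * f (dil w lam x)) (𝓝[>] 0) (𝓝 (0 * f 0)) := by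
    refine Tendsto.mul ?_ ((hf.tendsto 0).comp (tendsto_dil_zero hw x))
    have := (Real.continuousAt_rpow_const (0 : ℝ) (-d) (Or.inr (by linarith))).tendsto
    rw [Real.zero_rpow (by linarith)] at this
    exact this.mono_left nhdsWithin_le_nhds
  have h2 : Tendsto (fun lam : ℝ => lam ^ (-d) * f (dil w lam x)) (𝓝[>] 0) (𝓝 (f x)) := by
    refine tendsto_const_nhds.congr' ?_
    filter_upwards [self_mem_nhdsWithin] with lam hlam
    have hlam : (0 : ℝ) < lam := hlam
    rw [h lam hlam x, ← mul_assoc, ← Real.rpow_add hlam]; simp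
  simpa using tendsto_nhds_unique h2 h1

theorem pd_comp_dil (w : ι → ℝ) (lam : ℝ) {f : (ι → ℝ) → ℝ} (hf : Differentiable ℝ f) (i : ι)
    (x : ι → ℝ) : pd i (fun y => f (dil w lam y)) x = lam ^ w i * pd i f (dil w lam x) := by
  have : HasFDerivAt (fun y => f (dil w lam y)) ((fderiv ℝ f (dil w lam x)).comp (dilL w lam)) x :=
    (hf (dil w lam x)).hasFDerivAt.comp x (hasFDerivAt_dil w lam x)
  simp [pd, this.fderiv, dil_single]

theorem pd_const_mul {f : (ι → ℝ) → ℝ} (hf : Differentiable ℝ f) (c : ℝ) (i : ι) :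
    pd i (fun y => c * f y) = fun x => c * pd i f x := by
  funext x
  simp [pd, fderiv_const_mul (hf x)]

/-- Differentiation in the `i`-th variable lowers the degree by `w i`. -/
theorem Homog.pd {w : ι → ℝ} {d : ℝ} {f : (ι → ℝ) → ℝ} (hf : Differentiable ℝ f)
    (h : Homog w d f) (i : ι) : Homog w (d - w i) (pd i f) := by
  intro lam hlam x
  have h1 : (fun y => f (dil w lam y)) = fun y => lam ^ d * f y := funext (h lam hlam)
  have h2 := pd_comp_dil w lam hf i x
  rw [h1, pd_const_mul hf] at h2
  have : lam ^ w i ≠ 0 := (Real.rpow_pos_of_pos hlam _).ne'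
  rw [Real.rpow_sub hlam]
  field_simp
  linarith

omit [DecidableEq ι] [Fintype ι] in
theorem Homog.mul {w : ι → ℝ} {d e : ℝ} {f g : (ι → ℝ) → ℝ} (hf : Homog w d f)
    (hg : Homog w e g) : Homog w (d + e) (fun x => f x * g x) := by
  intro lam hlam x
  simp only [hf lam hlam, hg lam hlam, Real.rpow_add hlam]; ring

omit [DecidableEq ι] [Fintype ι] in
theorem homog_coord (w : ι → ℝ) (i : ι) : Homog w (w i) (fun x => x i) := fun _ _ _ => rfl

theorem fderiv_eq_sum_pd (f : (ι → ℝ) → ℝ) (x v : ι → ℝ) :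
    fderiv ℝ f x v = ∑ i, v i * pd i f x := by
  have h : v = ∑ i, v i • Pi.single i (1 : ℝ) := by
    conv_lhs => rw [pi_eq_sum_univ' v]
  conv_lhs => rw [h]
  simp [pd]

theorem contDiff_pd {f : (ι → ℝ) → ℝ} (hf : ContDiff ℝ ∞ f) (i : ι) : ContDiff ℝ ∞ (pd i f) :=
  (hf.fderiv_right (m := ∞) (by simp)).clm_apply contDiff_const

omit [DecidableEq ι] in
theorem contDiff_act {f : (ι → ℝ) → ℝ} (hf : ContDiff ℝ ∞ f) {V : (ι → ℝ) → (ι → ℝ)}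
    (hV : ContDiff ℝ ∞ V) : ContDiff ℝ ∞ (act V f) :=
  (hf.fderiv_right (m := ∞) (by simp)).clm_apply hV

omit [DecidableEq ι] [Fintype ι] in
theorem act_coord (V : (ι → ℝ) → (ι → ℝ)) (i : ι) : act V (fun x => x i) = fun x => V x i := by
  funext x
  simp only [act]
  have : HasFDerivAt (fun x : ι → ℝ => x i) (ContinuousLinearMap.proj (R := ℝ) i) x :=
    (ContinuousLinearMap.proj (R := ℝ) (φ := fun _ : ι => ℝ) i).hasFDerivAt
  rw [this.fderiv]; rfl

/-- A homogeneous smooth function of degree `≤ r` does not depend on the variables of weight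
greater than `r`. -/
theorem Homog.eq_of_agree {w : ι → ℝ} (hw : ∀ i, 0 < w i) {d : ℝ} {f : (ι → ℝ) → ℝ}
    (hf : ContDiff ℝ ∞ f) (h : Homog w d f) {x y : ι → ℝ} (hxy : ∀ i, w i ≤ d → x i = y i) :
    f x = f y := by
  have hd : Differentiable ℝ f := hf.differentiable (by simp)
  -- On the segment from x to y, coordinates of weight at most d do not move, and the partial
  -- derivatives in the others have negative degree, so they vanish.
  have key : ∀ t : ℝ, HasDerivAt (fun t : ℝ => f (x + t • (y - x))) 0 t := by
    intro t
    have h1 : HasDerivAt (fun t : ℝ => x + t • (y - x)) (y - x) t := by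
      simpa using ((hasDerivAt_id t).smul_const (y - x)).const_add x
    have h2 := (hd (x + t • (y - x))).hasFDerivAt.comp_hasDerivAt t h1
    have h0 : fderiv ℝ f (x + t • (y - x)) (y - x) = 0 := by
      rw [fderiv_eq_sum_pd]
      apply Finset.sum_eq_zero
      intro i _
      by_cases hi : w i ≤ d
      · simp [hxy i hi]
      · have : Saturation.pd i f = 0 :=
          (h.pd hd i).eq_zero_of_neg hw (by linarith) (contDiff_pd hf i).continuous
        simp [this]
    rw [← h0]
    exact h2
  have := is_const_of_deriv_eq_zero (fun t => (key t).differentiableAt) (fun t => (key t).deriv) 0 1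
  simpa using this

end Homogeneous

/-! ## Vector fields as operators on smooth functions -/

section Operators

variable {n : ℕ}

/-- The smooth functions on `ℝ^n`. -/
def smoothFun (n : ℕ) : Submodule ℝ ((Fin n → ℝ) → ℝ) where
  carrier := {f | ContDiff ℝ ∞ f}
  add_mem' := fun {f g} (hf : ContDiff ℝ ∞ f) (hg : ContDiff ℝ ∞ g) => hf.add hg
  zero_mem' := (contDiff_const : ContDiff ℝ ∞ fun _ : Fin n → ℝ => (0 : ℝ))
  smul_mem' := fun c f (hf : ContDiff ℝ ∞ f) => hf.const_smul c

theorem smoothFun_contDiff (f : smoothFun n) : ContDiff ℝ ∞ f.1 := f.2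

theorem smoothFun_differentiable (f : smoothFun n) : Differentiable ℝ f.1 :=
  (smoothFun_contDiff f).differentiable (by simp)

/-- A smooth vector field as an operator on smooth functions. -/
def op (V : smoothVF n) : Module.End ℝ (smoothFun n) where
  toFun f := ⟨act V.1 f.1, contDiff_act (smoothFun_contDiff f) (smoothVF_contDiff V)⟩
  map_add' f g := by
    ext1; funext x
    have := fderiv_add (smoothFun_differentiable f x) (smoothFun_differentiable g x)
    change fderiv ℝ (f.1 + g.1) x (V.1 x) = _
    rw [this]; rfl
  map_smul' c f := by
    ext1; funext x
    have := fderiv_const_smul (smoothFun_differentiable f x) c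
    change fderiv ℝ (c • f.1) x (V.1 x) = _
    rw [this]; rfl

theorem op_apply_coe (V : smoothVF n) (f : smoothFun n) : (op V f).1 = act V.1 f.1 := rfl

/-- In the commutator the second derivatives of f cancel by symmetry, which leaves the bracket. All
later computations with brackets are done with operators. -/
theorem op_lie_apply (V W : smoothVF n) (f : smoothFun n) :
    op ⁅V, W⁆ f = op V (op W f) - op W (op V f) := by
  ext1; funext x
  change fderiv ℝ f.1 x (fderiv ℝ W.1 x (V.1 x) - fderiv ℝ V.1 x (W.1 x)) =
    fderiv ℝ (fun y => fderiv ℝ f.1 y (W.1 y)) x (V.1 x) -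
      fderiv ℝ (fun y => fderiv ℝ f.1 y (V.1 y)) x (W.1 x)
  have hf2 : DifferentiableAt ℝ (fderiv ℝ f.1) x :=
    (((smoothFun_contDiff f).fderiv_right (m := 1) (by norm_cast)).differentiable (by simp)) x
  have e : ∀ U : smoothVF n, ∀ v, fderiv ℝ (fun y => fderiv ℝ f.1 y (U.1 y)) x v =
      fderiv ℝ f.1 x (fderiv ℝ U.1 x v) + fderiv ℝ (fderiv ℝ f.1) x v (U.1 x) := by
    intro U v
    rw [fderiv_clm_apply hf2 (smoothVF_differentiableAt U x)]
    simp
  have hs : fderiv ℝ (fderiv ℝ f.1) x (V.1 x) (W.1 x) = fderiv ℝ (fderiv ℝ f.1) x (W.1 x) (V.1 x) := by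
    have := (smoothFun_contDiff f).contDiffAt (x := x) |>.isSymmSndFDerivAt (by
      rw [minSmoothness_of_isRCLikeNormedField]; exact WithTop.coe_le_coe.2 le_top)
    exact this _ _
  rw [e, e, hs, map_sub]; ring

/-- The action of vector fields on functions, as a linear map. -/
def opL (n : ℕ) : smoothVF n →ₗ[ℝ] Module.End ℝ (smoothFun n) where
  toFun := op
  map_add' V W := by
    ext f x
    change fderiv ℝ f.1 x (V.1 x + W.1 x) = _
    rw [map_add]; rfl
  map_smul' c V := by
    ext f x
    change fderiv ℝ f.1 x (c • V.1 x) = _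
    rw [map_smul]; rfl

theorem op_add (V W : smoothVF n) : op (V + W) = op V + op W := map_add (opL n) V W
theorem op_smul (c : ℝ) (V : smoothVF n) : op (c • V) = c • op V := map_smul (opL n) c V
theorem op_zero : op (0 : smoothVF n) = 0 := map_zero (opL n)

/-- The coordinate functions. -/
def coordFun (j : Fin n) : smoothFun n :=
  ⟨fun x => x j, (contDiff_apply ℝ ℝ j : ContDiff ℝ ∞ fun x : Fin n → ℝ => x j)⟩

theorem op_coordFun (V : smoothVF n) (j : Fin n) (x : Fin n → ℝ) :
    (op V (coordFun j)).1 x = V.1 x j :=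
  congrFun (act_coord V.1 j) x

theorem smoothVF_ext_op {V W : smoothVF n} (h : ∀ j, op V (coordFun j) = op W (coordFun j)) :
    V = W := by
  ext1; funext x; funext j
  rw [← op_coordFun, h, op_coordFun]

/-- The smooth homogeneous functions of degree `d`. -/
def homogFun (w : Fin n → ℝ) (d : ℝ) : Submodule ℝ (smoothFun n) where
  carrier := {f | Homog w d f.1}
  add_mem' := by
    intro f g hf hg lam hlam x
    change f.1 _ + g.1 _ = _ * (f.1 x + g.1 x)
    rw [hf lam hlam, hg lam hlam]; ring
  zero_mem' := by
    intro lam hlam x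
    change (0 : ℝ) = _ * 0
    simp
  smul_mem' := by
    intro c f hf lam hlam x
    change c * f.1 _ = _ * (c * f.1 x)
    rw [hf lam hlam]; ring

/-- The vector field `V` is homogeneous of degree `k`, as an operator. -/
def HomogVF (w : Fin n → ℝ) (k : ℝ) (V : smoothVF n) : Prop :=
  ∀ d, ∀ f ∈ homogFun w d, op V f ∈ homogFun w (d - k)

/-- The filtration of the smooth functions by the degree. -/
def fil (w : Fin n → ℝ) (r : ℝ) : Submodule ℝ (smoothFun n) :=
  ⨆ d : Set.Iic r, homogFun w d

theorem homogFun_le_fil (w : Fin n → ℝ) {d r : ℝ} (h : d ≤ r) : homogFun w d ≤ fil w r :=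
  le_iSup (fun d : Set.Iic r => homogFun w d) ⟨d, h⟩

theorem fil_mono (w : Fin n → ℝ) {r s : ℝ} (h : r ≤ s) : fil w r ≤ fil w s :=
  iSup_le fun d => homogFun_le_fil w (d.2.trans h)

theorem homogFun_eq_bot {w : Fin n → ℝ} (hw : ∀ i, 0 < w i) {d : ℝ} (hd : d < 0) :
    homogFun w d = ⊥ := by
  rw [eq_bot_iff]
  intro f hf
  rw [Submodule.mem_bot]
  ext1
  exact Homog.eq_zero_of_neg hw hd (smoothFun_contDiff f).continuous hf

theorem fil_eq_bot {w : Fin n → ℝ} (hw : ∀ i, 0 < w i) {r : ℝ} (hr : r < 0) : fil w r = ⊥ := by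
  rw [eq_bot_iff]
  exact iSup_le fun d => (homogFun_eq_bot hw (lt_of_le_of_lt d.2 hr)).le

theorem coordFun_mem_homogFun (w : Fin n → ℝ) (j : Fin n) : coordFun j ∈ homogFun w (w j) :=
  homog_coord w j

theorem coordFun_mem_fil (w : Fin n → ℝ) (j : Fin n) : coordFun j ∈ fil w (w j) :=
  homogFun_le_fil w le_rfl (coordFun_mem_homogFun w j)

theorem fil_eq_of_agree {w : Fin n → ℝ} (hw : ∀ i, 0 < w i) {r : ℝ} {f : smoothFun n}
    (hf : f ∈ fil w r) {x y : Fin n → ℝ} (hxy : ∀ i, w i ≤ r → x i = y i) : f.1 x = f.1 y := by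
  induction hf using Submodule.iSup_induction' with
  | mem d f hf =>
    exact Homog.eq_of_agree hw (smoothFun_contDiff f) hf fun i hi => hxy i (hi.trans d.2)
  | zero => rfl
  | add f g _ _ hf hg =>
    change f.1 x + g.1 x = f.1 y + g.1 y
    rw [hf, hg]

/-- The filtration of the smooth vector fields: those which lower the degree of functions by at
least `k`. -/
def filVF (w : Fin n → ℝ) (k : ℝ) : Submodule ℝ (smoothVF n) where
  carrier := {V | ∀ r, ∀ f ∈ fil w r, op V f ∈ fil w (r - k)}
  add_mem' := by
    intro V W hV hW r f hf
    rw [op_add]; exact add_mem (hV r f hf) (hW r f hf)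
  zero_mem' := by
    intro r f _
    rw [op_zero]; exact zero_mem _
  smul_mem' := by
    intro c V hV r f hf
    rw [op_smul]; exact Submodule.smul_mem _ c (hV r f hf)

theorem HomogVF.mem_filVF {w : Fin n → ℝ} {k : ℝ} {V : smoothVF n} (h : HomogVF w k V) :
    V ∈ filVF w k := by
  intro r f hf
  induction hf using Submodule.iSup_induction' with
  | mem d f hf => exact homogFun_le_fil w (by have : d.1 ≤ r := d.2; linarith) (h d f hf)
  | zero => rw [map_zero]; exact zero_mem _
  | add f g _ _ hf hg => rw [map_add]; exact add_mem hf hg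

theorem filVF_lie {w : Fin n → ℝ} {k l : ℝ} {V W : smoothVF n} (hV : V ∈ filVF w k)
    (hW : W ∈ filVF w l) : ⁅V, W⁆ ∈ filVF w (k + l) := by
  intro r f hf
  rw [op_lie_apply]
  refine sub_mem ?_ ?_
  · have := hV _ _ (hW r f hf); rwa [sub_sub, add_comm l k] at this
  · have := hW _ _ (hV r f hf); rwa [sub_sub] at this

theorem filVF_anti (w : Fin n → ℝ) {k l : ℝ} (h : k ≤ l) : filVF w l ≤ filVF w k :=
  fun _ hV r f hf => fil_mono w (by linarith) (hV r f hf)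

/-- Such a field sends every coordinate function into negative degree, hence to zero. This is the
source of all nilpotency. -/
theorem filVF_eq_zero {w : Fin n → ℝ} (hw : ∀ i, 0 < w i) {k : ℝ} (hk : ∀ i, w i < k)
    {V : smoothVF n} (hV : V ∈ filVF w k) : V = 0 := by
  refine smoothVF_ext_op fun j => ?_
  have := hV _ _ (coordFun_mem_fil w j)
  rw [fil_eq_bot hw (by linarith [hk j]), Submodule.mem_bot] at this
  rw [this, op_zero]; rfl

theorem homogVF_lie {w : Fin n → ℝ} {k l : ℝ} {V W : smoothVF n} (hV : HomogVF w k V)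
    (hW : HomogVF w l W) : HomogVF w (k + l) ⁅V, W⁆ := by
  intro r f hf
  rw [op_lie_apply]
  refine sub_mem ?_ ?_
  · have := hV _ _ (hW r f hf); rwa [sub_sub, add_comm l k] at this
  · have := hW _ _ (hV r f hf); rwa [sub_sub] at this

theorem IsHomogeneousOne.homogVF {w : Fin n → ℝ} {V : smoothVF n}
    (h : IsHomogeneousOne w V.1) : HomogVF w 1 V := by
  intro d f hf lam hlam x
  have h1 := h lam hlam f.1 (smoothFun_contDiff f) x
  have h2 : f.1 ∘ dil w lam = (lam ^ d • f : smoothFun n).1 := by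
    funext y; exact hf lam hlam y
  rw [h2, ← op_apply_coe, map_smul] at h1
  change lam ^ d * (op V f).1 x = lam * (op V f).1 _ at h1
  rw [Real.rpow_sub hlam, Real.rpow_one]
  field_simp
  linarith

/-- The Lie algebra generated by homogeneous vector fields of degree one lowers degrees. -/
theorem lieHull_le_filVF {m : ℕ} {w : Fin n → ℝ} {X : Fin m → smoothVF n}
    (hX : ∀ i, HomogVF w 1 (X i)) {V : smoothVF n} (hV : V ∈ lieHull X) : V ∈ filVF w 1 := by
  let A : LieSubalgebra ℝ (smoothVF n) :=
    { filVF w 1 with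
      lie_mem' := fun {U V} hU hV =>
        filVF_anti w (by norm_num) (filVF_lie (k := 1) (l := 1) hU hV) }
  have : lieHull X ≤ A := by
    refine LieSubalgebra.lieSpan_le.2 ?_
    rintro _ ⟨i, rfl⟩
    exact (hX i).mem_filVF
  exact this hV

/-! ### Push-forward by dilations -/

/-- The composition of a function with a dilation. -/
def compDil (w : Fin n → ℝ) (lam : ℝ) (f : smoothFun n) : smoothFun n :=
  ⟨fun x => f.1 (dil w lam x), (smoothFun_contDiff f).comp (contDiff_dil w lam)⟩

/-- `W` is the push-forward of `V` by the dilation `dil w lam`. -/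
def DilRel (w : Fin n → ℝ) (lam : ℝ) (V W : smoothVF n) : Prop :=
  ∀ f, op V (compDil w lam f) = compDil w lam (op W f)

theorem DilRel.add {w : Fin n → ℝ} {lam : ℝ} {V W V' W' : smoothVF n} (h : DilRel w lam V W)
    (h' : DilRel w lam V' W') : DilRel w lam (V + V') (W + W') := by
  intro f
  rw [op_add, op_add, LinearMap.add_apply, LinearMap.add_apply, h f, h' f]; rfl

theorem DilRel.smul {w : Fin n → ℝ} {lam : ℝ} {V W : smoothVF n} (h : DilRel w lam V W)
    (c : ℝ) : DilRel w lam (c • V) (c • W) := by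
  intro f
  rw [op_smul, op_smul, LinearMap.smul_apply, LinearMap.smul_apply, h f]; rfl

theorem DilRel.zero {w : Fin n → ℝ} {lam : ℝ} : DilRel w lam (0 : smoothVF n) 0 := by
  intro f
  rw [op_zero]; rfl

theorem DilRel.sum {κ : Type*} {w : Fin n → ℝ} {lam : ℝ} (s : Finset κ) {V W : κ → smoothVF n}
    (h : ∀ i, DilRel w lam (V i) (W i)) : DilRel w lam (∑ i ∈ s, V i) (∑ i ∈ s, W i) := by
  classical
  induction s using Finset.induction_on with
  | empty => exact DilRel.zero
  | insert a s ha ih => rw [Finset.sum_insert ha, Finset.sum_insert ha]; exact (h a).add ih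

theorem DilRel.lie {w : Fin n → ℝ} {lam : ℝ} {V W V' W' : smoothVF n} (h : DilRel w lam V W)
    (h' : DilRel w lam V' W') : DilRel w lam ⁅V, V'⁆ ⁅W, W'⁆ := by
  intro f
  rw [op_lie_apply, op_lie_apply, h f, h' f, h, h']; rfl

/-- The dilation is invertible, so the push-forward is determined. This turns push-forward relations
into equalities of fields, and then of coordinates in 𝔞. -/
theorem DilRel.unique {w : Fin n → ℝ} {lam : ℝ} (hlam : 0 < lam) {V W W' : smoothVF n}
    (h : DilRel w lam V W) (h' : DilRel w lam V W') : W = W' := by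
  refine smoothVF_ext_op fun j => ?_
  ext1; funext x
  have h1 := (h (coordFun j)).symm.trans (h' (coordFun j))
  have h2 := congrFun (congrArg Subtype.val h1) (dil w lam⁻¹ x)
  simpa only [compDil, dil_dil_inv w hlam] using h2

/-- The j-th component of V is V applied to the j-th coordinate function, so it has degree `w j -
k`. -/
theorem HomogVF.dil_apply {w : Fin n → ℝ} {k : ℝ} {V : smoothVF n} (h : HomogVF w k V)
    {lam : ℝ} (hlam : 0 < lam) (x : Fin n → ℝ) :
    dil w lam (V.1 x) = lam ^ k • V.1 (dil w lam x) := by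
  funext j
  have := h _ _ (coordFun_mem_homogFun w j) lam hlam x
  rw [op_coordFun, op_coordFun] at this
  simp only [Saturation.dil_apply, Pi.smul_apply, smul_eq_mul]
  rw [this, ← mul_assoc, ← Real.rpow_add hlam]; simp

theorem HomogVF.dilRel {w : Fin n → ℝ} {k : ℝ} {V : smoothVF n} (h : HomogVF w k V)
    {lam : ℝ} (hlam : 0 < lam) : DilRel w lam V (lam ^ k • V) := by
  intro f
  ext1; funext x
  rw [op_smul]
  change fderiv ℝ (fun y => f.1 (dil w lam y)) x (V.1 x) =
    lam ^ k * fderiv ℝ f.1 (dil w lam x) (V.1 (dil w lam x))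
  have : HasFDerivAt (fun y => f.1 (dil w lam y))
      ((fderiv ℝ f.1 (dil w lam x)).comp (dilL w lam)) x :=
    (smoothFun_differentiable f (dil w lam x)).hasFDerivAt.comp x (hasFDerivAt_dil w lam x)
  rw [this.fderiv]
  simp [h.dil_apply hlam]

end Operators

/-! ## Integral curves of degree-lowering vector fields -/

section Flow

variable {n : ℕ}

/-- The Picard iterates for the integral curve of `V` starting at `x₀`. -/
def picardIter (V : (Fin n → ℝ) → (Fin n → ℝ)) (x₀ : Fin n → ℝ) : ℕ → ℝ → Fin n → ℝ
  | 0 => fun _ => x₀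
  | k + 1 => fun t j => x₀ j + ∫ s in (0 : ℝ)..t, V (picardIter V x₀ k s) j

theorem continuous_picardIter {V : (Fin n → ℝ) → (Fin n → ℝ)} (hV : Continuous V)
    (x₀ : Fin n → ℝ) (k : ℕ) : Continuous (picardIter V x₀ k) := by
  induction k with
  | zero => exact continuous_const
  | succ k ih =>
    refine continuous_pi fun j => ?_
    have hc : Continuous fun s => V (picardIter V x₀ k s) j :=
      (continuous_apply j).comp (hV.comp ih)
    exact continuous_const.add
      (intervalIntegral.continuous_primitive (fun a b => hc.intervalIntegrable a b) 0)

theorem coord_mem_fil {w : Fin n → ℝ} {V : smoothVF n} (hV : V ∈ filVF w 1) (j : Fin n) :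
    op V (coordFun j) ∈ fil w (w j - 1) :=
  hV _ _ (coordFun_mem_fil w j)

/-- The j-th component of V only sees variables of weight at most `w j - 1`. Hence each Picard step
freezes the components in a further unit range of weights. -/
theorem picardIter_stable {w : Fin n → ℝ} (hw : ∀ i, 0 < w i) {V : smoothVF n}
    (hV : V ∈ filVF w 1) (x₀ : Fin n → ℝ) (k : ℕ) :
    ∀ j, w j ≤ k → ∀ t, picardIter V.1 x₀ (k + 1) t j = picardIter V.1 x₀ k t j := by
  induction k with
  | zero => intro j hj; have := hw j; norm_num at hj; linarith
  | succ k ih =>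
    intro j hj t
    change x₀ j + (∫ s in (0 : ℝ)..t, V.1 (picardIter V.1 x₀ (k + 1) s) j) =
      x₀ j + ∫ s in (0 : ℝ)..t, V.1 (picardIter V.1 x₀ k s) j
    congr 2
    funext s
    rw [← op_coordFun, ← op_coordFun]
    refine fil_eq_of_agree hw (coord_mem_fil hV j) fun i hi => ih i ?_ s
    push_cast at hj; linarith

theorem exists_integralCurve {w : Fin n → ℝ} (hw : ∀ i, 0 < w i) {V : smoothVF n}
    (hV : V ∈ filVF w 1) (x₀ : Fin n → ℝ) :
    ∃ γ : ℝ → Fin n → ℝ, γ 0 = x₀ ∧ IsIntegralCurve γ (fun _ => V.1) := by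
  obtain ⟨K, hK⟩ : ∃ K : ℕ, ∀ j, w j ≤ K := by
    obtain ⟨K, hK⟩ := exists_nat_ge (∑ j, w j)
    exact ⟨K, fun j => (Finset.single_le_sum (fun i _ => (hw i).le) (Finset.mem_univ j)).trans hK⟩
  have hc := (smoothVF_contDiff V).continuous
  -- `K` dominates every weight, so iterates `K` and `K + 1` coincide: the iteration has reached a
  -- fixed point, defined for all times.
  refine ⟨picardIter V.1 x₀ (K + 1), ?_, ?_⟩
  · funext j; simp [picardIter]
  · intro t
    rw [hasDerivAt_pi]
    intro j
    have hcj : Continuous fun s => V.1 (picardIter V.1 x₀ K s) j :=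
      (continuous_apply j).comp (hc.comp (continuous_picardIter hc x₀ K))
    have h1 : HasDerivAt (fun t => x₀ j + ∫ s in (0 : ℝ)..t, V.1 (picardIter V.1 x₀ K s) j)
        (V.1 (picardIter V.1 x₀ K t) j) t :=
      (intervalIntegral.integral_hasDerivAt_right (hcj.intervalIntegrable _ _)
        (hcj.stronglyMeasurableAtFilter _ _) hcj.continuousAt).const_add _
    have h2 : picardIter V.1 x₀ (K + 1) t = picardIter V.1 x₀ K t :=
      funext fun i => picardIter_stable hw hV x₀ K i (hK i) t
    rw [h2]
    exact h1

/-- The truncated exponential series `∑_{k < K} t^k / k! c_k`. -/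
def expSum (c : ℕ → ℝ) (K : ℕ) (t : ℝ) : ℝ :=
  ∑ k ∈ Finset.range K, t ^ k / k.factorial * c k

theorem hasDerivAt_expSum (c : ℕ → ℝ) (K : ℕ) (t : ℝ) :
    HasDerivAt (expSum c (K + 1)) (expSum (fun k => c (k + 1)) K t) t := by
  have h : expSum c (K + 1) =
      fun t => (∑ k ∈ Finset.range K, t ^ (k + 1) / (k + 1).factorial * c (k + 1)) + c 0 := by
    funext t
    rw [expSum, Finset.sum_range_succ']; simp
  rw [h]
  refine HasDerivAt.add_const _ ?_
  refine HasDerivAt.fun_sum fun k _ => ?_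
  refine (((hasDerivAt_pow (k + 1) t).div_const ((k + 1).factorial : ℝ)).mul_const
    (c (k + 1))).congr_deriv ?_
  rw [Nat.factorial_succ]
  have : (k.factorial : ℝ) ≠ 0 := by positivity
  push_cast
  field_simp

theorem expSum_zero (c : ℕ → ℝ) (K : ℕ) : expSum c (K + 1) 0 = c 0 := by
  rw [expSum, Finset.sum_range_succ']; simp

theorem eq_of_hasDerivAt_eq {f g f' : ℝ → ℝ} (hf : ∀ t, HasDerivAt f (f' t) t)
    (hg : ∀ t, HasDerivAt g (f' t) t) (h0 : f 0 = g 0) (t : ℝ) : f t = g t := by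
  have h : ∀ t, HasDerivAt (fun t => f t - g t) 0 t := fun t =>
    ((hf t).fun_sub (hg t)).congr_deriv (sub_self _)
  have := is_const_of_deriv_eq_zero (fun t => (h t).differentiableAt) (fun t => (h t).deriv) t 0
  simp only [h0, sub_self] at this
  linarith

theorem hasDerivAt_along {V : smoothVF n} {γ : ℝ → Fin n → ℝ}
    (hγ : IsIntegralCurve γ (fun _ => V.1)) (f : smoothFun n) (t : ℝ) :
    HasDerivAt (fun t => f.1 (γ t)) ((op V f).1 (γ t)) t :=
  (smoothFun_differentiable f (γ t)).hasFDerivAt.comp_hasDerivAt t (hγ t)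

/-- Taylor's formula along integral curves; the series terminates. -/
theorem apply_integralCurve {w : Fin n → ℝ} (hw : ∀ i, 0 < w i) {V : smoothVF n}
    (hV : V ∈ filVF w 1) {γ : ℝ → Fin n → ℝ} (hγ : IsIntegralCurve γ (fun _ => V.1)) (K : ℕ) :
    ∀ r : ℝ, r < K → ∀ f ∈ fil w r, ∀ t,
      f.1 (γ t) = expSum (fun k => ((op V ^ k) f).1 (γ 0)) K t := by
  induction K with
  | zero =>
    intro r hr f hf t
    rw [fil_eq_bot hw (by simpa using hr), Submodule.mem_bot] at hf
    simp [hf, expSum]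
  | succ K ih =>
    intro r hr f hf t
    -- The derivative of f along γ is Vf, which lies one step lower in the filtration, where the
    -- inductive formula applies. The induction bottoms out because `fil w r` is zero for r < 0.
    refine eq_of_hasDerivAt_eq (hasDerivAt_along hγ f) (fun t => ?_) ?_ t
    · rw [ih (r - 1) (by push_cast at hr; linarith) _ (hV r f hf) t]
      exact hasDerivAt_expSum _ K t
    · rw [expSum_zero]; simp

/-- `flowOne` picks some integral curve. Uniqueness of integral curves is never needed, because
Taylor's formula holds along each of them. -/
theorem flowOne_eq {w : Fin n → ℝ} (hw : ∀ i, 0 < w i) {V : smoothVF n} (hV : V ∈ filVF w 1)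
    (x₀ : Fin n → ℝ) : ∃ γ : ℝ → Fin n → ℝ,
      γ 0 = x₀ ∧ IsIntegralCurve γ (fun _ => V.1) ∧ flowOne V.1 x₀ = γ 1 := by
  have h := Classical.epsilon_spec (p := fun γ : ℝ → Fin n → ℝ =>
    γ 0 = x₀ ∧ IsIntegralCurve γ (fun _ => V.1)) (exists_integralCurve hw hV x₀)
  exact ⟨_, h.1, h.2, rfl⟩

/-- The derivative of `(A + ε B)^k` at `ε = 0`. -/
def dpow {M : Type*} [Ring M] (A B : M) : ℕ → M
  | 0 => 0
  | k + 1 => dpow A B k * A + A ^ k * B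

theorem hasDerivAt_pow_add_smul (A B : Module.End ℝ (smoothFun n)) (x : Fin n → ℝ) (k : ℕ) :
    ∀ f : smoothFun n,
      HasDerivAt (fun ε : ℝ => (((A + ε • B) ^ k) f).1 x) ((dpow A B k f).1 x) 0 := by
  induction k with
  | zero => intro f; simpa [dpow] using hasDerivAt_const (0 : ℝ) (f.1 x)
  | succ k ih =>
    intro f
    have h : (fun ε : ℝ => (((A + ε • B) ^ (k + 1)) f).1 x) = fun ε : ℝ =>
        (((A + ε • B) ^ k) (A f)).1 x + ε * (((A + ε • B) ^ k) (B f)).1 x := by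
      funext ε
      rw [pow_succ, Module.End.mul_apply, LinearMap.add_apply, LinearMap.smul_apply, map_add,
        map_smul]
      rfl
    rw [h]
    refine ((ih (A f)).fun_add ((hasDerivAt_id (0 : ℝ)).fun_mul (ih (B f)))).congr_deriv ?_
    simp only [id, zero_mul, one_mul, add_zero, zero_smul, dpow]
    rfl

-- Since V ∘ ad^q E = ad^q E ∘ V + ad^{q+1} E as operators, differentiation along γ yields the same
-- series applied to Vf plus a telescoping sum. Its upper end is killed by `hM`, and its lower end
-- is Ef.
open LieAlgebra in
theorem hasDerivAt_adSeries {V E : smoothVF n} {γ : ℝ → Fin n → ℝ}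
    (hγ : IsIntegralCurve γ (fun _ => V.1)) {M : ℕ} (hM : (ad ℝ _ V ^ M) E = 0)
    (f : smoothFun n) (t : ℝ) :
    HasDerivAt (fun t : ℝ => ∑ q ∈ Finset.range M, (-1) ^ q * t ^ (q + 1) / (q + 1).factorial *
        (op ((ad ℝ _ V ^ q) E) f).1 (γ t))
      ((∑ q ∈ Finset.range M, (-1) ^ q * t ^ (q + 1) / (q + 1).factorial *
        (op ((ad ℝ _ V ^ q) E) (op V f)).1 (γ t)) + (op E f).1 (γ t)) t := by
  set A : ℕ → ℝ := fun q => (op ((ad ℝ _ V ^ q) E) f).1 (γ t) with hA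
  set c : ℕ → ℝ := fun q => (-1) ^ q * t ^ (q + 1) / (q + 1).factorial with hc
  set c' : ℕ → ℝ := fun q => (-1) ^ q * t ^ q / q.factorial with hc'
  have h1 : HasDerivAt (fun t : ℝ => ∑ q ∈ Finset.range M,
      (-1) ^ q * t ^ (q + 1) / (q + 1).factorial * (op ((ad ℝ _ V ^ q) E) f).1 (γ t))
      (∑ q ∈ Finset.range M, (c' q * A q + c q * (op V (op ((ad ℝ _ V ^ q) E) f)).1 (γ t))) t := by
    refine HasDerivAt.fun_sum fun q _ => ?_
    refine HasDerivAt.mul ?_ (hasDerivAt_along hγ _ t)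
    refine (((hasDerivAt_pow (q + 1) t).const_mul ((-1 : ℝ) ^ q)).div_const
      ((q + 1).factorial : ℝ)).congr_deriv ?_
    simp only [hc', Nat.factorial_succ]
    have : (q.factorial : ℝ) ≠ 0 := by positivity
    push_cast
    field_simp
  have h2 : ∀ q, (op V (op ((ad ℝ _ V ^ q) E) f)).1 (γ t) =
      (op ((ad ℝ _ V ^ q) E) (op V f)).1 (γ t) + A (q + 1) := by
    intro q
    have : A (q + 1) = (op V (op ((ad ℝ _ V ^ q) E) f) - op ((ad ℝ _ V ^ q) E) (op V f)).1 (γ t) := by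
      simp only [hA]
      rw [pow_succ', Module.End.mul_apply, ad_apply, op_lie_apply]
    have e : ∀ a b : smoothFun n, (a - b).1 (γ t) = a.1 (γ t) - b.1 (γ t) := fun _ _ => rfl
    rw [this, e]
    ring
  -- The sum telescopes because `c' (q + 1) = -c q`.
  have h3 : ∀ N, ∑ q ∈ Finset.range N, (c' q * A q + c q * A (q + 1)) = A 0 - c' N * A N := by
    intro N
    induction N with
    | zero => simp [hc']
    | succ N ih =>
      rw [Finset.sum_range_succ, ih]
      have : c' (N + 1) = - c N := by simp only [hc, hc', pow_succ]; ring
      rw [this]; ring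
  have h4 : A M = 0 := by simp only [hA, hM, op_zero]; rfl
  refine h1.congr_deriv ?_
  simp only [h2]
  have : ∀ q, c' q * A q + c q * ((op ((ad ℝ _ V ^ q) E) (op V f)).1 (γ t) + A (q + 1)) =
      c q * (op ((ad ℝ _ V ^ q) E) (op V f)).1 (γ t) + (c' q * A q + c q * A (q + 1)) :=
    fun q => by ring
  simp only [this]
  rw [Finset.sum_add_distrib, h3, h4]
  simp [hA, hc]

open LieAlgebra in
/-- The derivative of the exponential map, as an identity of terminating series. -/
theorem expSum_dpow {w : Fin n → ℝ} (hw : ∀ i, 0 < w i) {V E : smoothVF n}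
    (hV : V ∈ filVF w 1) (hE : E ∈ filVF w 1) {γ : ℝ → Fin n → ℝ}
    (hγ : IsIntegralCurve γ (fun _ => V.1)) {M : ℕ} (hM : (ad ℝ _ V ^ M) E = 0) (K : ℕ) :
    ∀ r : ℝ, r < K → ∀ f ∈ fil w r, ∀ t,
      expSum (fun k => (dpow (op V) (op E) k f).1 (γ 0)) K t =
        ∑ q ∈ Finset.range M, (-1) ^ q * t ^ (q + 1) / (q + 1).factorial *
          (op ((ad ℝ _ V ^ q) E) f).1 (γ t) := by
  induction K with
  | zero =>
    intro r hr f hf t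
    rw [fil_eq_bot hw (by simpa using hr), Submodule.mem_bot] at hf
    simp [hf, expSum]
  | succ K ih =>
    intro r hr f hf t
    have hr' : r - 1 < K := by push_cast at hr; linarith
    -- Both sides have the same derivative. On the left, the recursion of `dpow` splits it into the
    -- left side for Vf, treated by induction, and the Taylor series of Ef along γ.
    refine eq_of_hasDerivAt_eq (fun t => ?_) (hasDerivAt_adSeries hγ hM f) ?_ t
    · rw [← ih (r - 1) hr' _ (hV r f hf) t, apply_integralCurve hw hV hγ K _ hr' _ (hE r f hf) t]
      refine (hasDerivAt_expSum _ K t).congr_deriv ?_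
      simp only [expSum, dpow]
      rw [← Finset.sum_add_distrib]
      refine Finset.sum_congr rfl fun k _ => ?_
      rw [← mul_add]; rfl
    · rw [expSum_zero]; simp [dpow]

end Flow

/-! ## The part of the Campbell-Baker-Hausdorff series linear in the second variable -/

section BernoulliSeries

open PowerSeries

/-- The series `e^X - 1`. -/
def expSubOne : PowerSeries ℝ := exp ℝ - 1

theorem constantCoeff_expSubOne : constantCoeff expSubOne = 0 := by
  simp [expSubOne]

theorem X_dvd_expSubOne : X ∣ expSubOne := X_dvd_iff.2 constantCoeff_expSubOne

theorem exists_expSubOne_eq : ∃ v : PowerSeries ℝ, IsUnit v ∧ expSubOne = X * v := by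
  obtain ⟨v, hv⟩ := X_dvd_expSubOne
  refine ⟨v, ?_, hv⟩
  rw [isUnit_iff_constantCoeff]
  have h : coeff 1 expSubOne = 1 := by simp [expSubOne, coeff_exp, coeff_one]
  rw [hv, show (1 : ℕ) = 0 + 1 from rfl, coeff_succ_X_mul, coeff_zero_eq_constantCoeff_apply] at h
  simp [h]

theorem bernoulli_mul_expSubOne : bernoulli'PowerSeries ℝ * expSubOne = X * exp ℝ :=
  bernoulli'PowerSeries_mul_exp_sub_one ℝ

/-- The truncated logarithmic series of `e^X`. -/
def logTrunc (M : ℕ) : PowerSeries ℝ :=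
  ∑ l ∈ Finset.range M, C ((-1) ^ l / ((l : ℝ) + 1)) * expSubOne ^ (l + 1)

/-- With u = e^X - 1 one has u' = 1 + u, so the derivative is 1 + u times a finite geometric series
in -u. -/
theorem deriv_logTrunc (M : ℕ) :
    derivative ℝ (logTrunc M) = 1 - (-expSubOne) ^ M := by
  have hu : derivative ℝ expSubOne = 1 + expSubOne := by
    simp [expSubOne, derivative_exp]
  have h1 : derivative ℝ (logTrunc M) =
      (1 + expSubOne) * ∑ l ∈ Finset.range M, (-expSubOne) ^ l := by
    rw [logTrunc, map_sum, Finset.mul_sum]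
    refine Finset.sum_congr rfl fun l _ => ?_
    have hC : C ((-1) ^ l / ((l : ℝ) + 1)) * ((l : PowerSeries ℝ) + 1) = (-1) ^ l := by
      have : ((l : PowerSeries ℝ) + 1) = C ((l : ℝ) + 1) := by simp
      rw [this, ← map_mul, div_mul_cancel₀ _ (by positivity)]; simp
    rw [← smul_eq_C_mul, (derivative ℝ).map_smul, Derivation.leibniz_pow, smul_eq_C_mul, hu, nsmul_eq_mul,
      smul_eq_mul, neg_pow expSubOne, ← hC]
    push_cast
    ring
  have h2 := mul_neg_geom_sum (-expSubOne) M
  rw [h1, ← h2]; ring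

/-- The difference has zero constant term, and its derivative -(-u)^M, with u = e^X - 1, is
divisible by X^M. -/
theorem X_pow_dvd_logTrunc_sub (M : ℕ) : X ^ (M + 1) ∣ logTrunc M - X := by
  rw [X_pow_dvd_iff]
  intro d hd
  cases d with
  | zero =>
    simp [logTrunc, constantCoeff_expSubOne]
  | succ d =>
    have h1 : coeff d (derivative ℝ (logTrunc M - X)) = 0 := by
      rw [map_sub, deriv_logTrunc]
      have : X ^ M ∣ (-expSubOne) ^ M := pow_dvd_pow_of_dvd ((dvd_neg).2 X_dvd_expSubOne) M
      have h3 := (X_pow_dvd_iff.1 this) d (by omega)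
      simp [h3]
    rw [coeff_derivative] at h1
    have : ((d : ℝ) + 1) ≠ 0 := by positivity
    simpa [this] using h1

/-- Generating functions for the suffixes of words which follow the letter `Y`. -/
def tailSeries : ℕ → PowerSeries ℝ
  | 0 => 1
  | 1 => -X
  | _ + 2 => 0

/-- Generating functions for the words in the Dynkin series which are linear in `Y`. -/
def headSeries : ℕ → PowerSeries ℝ
  | 0 => 0
  | l + 1 => expSubOne * headSeries l + X * exp ℝ * tailSeries l

theorem headSeries_add_two (l : ℕ) : headSeries (l + 2) =
    expSubOne ^ (l + 1) * (X * exp ℝ) - expSubOne ^ l * (X ^ 2 * exp ℝ) := by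
  induction l with
  | zero => simp [headSeries, tailSeries]; ring
  | succ l ih => rw [headSeries, ih, tailSeries]; ring

/-- The factor u², with u = e^X - 1, clears negative powers of u. The summands from two blocks on
follow the logarithmic series; the one-block summand deviates from that pattern and produces the
last term. -/
theorem sum_headSeries (M : ℕ) (hM : 1 ≤ M) :
    expSubOne ^ 2 * ∑ l ∈ Finset.range M, C ((-1) ^ l / ((l : ℝ) + 1)) * headSeries (l + 1) =
      (X * exp ℝ * expSubOne - X ^ 2 * exp ℝ) * logTrunc M + X ^ 2 * exp ℝ * expSubOne := by
  obtain ⟨M, rfl⟩ : ∃ k, M = k + 1 := ⟨M - 1, by omega⟩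
  rw [logTrunc, Finset.sum_range_succ', Finset.sum_range_succ' _ M, mul_add, mul_add,
    Finset.mul_sum, Finset.mul_sum]
  have h1 : ∀ l, expSubOne ^ 2 * (C ((-1) ^ (l + 1) / (((l + 1 : ℕ) : ℝ) + 1)) *
      headSeries (l + 1 + 1)) = (X * exp ℝ * expSubOne - X ^ 2 * exp ℝ) *
      (C ((-1) ^ (l + 1) / (((l + 1 : ℕ) : ℝ) + 1)) * expSubOne ^ (l + 1 + 1)) := by
    intro l
    rw [headSeries_add_two]; ring
  simp only [h1]
  have h2 : headSeries (0 + 1) = X * exp ℝ := by simp [headSeries, tailSeries]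
  rw [h2]
  simp only [pow_zero, Nat.cast_zero, zero_add, div_one, map_one]
  ring

/-- With b = X/(1 - e^{-X}), replacing the truncated logarithm of e^X by X turns the sum into
X·(X·b)', and the error is invisible up to degree k + 1. The derivative creates the factor k + 1,
which later cancels the 1/(k + 1) of Dynkin's formula. -/
theorem coeff_sum_headSeries (k : ℕ) :
    coeff (k + 1) (∑ l ∈ Finset.range (k + 1), C ((-1) ^ l / ((l : ℝ) + 1)) * headSeries (l + 1)) =
      ((k : ℝ) + 1) * coeff k (bernoulli'PowerSeries ℝ) := by
  set b := bernoulli'PowerSeries ℝ with hb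
  set N := ∑ l ∈ Finset.range (k + 1), C ((-1) ^ l / ((l : ℝ) + 1)) * headSeries (l + 1) with hN
  have hbu := bernoulli_mul_expSubOne
  rw [← hb] at hbu
  have he : exp ℝ = expSubOne + 1 := by simp [expSubOne]
  have hdu : derivative ℝ expSubOne = exp ℝ := by
    simp [expSubOne, derivative_exp]
  have hdb : derivative ℝ b * expSubOne + b * exp ℝ = exp ℝ + X * exp ℝ := by
    have := congrArg (derivative ℝ) hbu
    simp only [Derivation.leibniz, hdu, derivative_exp, smul_eq_mul, derivative_X] at this
    linear_combination this
  have hH : expSubOne ^ 2 * (X * derivative ℝ (X * b)) =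
      2 * X ^ 2 * exp ℝ * expSubOne - X ^ 3 * exp ℝ := by
    have hX : derivative ℝ (X * b) = b + X * derivative ℝ b := by
      simp only [Derivation.leibniz, smul_eq_mul, derivative_X]; ring
    have h3 : expSubOne ^ 2 * derivative ℝ b =
        expSubOne * exp ℝ * (1 + X) - X * exp ℝ ^ 2 := by
      linear_combination expSubOne * hdb - exp ℝ * hbu
    rw [hX]
    have h4 : expSubOne ^ 2 * b = expSubOne * (X * exp ℝ) := by
      linear_combination expSubOne * hbu
    linear_combination X * h4 + X ^ 2 * h3 + (- X ^ 3 * exp ℝ) * he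
  -- Division by u² is legitimate: u = X·v with v a unit, X² cancels in a domain and v² does not
  -- affect divisibility.
  obtain ⟨v, hv, huv⟩ := exists_expSubOne_eq
  have hdvd : X ^ (k + 2) ∣ N - X * derivative ℝ (X * b) := by
    obtain ⟨g, hg⟩ := X_pow_dvd_logTrunc_sub (k + 1)
    have h1 := sum_headSeries (k + 1) (by omega)
    rw [← hN] at h1
    have h2 : X ^ 2 * (v ^ 2 * (N - X * derivative ℝ (X * b))) =
        X ^ 2 * (X ^ (k + 2) * (exp ℝ * (v - 1) * g)) := by
      have h5 : X ^ 2 * v ^ 2 = expSubOne ^ 2 := by rw [huv]; ring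
      have h6 : logTrunc (k + 1) = X + X ^ (k + 2) * g := by linear_combination hg
      rw [← mul_assoc, h5, mul_sub, h1, hH, h6, huv]; ring
    have h3 := mul_left_cancel₀ (pow_ne_zero 2 X_ne_zero) h2
    have h4 : X ^ (k + 2) ∣ v ^ 2 * (N - X * derivative ℝ (X * b)) := ⟨_, h3⟩
    exact (hv.pow 2).dvd_mul_left.1 h4
  have := (X_pow_dvd_iff.1 hdvd) (k + 1) (by omega)
  rw [map_sub, sub_eq_zero] at this
  rw [this, coeff_succ_X_mul, coeff_derivative, coeff_succ_X_mul]
  ring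

/-- The Taylor coefficients of `z / (1 - e^{-z})`. -/
def bernoulliCoeff (k : ℕ) : ℝ := coeff k (bernoulli'PowerSeries ℝ)

/-- The series `(1 - e^{-z}) / z` and `z / (1 - e^{-z})` are inverse to each other. -/
theorem expSeries_mul_bernoulli :
    (mk fun q => (-1 : ℝ) ^ q / (q + 1).factorial) * bernoulli'PowerSeries ℝ = 1 := by
  have h1 : X * (mk fun q => (-1 : ℝ) ^ q / (q + 1).factorial) = 1 - evalNegHom (exp ℝ) := by
    ext k
    cases k with
    | zero => rw [map_sub, evalNegHom, coeff_rescale]; simp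
    | succ k =>
      rw [coeff_succ_X_mul, coeff_mk, map_sub, evalNegHom, coeff_rescale, coeff_exp, coeff_one]
      simp [pow_succ]; ring
  have h2 := exp_mul_exp_neg_eq_one (A := ℝ)
  have h3 := bernoulli_mul_expSubOne
  have h4 : X * ((mk fun q => (-1 : ℝ) ^ q / (q + 1).factorial) * bernoulli'PowerSeries ℝ) =
      X * 1 := by
    rw [← mul_assoc, h1]
    have he : expSubOne = exp ℝ - 1 := rfl
    rw [he] at h3
    linear_combination evalNegHom (exp ℝ) * h3 + (X - bernoulli'PowerSeries ℝ) * h2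
  exact mul_left_cancel₀ X_ne_zero h4

/-- The evaluation of the identity `expSeries_mul_bernoulli` at a nilpotent operator. -/
theorem sum_sum_bernoulli {A : Type*} [AddCommGroup A] [Module ℝ A] (z : Module.End ℝ A) (M : ℕ)
    (y : A) (hz : ∀ k, M ≤ k → (z ^ k) y = 0) :
    ∑ q ∈ Finset.range M, ((-1 : ℝ) ^ q / (q + 1).factorial) •
      (z ^ q) (∑ j ∈ Finset.range M, bernoulliCoeff j • (z ^ j) y) = y := by
  set P := trunc M (mk fun q => (-1 : ℝ) ^ q / (q + 1).factorial)
  set Q := trunc M (bernoulli'PowerSeries ℝ)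
  have hev : ∀ f : PowerSeries ℝ, ∀ y : A, Polynomial.aeval z (trunc M f) y =
      ∑ q ∈ Finset.range M, coeff q f • (z ^ q) y := by
    intro f y
    rw [Polynomial.aeval_def, eval₂_trunc_eq_sum_range, LinearMap.sum_apply]
    refine Finset.sum_congr rfl fun i _ => ?_
    rw [Module.End.mul_apply, Module.algebraMap_end_apply]
  -- The truncations are inverse modulo X^M, and the M-th power of z kills y.
  have h1 : (Polynomial.X : Polynomial ℝ) ^ M ∣ P * Q - 1 := by
    rw [Polynomial.X_pow_dvd_iff]
    intro d hd
    have : (P * Q).coeff d = coeff d ((P * Q : Polynomial ℝ) : PowerSeries ℝ) :=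
      (Polynomial.coeff_coe _ _).symm
    rw [Polynomial.coeff_sub, this, Polynomial.coe_mul, ← coeff_mul_eq_coeff_trunc_mul_trunc _ _ hd,
      expSeries_mul_bernoulli]
    simp [coeff_one, Polynomial.coeff_one]
  obtain ⟨R, hR⟩ := h1
  have h2 : Polynomial.aeval z (P * Q) y = y := by
    have : P * Q = R * Polynomial.X ^ M + 1 := by linear_combination hR
    rw [this, map_add, map_mul, map_pow, Polynomial.aeval_X, map_one, LinearMap.add_apply,
      Module.End.mul_apply, hz M le_rfl]
    simp
  have h3 := hev (mk fun q => (-1 : ℝ) ^ q / (q + 1).factorial)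
    (∑ j ∈ Finset.range M, bernoulliCoeff j • (z ^ j) y)
  simp only [coeff_mk] at h3
  rw [← h3]
  have h4 := hev (bernoulli'PowerSeries ℝ) y
  change _ = ∑ j ∈ Finset.range M, bernoulliCoeff j • (z ^ j) y at h4
  rw [← h4, ← Module.End.mul_apply, ← map_mul]
  exact h2

end BernoulliSeries

/-! ### Generating functions of the Dynkin words with a single Y. -/

section DynkinWords

open PowerSeries

/-- The weight of a suffix following the letter `Y` (`true`) in a right-nested bracket. -/
def tailWt : List Bool → ℝ
  | [] => 1
  | [false] => -1
  | _ => 0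

/-- The weight of a word in the letters `X` (`false`) and `Y` (`true`): the right-nested bracket of a
word of length `k` with a single `Y` is this multiple of `(ad X)^{k-1} Y`. -/
def headWt : List Bool → ℝ
  | [] => 0
  | false :: w => headWt w
  | true :: w => tailWt w

/-- The word `X^{a_1} Y^{b_1} ⋯ X^{a_l} Y^{b_l}`. -/
def powersWord {l : ℕ} (c : Fin l → ℕ × ℕ) : List Bool :=
  (List.finRange l).flatMap fun i =>
    List.replicate (c i).1 false ++ List.replicate (c i).2 true

theorem powersWord_cons {l : ℕ} (p : ℕ × ℕ) (c : Fin l → ℕ × ℕ) :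
    powersWord (Fin.cons p c : Fin (l + 1) → ℕ × ℕ) =
      List.replicate p.1 false ++ (List.replicate p.2 true ++ powersWord c) := by
  simp [powersWord, List.finRange_succ, List.flatMap_map]

theorem length_powersWord {l : ℕ} (c : Fin l → ℕ × ℕ) :
    (powersWord c).length = ∑ i, ((c i).1 + (c i).2) := by
  induction l with
  | zero => simp [powersWord]
  | succ l ih =>
    rw [← Fin.cons_self_tail c, powersWord_cons, Fin.sum_univ_succ]
    simp [ih, add_assoc]

theorem headWt_replicate_append (a : ℕ) (w : List Bool) :
    headWt (List.replicate a false ++ w) = headWt w := by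
  induction a with
  | zero => simp
  | succ a ih => simpa [List.replicate_succ, headWt] using ih

theorem tailWt_replicate_append (a : ℕ) (w : List Bool) :
    tailWt (List.replicate (a + 2) false ++ w) = 0 := by
  simp [List.replicate_succ, tailWt]

theorem tailWt_true (w : List Bool) : tailWt (true :: w) = 0 := by simp [tailWt]

theorem tailWt_false_cons (w : List Bool) : tailWt (false :: w) = if w = [] then -1 else 0 := by
  cases w <;> simp [tailWt]

/-- The generating function of a weight `φ` on the words which occur in the Dynkin series. -/
def wordSeries (R : Finset (ℕ × ℕ)) (φ : List Bool → ℝ) (l : ℕ) : PowerSeries ℝ :=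
  ∑ c ∈ Fintype.piFinset (fun _ : Fin l => R),
    monomial (∑ i, ((c i).1 + (c i).2))
      ((∏ i, (((c i).1.factorial : ℝ) * ((c i).2.factorial : ℝ)))⁻¹ * φ (powersWord c))

theorem sum_piFinset_succ {α M : Type*} [DecidableEq α] [AddCommMonoid M] (R : Finset α) (l : ℕ)
    (f : (Fin (l + 1) → α) → M) :
    ∑ c ∈ Fintype.piFinset (fun _ : Fin (l + 1) => R), f c =
      ∑ p ∈ R, ∑ c ∈ Fintype.piFinset (fun _ : Fin l => R), f (Fin.cons p c) := by
  rw [← Finset.sum_product']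
  refine Finset.sum_nbij' (fun c => (c 0, Fin.tail c)) (fun q => Fin.cons q.1 q.2) ?_ ?_ ?_ ?_ ?_
  · intro c hc
    rw [Fintype.mem_piFinset] at hc
    simp only [Finset.mem_product, Fintype.mem_piFinset]
    exact ⟨hc 0, fun i => hc i.succ⟩
  · intro q hq
    simp only [Finset.mem_product, Fintype.mem_piFinset] at hq
    rw [Fintype.mem_piFinset]
    refine Fin.cases hq.1 hq.2
  · intro c _; simp
  · intro q _; simp
  · intro c _; simp

theorem wordSeries_zero (R : Finset (ℕ × ℕ)) (φ : List Bool → ℝ) :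
    wordSeries R φ 0 = C (φ []) := by
  simp [wordSeries, powersWord]

theorem wordSeries_succ (R : Finset (ℕ × ℕ)) (φ : List Bool → ℝ) (l : ℕ) :
    wordSeries R φ (l + 1) = ∑ p ∈ R,
      monomial (p.1 + p.2) (((p.1.factorial : ℝ) * (p.2.factorial : ℝ))⁻¹) *
        wordSeries R
          (fun w => φ (List.replicate p.1 false ++ (List.replicate p.2 true ++ w))) l := by
  rw [wordSeries, sum_piFinset_succ]
  refine Finset.sum_congr rfl fun p _ => ?_
  rw [wordSeries, Finset.mul_sum]
  refine Finset.sum_congr rfl fun c _ => ?_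
  rw [monomial_mul_monomial, Fin.sum_univ_succ, Fin.prod_univ_succ, powersWord_cons]
  simp only [Fin.cons_zero, Fin.cons_succ, mul_inv]
  congr 1
  ring

theorem wordSeries_zero_wt (R : Finset (ℕ × ℕ)) (l : ℕ) : wordSeries R (fun _ => 0) l = 0 := by
  simp [wordSeries]

theorem wordSeries_mul_wt (R : Finset (ℕ × ℕ)) (a : ℝ) (φ : List Bool → ℝ) (l : ℕ) :
    wordSeries R (fun w => a * φ w) l = C a * wordSeries R φ l := by
  rw [wordSeries, wordSeries, Finset.mul_sum]
  refine Finset.sum_congr rfl fun c _ => ?_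
  rw [← smul_eq_C_mul, ← map_smul, smul_eq_mul]
  congr 1; ring

/-- The admissible pairs `(a, b)`, `1 ≤ a + b`, with entries less than `M`. -/
def dynkinPairs (M : ℕ) : Finset (ℕ × ℕ) :=
  (Finset.range M ×ˢ Finset.range M).filter fun p => 1 ≤ p.1 + p.2

theorem mem_dynkinPairs {M : ℕ} {p : ℕ × ℕ} :
    p ∈ dynkinPairs M ↔ p.1 < M ∧ p.2 < M ∧ 1 ≤ p.1 + p.2 := by
  simp [dynkinPairs, and_assoc]

theorem wordSeries_nil_succ (M l : ℕ) :
    wordSeries (dynkinPairs M) (fun w => if w = [] then 1 else 0) (l + 1) = 0 := by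
  rw [wordSeries_succ]
  refine Finset.sum_eq_zero fun p hp => ?_
  rw [mem_dynkinPairs] at hp
  have : (fun w : List Bool => if List.replicate p.1 false ++ (List.replicate p.2 true ++ w) = []
      then (1 : ℝ) else 0) = fun _ => 0 := by
    funext w
    rw [if_neg]
    simp; omega
  rw [this, wordSeries_zero_wt, mul_zero]

/-- After Y only the empty word and the word X have nonzero weight. Blocks being nonempty, this
means no block, or the single block (1,0). -/
theorem wordSeries_tailWt {M : ℕ} (hM : 2 ≤ M) (l : ℕ) :
    wordSeries (dynkinPairs M) tailWt l = tailSeries l := by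
  cases l with
  | zero => simp [wordSeries_zero, tailWt, tailSeries]
  | succ l =>
    rw [wordSeries_succ, Finset.sum_eq_single ((1, 0) : ℕ × ℕ)]
    · have : (fun w => tailWt (List.replicate 1 false ++ (List.replicate 0 true ++ w))) =
          fun w => (-1) * (if w = [] then (1 : ℝ) else 0) := by
        funext w
        simp [tailWt_false_cons]
      simp only [this]
      rw [wordSeries_mul_wt]
      cases l with
      | zero => simp [wordSeries_zero, tailSeries, X_eq]
      | succ l => rw [wordSeries_nil_succ]; simp [tailSeries]
    · rintro ⟨a, b⟩ hp hne
      rw [mem_dynkinPairs] at hp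
      have : (fun w => tailWt (List.replicate a false ++ (List.replicate b true ++ w))) =
          fun _ => 0 := by
        funext w
        match a, b with
        | 0, 0 => simp at hp
        | 0, b + 1 => simp [List.replicate_succ, tailWt_true]
        | 1, 0 => simp at hne
        | 1, b + 1 => simp [List.replicate_succ, tailWt_false_cons]
        | a + 2, b => exact tailWt_replicate_append a _
      simp only [this]
      rw [wordSeries_zero_wt, mul_zero]
    · intro h
      exact absurd (mem_dynkinPairs.2 (by simp; omega)) h

/-- Split off the first block X^a Y^b. If b = 0 then a ≥ 1 and Y is still to come; if b = 1 a suffix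
follows Y; if b ≥ 2 the weight is zero. -/
theorem wordSeries_headWt_succ {M : ℕ} (hM : 2 ≤ M) (l : ℕ) :
    wordSeries (dynkinPairs M) headWt (l + 1) =
      (∑ a ∈ Finset.Ico 1 M, monomial a ((a.factorial : ℝ)⁻¹)) *
        wordSeries (dynkinPairs M) headWt l +
      (∑ a ∈ Finset.range M, monomial (a + 1) ((a.factorial : ℝ)⁻¹)) *
        wordSeries (dynkinPairs M) tailWt l := by
  have hw : ∀ a b : ℕ, (fun w => headWt (List.replicate a false ++ (List.replicate b true ++ w))) =
      if b = 0 then headWt else if b = 1 then tailWt else fun _ => 0 := by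
    intro a b
    funext w
    rw [headWt_replicate_append]
    match b with
    | 0 => simp
    | 1 => simp [headWt]
    | b + 2 => simp [List.replicate_succ, headWt, tailWt_true]
  rw [wordSeries_succ]
  simp only [hw]
  rw [dynkinPairs, Finset.sum_filter, Finset.sum_product_right]
  rw [← dynkinPairs]
  obtain ⟨M, rfl⟩ : ∃ k, M = k + 2 := ⟨M - 2, by omega⟩
  rw [Finset.sum_range_succ', Finset.sum_range_succ', Finset.sum_eq_zero (s := Finset.range M)]
  · simp only [zero_add]
    rw [add_comm]
    congr 1
    · rw [Finset.sum_mul, Finset.range_eq_Ico, Finset.sum_eq_sum_Ico_succ_bot (by omega)]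
      simp only [zero_add, add_zero, nonpos_iff_eq_zero, one_ne_zero, if_true]
      rw [if_neg (by norm_num), zero_add]
      refine Finset.sum_congr rfl fun a ha => ?_
      rw [Finset.mem_Ico] at ha
      rw [if_pos ha.1]; simp
    · rw [Finset.sum_mul]
      refine Finset.sum_congr rfl fun a ha => ?_
      simp
  · intro b _
    refine Finset.sum_eq_zero fun a _ => ?_
    rw [if_pos (by omega), if_neg (by omega), if_neg (by omega), wordSeries_zero_wt, mul_zero]

/-- Both sides satisfy the same recursion, except that the word count uses exponentials truncated at
order X^M. -/
theorem X_pow_dvd_wordSeries_sub {M : ℕ} (hM : 2 ≤ M) (l : ℕ) :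
    X ^ M ∣ wordSeries (dynkinPairs M) headWt l - headSeries l := by
  have h1 : X ^ M ∣ (∑ a ∈ Finset.Ico 1 M, monomial a ((a.factorial : ℝ)⁻¹)) - expSubOne := by
    rw [X_pow_dvd_iff]
    intro d hd
    simp only [map_sub, map_sum, coeff_monomial, expSubOne, coeff_exp, coeff_one]
    rw [Finset.sum_ite_eq]
    rcases Nat.eq_zero_or_pos d with rfl | h
    · simp
    · simp [hd, h.ne', Nat.succ_le_iff.2 h]
  have h2 : X ^ M ∣ (∑ a ∈ Finset.range M, monomial (a + 1) ((a.factorial : ℝ)⁻¹)) -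
      X * exp ℝ := by
    rw [X_pow_dvd_iff]
    intro d hd
    simp only [map_sub, map_sum, coeff_monomial]
    cases d with
    | zero => simp
    | succ d =>
      rw [coeff_succ_X_mul, coeff_exp]
      simp only [Nat.add_right_cancel_iff]
      rw [Finset.sum_ite_eq, if_pos (Finset.mem_range.2 (by omega))]
      simp
  induction l with
  | zero => simp [wordSeries_zero, headWt, headSeries]
  | succ l ih =>
    rw [wordSeries_headWt_succ hM, headSeries, wordSeries_tailWt hM]
    have : ∀ a b u v p q t : PowerSeries ℝ, a * p + b * t - (u * q + v * t) =
        a * (p - q) + (a - u) * q + (b - v) * t := fun a b u v p q t => by ring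
    rw [this]
    exact dvd_add (dvd_add (ih.mul_left _) (h1.mul_right _)) (h2.mul_right _)

theorem coeff_wordSeries_headWt (k l : ℕ) (hk : 1 ≤ k) :
    coeff k (wordSeries (dynkinPairs (k + 1)) headWt l) = coeff k (headSeries l) := by
  have := (X_pow_dvd_iff.1 (X_pow_dvd_wordSeries_sub (M := k + 1) (by omega) l)) k (by omega)
  rwa [map_sub, sub_eq_zero] at this

end DynkinWords

/-! ### The derivative of x ⋄ t y at t = 0. -/

section CBHLinear

variable {L : Type*} [LieRing L] [LieAlgebra ℝ L]

theorem dynkinTerm_eq (x y : L) (k : ℕ) : dynkinTerm x y k =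
    ∑ l ∈ Finset.Icc 1 k, ∑ c ∈ (Fintype.piFinset fun _ : Fin l => dynkinPairs (k + 1)).filter
        (fun c => ∑ i, ((c i).1 + (c i).2) = k),
      ((-1 : ℝ) ^ (l + 1) / ((l : ℝ) * (k : ℝ) *
        ∏ i, (((c i).1.factorial : ℝ) * ((c i).2.factorial : ℝ)))) •
        nested ((powersWord c).map fun b => bif b then y else x) := by
  rw [dynkinTerm]
  refine Finset.sum_congr rfl fun l _ => ?_
  have h : (Fintype.piFinset fun _ : Fin l => dynkinPairs (k + 1)).filter
        (fun c => ∑ i, ((c i).1 + (c i).2) = k) =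
      (Fintype.piFinset fun _ : Fin l => Finset.range (k + 1) ×ˢ Finset.range (k + 1)).filter
        (fun c => (∀ i, 1 ≤ (c i).1 + (c i).2) ∧ ∑ i, ((c i).1 + (c i).2) = k) := by
    ext c
    simp only [Finset.mem_filter, Fintype.mem_piFinset, dynkinPairs, forall_and, and_assoc]
  rw [h]
  refine Finset.sum_congr rfl fun c _ => ?_
  simp [powersWord, List.map_flatMap, List.map_append]

omit [LieAlgebra ℝ L] in
theorem nested_cons (a : L) {w : List L} (hw : w ≠ []) : nested (a :: w) = ⁅a, nested w⁆ := by
  obtain ⟨b, l, rfl⟩ := List.exists_cons_of_ne_nil hw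
  rfl

theorem nested_smul_true (x y : L) (t : ℝ) (w : List Bool) :
    nested (w.map fun b => bif b then t • y else x) =
      t ^ (w.count true) • nested (w.map fun b => bif b then y else x) := by
  induction w with
  | nil => simp [nested]
  | cons b w ih =>
    rcases eq_or_ne w [] with rfl | hw
    · cases b <;> simp [nested]
    · rw [List.map_cons, List.map_cons, nested_cons _ (by simpa using hw),
        nested_cons _ (by simpa using hw), ih]
      cases b
      · simp
      · simp [pow_succ, smul_smul]

-- The innermost bracket is [x, x].
omit [LieAlgebra ℝ L] in
theorem nested_all_false (x y : L) {w : List Bool} (hw : w.count true = 0) (h2 : 2 ≤ w.length) :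
    nested (w.map fun b => bif b then y else x) = 0 := by
  induction w with
  | nil => simp at h2
  | cons b w ih =>
    have hb : b = false := by
      cases b
      · rfl
      · simp at hw
    subst hb
    have hw' : w.count true = 0 := by simpa using hw
    have hne : w ≠ [] := by rintro rfl; simp at h2
    rw [List.map_cons, nested_cons _ (by simpa using hne)]
    by_cases h : 2 ≤ w.length
    · rw [ih hw' h, lie_zero]
    · obtain ⟨c, l, rfl⟩ := List.exists_cons_of_ne_nil hne
      have : l = [] := by simp at h; exact h
      subst this
      cases c
      · simp [nested]
      · simp at hw'

-- Letters x before y act by ad x. The bracket of the x's after y vanishes once there are two or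
-- more of them, and a single one gives [y, x] = -[x, y]; this accounts for the weights 1, -1 and 0.
open LieAlgebra in
theorem nested_eq_headWt (x y : L) {w : List Bool} (hw : w.count true = 1) :
    nested (w.map fun b => bif b then y else x) =
      headWt w • (ad ℝ L x ^ (w.length - 1)) y := by
  induction w with
  | nil => simp at hw
  | cons b w ih =>
    cases b with
    | false =>
      have hw' : w.count true = 1 := by simpa using hw
      have hne : w ≠ [] := by rintro rfl; simp at hw'
      obtain ⟨c, l, rfl⟩ := List.exists_cons_of_ne_nil hne
      rw [List.map_cons, nested_cons _ (by simp), ih hw']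
      simp [headWt, pow_succ']
    | true =>
      have hw' : w.count true = 0 := by simpa using hw
      match w, hw' with
      | [], _ => simp [nested, headWt, tailWt]
      | [false], _ => simp [nested, headWt, tailWt]
      | false :: c :: l, hw' =>
        rw [List.map_cons, nested_cons _ (by simp), nested_all_false x y hw' (by simp)]
        simp [headWt, tailWt]
      | true :: _, hw' => simp at hw'

theorem headWt_eq_zero {w : List Bool} (hw : w.count true ≠ 1) : headWt w = 0 := by
  induction w with
  | nil => rfl
  | cons b w ih =>
    cases b with
    | false => exact ih (by simpa using hw)
    | true =>
      match w with
      | [] => simp at hw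
      | [false] => simp at hw
      | [true] => rfl
      | true :: _ :: _ => rfl
      | false :: _ :: _ => rfl

open LieAlgebra in
/-- The derivative at `t = 0` of the terms of the series of `x ⋄ t y`. -/
theorem hasDerivAt_dynkinTerm (x y : L) (k : ℕ) (f : L →ₗ[ℝ] ℝ) :
    HasDerivAt (fun t : ℝ => f (dynkinTerm x (t • y) (k + 1)))
      (bernoulliCoeff k * f ((ad ℝ L x ^ k) y)) 0 := by
  have h1 : (fun t : ℝ => f (dynkinTerm x (t • y) (k + 1))) = fun t : ℝ =>
      ∑ l ∈ Finset.Icc 1 (k + 1),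
        ∑ c ∈ (Fintype.piFinset fun _ : Fin l => dynkinPairs (k + 1 + 1)).filter
          (fun c => ∑ i, ((c i).1 + (c i).2) = k + 1),
        ((-1 : ℝ) ^ (l + 1) / ((l : ℝ) * ((k + 1 : ℕ) : ℝ) *
          ∏ i, (((c i).1.factorial : ℝ) * ((c i).2.factorial : ℝ)))) *
          (t ^ ((powersWord c).count true) *
            f (nested ((powersWord c).map fun b => bif b then y else x))) := by
    funext t
    rw [dynkinTerm_eq, map_sum]
    refine Finset.sum_congr rfl fun l _ => ?_
    rw [map_sum]
    refine Finset.sum_congr rfl fun c _ => ?_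
    rw [nested_smul_true, map_smul, map_smul, smul_eq_mul, smul_eq_mul]
  have h2 : ∀ (l : ℕ) (c : Fin l → ℕ × ℕ), ∑ i, ((c i).1 + (c i).2) = k + 1 →
      HasDerivAt (fun t : ℝ => t ^ ((powersWord c).count true) *
          f (nested ((powersWord c).map fun b => bif b then y else x)))
        (headWt (powersWord c) * f ((ad ℝ L x ^ k) y)) 0 := by
    intro l c hc
    -- A word with r letters y contributes t^r, whose derivative at 0 is nonzero only for r = 1;
    -- `headWt` vanishes on all other words.
    refine ((hasDerivAt_pow _ (0 : ℝ)).mul_const _).congr_deriv ?_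
    by_cases h : (powersWord c).count true = 1
    · rw [nested_eq_headWt x y h, h, length_powersWord, hc]
      simp
    · rw [headWt_eq_zero h]
      rcases Nat.lt_or_gt_of_ne h with h0 | h0
      · simp [Nat.lt_one_iff.1 h0]
      · rw [zero_pow (by omega)]; simp
  rw [h1]
  refine (HasDerivAt.fun_sum fun l _ => HasDerivAt.fun_sum fun c hc =>
    (h2 l c (Finset.mem_filter.1 hc).2).const_mul _).congr_deriv ?_
  have h3 : ∀ l, ∑ c ∈ (Fintype.piFinset fun _ : Fin l => dynkinPairs (k + 1 + 1)).filter
          (fun c => ∑ i, ((c i).1 + (c i).2) = k + 1),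
        ((-1 : ℝ) ^ (l + 1) / ((l : ℝ) * ((k + 1 : ℕ) : ℝ) *
          ∏ i, (((c i).1.factorial : ℝ) * ((c i).2.factorial : ℝ)))) *
          (headWt (powersWord c) * f ((ad ℝ L x ^ k) y)) =
      ((-1 : ℝ) ^ (l + 1) / (l : ℝ)) * PowerSeries.coeff (k + 1) (headSeries l) *
        (((k + 1 : ℕ) : ℝ)⁻¹ * f ((ad ℝ L x ^ k) y)) := by
    intro l
    rw [← coeff_wordSeries_headWt (k + 1) l (by omega), wordSeries, map_sum, Finset.sum_filter,
      Finset.mul_sum, Finset.sum_mul]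
    refine Finset.sum_congr rfl fun c _ => ?_
    rw [PowerSeries.coeff_monomial]
    by_cases h : ∑ i, ((c i).1 + (c i).2) = k + 1
    · rw [if_pos h, if_pos h.symm, div_eq_mul_inv, div_eq_mul_inv, mul_inv, mul_inv]; ring
    · rw [if_neg h, if_neg (Ne.symm h)]; ring
  rw [Finset.sum_congr rfl fun l _ => h3 l, ← Finset.sum_mul]
  -- The signs (-1)^(l+1)/l of Dynkin's formula become those of the logarithm after the shift l ↦ l
  -- + 1.
  have h4 := coeff_sum_headSeries k
  have h5 : ∑ l ∈ Finset.Icc 1 (k + 1),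
      ((-1 : ℝ) ^ (l + 1) / (l : ℝ)) * PowerSeries.coeff (k + 1) (headSeries l) =
      ((k : ℝ) + 1) * bernoulliCoeff k := by
    rw [bernoulliCoeff, ← h4, map_sum, Finset.range_eq_Ico,
      ← Finset.Ico_add_one_right_eq_Icc, ← Finset.sum_Ico_add' _ 0 (k + 1) 1]
    refine Finset.sum_congr rfl fun l _ => ?_
    rw [PowerSeries.coeff_C_mul]
    push_cast; ring
  rw [h5]
  have : ((k : ℝ) + 1) ≠ 0 := by positivity
  push_cast
  field_simp

theorem dynkinTerm_zero_right (x : L) (k : ℕ) : dynkinTerm x 0 (k + 2) = 0 := by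
  rw [dynkinTerm_eq]
  refine Finset.sum_eq_zero fun l _ => Finset.sum_eq_zero fun c hc => ?_
  have h : nested ((powersWord c).map fun b => bif b then (0 : L) else x) = 0 := by
    have h0 := nested_smul_true x 0 0 (powersWord c)
    rw [smul_zero] at h0
    rw [h0]
    by_cases h : (powersWord c).count true = 0
    · rw [nested_all_false x 0 h (by rw [length_powersWord, (Finset.mem_filter.1 hc).2]; omega),
        smul_zero]
    · rw [zero_pow h, zero_smul]
  rw [h, smul_zero]

theorem dynkinTerm_zero (x y : L) : dynkinTerm x y 0 = 0 := by
  simp [dynkinTerm]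

theorem dynkinTerm_one_zero (x : L) : dynkinTerm x 0 1 = x := by
  rw [dynkinTerm_eq, Finset.Icc_self, Finset.sum_singleton,
    Finset.sum_eq_single (fun _ => ((1, 0) : ℕ × ℕ))]
  · simp [powersWord, List.finRange_succ, nested]
  · intro c hc hne
    have h1 := (Finset.mem_filter.1 hc).2
    have h2 : c 0 = (0, 1) := by
      have : c 0 ≠ (1, 0) := fun h => hne (by funext i; rw [Subsingleton.elim i 0]; exact h)
      rw [Fin.sum_univ_one] at h1
      rcases h3 : c 0 with ⟨a, b⟩
      rw [h3] at h1 this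
      simp only [ne_eq, Prod.mk.injEq] at h1 this ⊢
      omega
    simp [powersWord, List.finRange_succ, h2, nested]
  · intro h
    exact absurd (Finset.mem_filter.2 ⟨Fintype.mem_piFinset.2 fun _ =>
      mem_dynkinPairs.2 (by simp), by simp⟩) h

open LieAlgebra in
/-- If all long brackets vanish, then the series of `x ⋄ t y` is a finite sum, with derivative
`∑_k β_k (ad x)^k y` at `t = 0`. -/
theorem hasDerivAt_cbh {M : ℕ}
    (hM : ∀ w : List L, M ≤ w.length → nested w = 0) (x y : L) (f : L →ₗ[ℝ] ℝ) :
    HasDerivAt (fun t : ℝ => f (cbh x (t • y)))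
      (f (∑ k ∈ Finset.range M, bernoulliCoeff k • (ad ℝ L x ^ k) y)) 0 := by
  have h0 : ∀ y : L, ∀ k, M + 1 ≤ k → dynkinTerm x y k = 0 := by
    intro y k hk
    rw [dynkinTerm_eq]
    refine Finset.sum_eq_zero fun l _ => Finset.sum_eq_zero fun c hc => ?_
    rw [hM _ (by rw [List.length_map, length_powersWord, (Finset.mem_filter.1 hc).2]; omega),
      smul_zero]
  have h1 : ∀ y : L, cbh x y = ∑ k ∈ Finset.range M, dynkinTerm x y (k + 1) := by
    intro y
    rw [cbh, finsum_eq_sum_of_support_subset (s := Finset.range (M + 1)),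
      Finset.sum_range_succ', dynkinTerm_zero, add_zero]
    intro k hk
    rw [Finset.mem_coe, Finset.mem_range]
    by_contra h
    exact hk (h0 y k (by omega))
  simp only [h1, map_sum, map_smul, smul_eq_mul]
  exact HasDerivAt.fun_sum fun k _ => hasDerivAt_dynkinTerm x y k f

theorem cbh_zero_right (x : L) : cbh x 0 = x := by
  rw [cbh, finsum_eq_single _ 1, dynkinTerm_one_zero]
  intro k hk
  match k with
  | 0 => exact dynkinTerm_zero x 0
  | 1 => exact absurd rfl hk
  | k + 2 => exact dynkinTerm_zero_right x k

end CBHLinear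

/-! ### Smooth dependence of operator powers on parameters. -/

section PolynomialDependence

/-- Expanding the rightmost factor in the coordinates of a reduces the power, with y varying in the
induction. The function is a polynomial, so W needs no topology. -/
theorem contDiff_pow_apply {N : ℕ} {W : Type*} [AddCommGroup W] [Module ℝ W]
    (A : (Fin N → ℝ) →ₗ[ℝ] Module.End ℝ W) (g : W →ₗ[ℝ] ℝ) (k : ℕ) :
    ∀ y : W, ContDiff ℝ ∞ fun a => g ((A a ^ k) y) := by
  induction k with
  | zero => intro y; simpa using contDiff_const
  | succ k ih =>
    intro y
    have h : (fun a => g ((A a ^ (k + 1)) y)) =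
        fun a => ∑ i, a i * g ((A a ^ k) (A (Pi.single i 1) y)) := by
      funext a
      have ha : A a = ∑ i, a i • A (Pi.single i 1) := by
        conv_lhs => rw [pi_eq_sum_univ' a]
        simp only [map_sum, map_smul]
      rw [pow_succ, Module.End.mul_apply]
      conv_lhs => rw [show A a y = ∑ i, a i • A (Pi.single i 1) y by
        conv_lhs => rw [ha]
        simp]
      simp
    rw [h]
    exact ContDiff.sum fun i _ => (contDiff_apply ℝ ℝ i).mul (ih _)

end PolynomialDependence

/-! ## The layers -/

section Layers

variable {n m : ℕ}

/-- The smooth vector fields which are homogeneous of degree `k`. -/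
def homogVF (w : Fin n → ℝ) (k : ℝ) : Submodule ℝ (smoothVF n) where
  carrier := {V | HomogVF w k V}
  add_mem' := by
    intro V W hV hW d f hf
    rw [op_add]; exact add_mem (hV d f hf) (hW d f hf)
  zero_mem' := by
    intro d f _
    rw [op_zero]; exact zero_mem _
  smul_mem' := by
    intro c V hV d f hf
    rw [op_smul]; exact Submodule.smul_mem _ c (hV d f hf)

theorem layer_le_homogVF {w : Fin n → ℝ} {X : Fin m → smoothVF n}
    (hX : ∀ i, HomogVF w 1 (X i)) (k : ℕ) : layer X k ≤ homogVF w k := by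
  have h1 : Submodule.span ℝ (Set.range X) ≤ homogVF w 1 := by
    rw [Submodule.span_le]; rintro _ ⟨i, rfl⟩; exact hX i
  have hsucc : ∀ k : ℕ, layer X (k + 1) ≤ homogVF w ((k + 1 : ℕ) : ℝ) := by
    intro k
    induction k with
    | zero => simpa [layer] using h1
    | succ k ih =>
      rw [layer, Submodule.span_le]
      rintro _ ⟨U, hU, V, hV, rfl⟩
      have := homogVF_lie (h1 hU) (ih hV)
      have e : (1 : ℝ) + ((k + 1 : ℕ) : ℝ) = ((k + 1 + 1 : ℕ) : ℝ) := by push_cast; ring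
      rw [e] at this
      exact this
  cases k with
  | zero => exact bot_le
  | succ k => exact hsucc k

theorem exists_nat_gt_weights (w : Fin n → ℝ) (hw : ∀ i, 0 < w i) : ∃ M : ℕ, ∀ i, w i < M := by
  obtain ⟨M, hM⟩ := exists_nat_gt (∑ j, w j)
  exact ⟨M, fun j =>
    (Finset.single_le_sum (fun i _ => (hw i).le) (Finset.mem_univ j)).trans_lt hM⟩

theorem nested_mem_filVF {w : Fin n → ℝ} {X : Fin m → smoothVF n}
    (hX : ∀ i, HomogVF w 1 (X i)) (l : List (lieHull X)) :
    ((nested l : lieHull X) : smoothVF n) ∈ filVF w l.length := by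
  induction l with
  | nil => exact zero_mem _
  | cons a l ih =>
    rcases eq_or_ne l [] with rfl | hl
    · simpa [nested] using lieHull_le_filVF hX a.2
    · rw [nested_cons a hl]
      have := filVF_lie (lieHull_le_filVF hX a.2) ih
      rw [List.length_cons]
      push_cast
      rwa [add_comm] at this

/-- A bracket of length l lowers degrees by l, which exceeds every weight as soon as l ≥ M. Hence 𝔞
is nilpotent and the series for ⋄ is finite. -/
theorem nested_eq_zero {w : Fin n → ℝ} (hw : ∀ i, 0 < w i) {X : Fin m → smoothVF n}
    (hX : ∀ i, HomogVF w 1 (X i)) {M : ℕ} (hM : ∀ i, w i < M) (l : List (lieHull X))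
    (hl : M ≤ l.length) : nested l = 0 := by
  ext1
  refine filVF_eq_zero hw (fun i => (hM i).trans_le ?_) (nested_mem_filVF hX l)
  exact_mod_cast hl

open LieAlgebra in
theorem coe_ad_pow {X : Fin m → smoothVF n} (x y : lieHull X) (k : ℕ) :
    (((ad ℝ (lieHull X) x ^ k) y : lieHull X) : smoothVF n) =
      (ad ℝ (smoothVF n) x ^ k) (y : smoothVF n) := by
  induction k with
  | zero => rfl
  | succ k ih =>
    rw [pow_succ', pow_succ', Module.End.mul_apply, Module.End.mul_apply, ← ih]; rfl

open LieAlgebra in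
theorem ad_pow_eq_nested {L : Type*} [LieRing L] [LieAlgebra ℝ L] (x y : L) (k : ℕ) :
    (ad ℝ L x ^ k) y = nested (List.replicate k x ++ [y]) := by
  induction k with
  | zero => simp [nested]
  | succ k ih =>
    rw [List.replicate_succ, List.cons_append, nested_cons _ (by simp), ← ih, pow_succ',
      Module.End.mul_apply, ad_apply]

open LieAlgebra in
theorem ad_pow_eq_zero {w : Fin n → ℝ} (hw : ∀ i, 0 < w i) {X : Fin m → smoothVF n}
    (hX : ∀ i, HomogVF w 1 (X i)) {M : ℕ} (hM : ∀ i, w i < M) (x y : lieHull X) {k : ℕ}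
    (hk : M ≤ k) : (ad ℝ (lieHull X) x ^ k) y = 0 := by
  rw [ad_pow_eq_nested]
  exact nested_eq_zero hw hX hM _ (by simp; omega)

end Layers

/-! ## The lifting construction -/

namespace Frame

variable {n m p : ℕ} {X : Fin m → smoothVF n} (F : Frame X p)

/-- The vector field `a · X`. -/
def field : (Fin (n + p) → ℝ) →ₗ[ℝ] smoothVF n :=
  (lieHull X).toSubmodule.subtype ∘ₗ F.Phi.toLinearMap

theorem field_apply (a : Fin (n + p) → ℝ) : F.field a = (F.Phi a : smoothVF n) := rfl

theorem Phi_single (i : Fin (n + p)) : F.Phi (Pi.single i 1) = F.basis i := by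
  rw [Phi, Module.Basis.equivFun_symm_apply]
  simp [Pi.single_apply]

theorem field_eq_sum (a : Fin (n + p) → ℝ) :
    F.field a = ∑ i, a i • (F.basis i : smoothVF n) := by
  rw [field_apply, Phi, Module.Basis.equivFun_symm_apply]
  push_cast
  rfl

theorem basis_mem_layer (i : Fin (n + p)) : (F.basis i : smoothVF n) ∈ layer X (F.deg i) := by
  rw [← F.span_layer]
  exact Submodule.subset_span ⟨i, rfl, rfl⟩

/-- Layer 0 is zero by convention, and a basis vector is not. -/
theorem deg_pos (i : Fin (n + p)) : 0 < F.deg i := by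
  rcases Nat.eq_zero_or_pos (F.deg i) with h | h
  · have := F.basis_mem_layer i
    rw [h, layer, Submodule.mem_bot] at this
    exact absurd (Subtype.ext this) (F.basis.ne_zero i)
  · exact h

/-- The weights of the dilations of `ℝ^N`. -/
def weight (i : Fin (n + p)) : ℝ := F.deg i

theorem weight_pos (i : Fin (n + p)) : 0 < F.weight i := Nat.cast_pos.2 (F.deg_pos i)

/-! ### The map π, the fields J_i, and their homogeneity. -/

section Projection

variable {σ : Fin n → ℝ} (hσ : ∀ i, 0 < σ i) (hX : ∀ i, HomogVF σ 1 (X i))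
  {M : ℕ} (hM : ∀ i, σ i < M)

include hX in
theorem field_mem_filVF (a : Fin (n + p) → ℝ) : F.field a ∈ filVF σ 1 :=
  lieHull_le_filVF hX (F.Phi a).2

include hσ hX in
theorem apply_proj {K : ℕ} {r : ℝ} (hr : r < K) {f : smoothFun n} (hf : f ∈ fil σ r)
    (a : Fin (n + p) → ℝ) :
    f.1 (F.proj a) = expSum (fun k => ((op (F.field a) ^ k) f).1 0) K 1 := by
  obtain ⟨γ, h0, hγ, h1⟩ := flowOne_eq hσ (F.field_mem_filVF hX a) 0
  have : F.proj a = γ 1 := h1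
  rw [this, apply_integralCurve hσ (F.field_mem_filVF hX a) hγ K r hr f hf 1, h0]

include hσ hX hM in
theorem proj_apply (a : Fin (n + p) → ℝ) (j : Fin n) :
    F.proj a j = expSum (fun k => ((op (F.field a) ^ k) (coordFun j)).1 0) M 1 :=
  F.apply_proj hσ hX (hM j) (coordFun_mem_fil σ j) a

/-- The evaluation of smooth functions at a point. -/
def evalAt (x : Fin n → ℝ) : smoothFun n →ₗ[ℝ] ℝ where
  toFun f := f.1 x
  map_add' _ _ := rfl
  map_smul' _ _ := rfl

-- By Taylor's formula at time 1, the components of π are polynomials in a.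
include hσ hX in
theorem contDiff_proj : ContDiff ℝ ∞ F.proj := by
  obtain ⟨M, hM⟩ := exists_nat_gt_weights σ hσ
  rw [contDiff_pi]
  intro j
  have : (fun a => F.proj a j) = fun a =>
      expSum (fun k => ((op (F.field a) ^ k) (coordFun j)).1 0) M 1 :=
    funext fun a => F.proj_apply hσ hX hM a j
  rw [this]
  refine ContDiff.sum fun k _ => contDiff_const.mul ?_
  exact contDiff_pow_apply ((opL n) ∘ₗ F.field) (evalAt 0) k (coordFun j)

open LieAlgebra in
include hσ hX hM in
/-- The derivative of the map `π`. -/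
theorem fderiv_proj (a c : Fin (n + p) → ℝ) :
    fderiv ℝ F.proj a c = ((∑ q ∈ Finset.range M, ((-1 : ℝ) ^ q / (q + 1).factorial) •
      (ad ℝ (lieHull X) (F.Phi a) ^ q) (F.Phi c) : lieHull X) : smoothVF n).1 (F.proj a) := by
  have hd : DifferentiableAt ℝ F.proj a :=
    (F.contDiff_proj hσ hX).differentiable (by simp) a
  have hline : HasDerivAt (fun ε : ℝ => a + ε • c) c 0 := by
    simpa using ((hasDerivAt_id (0 : ℝ)).smul_const c).const_add a
  have h1 : HasDerivAt (fun ε : ℝ => F.proj (a + ε • c)) (fderiv ℝ F.proj a c) 0 := by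
    have hd' : HasFDerivAt F.proj (fderiv ℝ F.proj a) (a + (0 : ℝ) • c) := by
      simpa using hd.hasFDerivAt
    exact hd'.comp_hasDerivAt 0 hline
  funext j
  have h1j := (hasDerivAt_pi.1 h1) j
  have h2 : HasDerivAt (fun ε : ℝ => F.proj (a + ε • c) j)
      (expSum (fun k => (dpow (op (F.field a)) (op (F.field c)) k (coordFun j)).1 0) M 1) 0 := by
    have : (fun ε : ℝ => F.proj (a + ε • c) j) = fun ε : ℝ => expSum (fun k =>
        (((op (F.field a) + ε • op (F.field c)) ^ k) (coordFun j)).1 0) M 1 := by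
      funext ε
      rw [F.proj_apply hσ hX hM, map_add, map_smul, op_add, op_smul]
    rw [this]
    exact HasDerivAt.fun_sum fun k _ => (hasDerivAt_pow_add_smul _ _ 0 k _).const_mul _
  rw [h1j.unique h2]
  obtain ⟨γ, h0, hγ, hγ1⟩ := flowOne_eq hσ (F.field_mem_filVF hX a) 0
  have hp : F.proj a = γ 1 := hγ1
  have hz : (ad ℝ (smoothVF n) (F.field a) ^ M) (F.field c) = 0 := by
    have := coe_ad_pow (F.Phi a) (F.Phi c) M
    rw [ad_pow_eq_zero hσ hX hM _ _ le_rfl] at this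
    exact this.symm
  have h3 := expSum_dpow hσ (F.field_mem_filVF hX a) (F.field_mem_filVF hX c) hγ hz M (σ j)
    (hM j) (coordFun j) (coordFun_mem_fil σ j) 1
  rw [h0] at h3
  rw [h3, hp]
  push_cast
  rw [Finset.sum_apply, Finset.sum_apply]
  refine Finset.sum_congr rfl fun q _ => ?_
  rw [op_coordFun, coe_ad_pow]
  simp [field_apply]

/-- The element of `𝔞` which corresponds to `J_i(a)`. -/
def fieldJ (M : ℕ) (i : Fin (n + p)) (a : Fin (n + p) → ℝ) : lieHull X :=
  ∑ k ∈ Finset.range M, bernoulliCoeff k • (LieAlgebra.ad ℝ (lieHull X) (F.Phi a) ^ k) (F.basis i)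

include hσ hX hM in
theorem hasDerivAt_mul (i : Fin (n + p)) (a : Fin (n + p) → ℝ) :
    HasDerivAt (fun t : ℝ => F.mul a (t • Pi.single i 1)) (F.Phi.symm (F.fieldJ M i a)) 0 := by
  rw [hasDerivAt_pi]
  intro j
  have := hasDerivAt_cbh (nested_eq_zero hσ hX hM) (F.Phi a) (F.basis i)
    ((LinearMap.proj j) ∘ₗ F.Phi.symm.toLinearMap)
  have e : (fun t : ℝ => F.mul a (t • Pi.single i 1) j) = fun t : ℝ =>
      ((LinearMap.proj j) ∘ₗ F.Phi.symm.toLinearMap) (cbh (F.Phi a) (t • F.basis i)) := by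
    funext t
    rw [mul, map_smul, Phi_single]; rfl
  rw [e]
  exact this

include hσ hX hM in
theorem J_eq (i : Fin (n + p)) (a : Fin (n + p) → ℝ) :
    F.J i a = F.Phi.symm (F.fieldJ M i a) :=
  (F.hasDerivAt_mul hσ hX hM i a).deriv

include hσ hX in
theorem hasDerivAt_mul_J (i : Fin (n + p)) (a : Fin (n + p) → ℝ) :
    HasDerivAt (fun t : ℝ => F.mul a (t • Pi.single i 1)) (F.J i a) 0 := by
  obtain ⟨M, hM⟩ := exists_nat_gt_weights σ hσ
  rw [F.J_eq hσ hX hM]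
  exact F.hasDerivAt_mul hσ hX hM i a

theorem mul_zero_right (a : Fin (n + p) → ℝ) : F.mul a 0 = a := by
  rw [mul, map_zero, cbh_zero_right, LinearEquiv.symm_apply_apply]

include hσ hX in
/-- The vector fields `J_i` are lifted by `π` from the elements of the basis of `𝔞`. -/
theorem fderiv_proj_J (i : Fin (n + p)) (a : Fin (n + p) → ℝ) :
    fderiv ℝ F.proj a (F.J i a) = (F.basis i : smoothVF n).1 (F.proj a) := by
  obtain ⟨M, hM⟩ := exists_nat_gt_weights σ hσ
  -- The series (1 - e^{-z})/z from dπ cancels the series z/(1 - e^{-z}) from J_i, with z = ad(a·X)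
  -- nilpotent.
  rw [F.fderiv_proj hσ hX hM, F.J_eq hσ hX hM, LinearEquiv.apply_symm_apply, fieldJ,
    sum_sum_bernoulli _ M _ fun k hk => ad_pow_eq_zero hσ hX hM _ _ hk]

include hσ hX in
theorem fderiv_proj_zero (c : Fin (n + p) → ℝ) :
    fderiv ℝ F.proj 0 c = (F.field c).1 0 := by
  obtain ⟨M, hM⟩ := exists_nat_gt_weights σ hσ
  have h0 : F.proj 0 = 0 := by
    funext j
    rw [F.proj_apply hσ hX hM, expSum, Finset.sum_eq_zero]; · rfl
    intro k _
    rw [map_zero, op_zero]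
    cases k with
    | zero => simp [coordFun]
    | succ k => simp
  rw [F.fderiv_proj hσ hX hM, map_zero, map_zero, h0, field_apply]
  cases M with
  -- All weights are positive, so the bound M = 0 leaves no index j.
  | zero =>
    funext j
    have h1 := hM j
    have h2 := hσ j
    rw [Nat.cast_zero] at h1
    linarith
  | succ M =>
    rw [Finset.sum_range_succ', Finset.sum_eq_zero]
    · simp
    · intro q _; simp

include hσ hX in
theorem contDiff_J (i : Fin (n + p)) : ContDiff ℝ ∞ (F.J i) := by
  obtain ⟨M, hM⟩ := exists_nat_gt_weights σ hσ
  rw [contDiff_pi]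
  intro j
  have : (fun a => F.J i a j) = fun a => ∑ k ∈ Finset.range M, bernoulliCoeff k *
      ((LinearMap.proj (R := ℝ) (φ := fun _ : Fin (n + p) => ℝ) j) ∘ₗ F.Phi.symm.toLinearMap)
      ((LieAlgebra.ad ℝ (lieHull X) (F.Phi a) ^ k) (F.basis i)) := by
    funext a
    rw [F.J_eq hσ hX hM, fieldJ, map_sum, Finset.sum_apply]
    simp
  rw [this]
  refine ContDiff.sum fun k _ => contDiff_const.mul ?_
  exact contDiff_pow_apply ((LieAlgebra.ad ℝ (lieHull X) : lieHull X →ₗ[ℝ] Module.End ℝ (lieHull X)) ∘ₗ F.Phi.toLinearMap) _ k _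

/-! ### Homogeneity -/

include hX in
theorem dilRel_field {lam : ℝ} (hlam : 0 < lam) (a : Fin (n + p) → ℝ) :
    DilRel σ lam (F.field a) (F.field (dil F.weight lam a)) := by
  rw [field_eq_sum, field_eq_sum]
  refine DilRel.sum _ fun i => ?_
  have h := ((layer_le_homogVF hX _ (F.basis_mem_layer i)).dilRel hlam).smul (a i)
  rw [smul_smul, mul_comm (a i)] at h
  exact h

-- The push-forward relation passes through powers of a·X, so it can be read off from the Taylor
-- sums for π without comparing integral curves.
include hσ hX in
theorem proj_dil {lam : ℝ} (hlam : 0 < lam) (a : Fin (n + p) → ℝ) :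
    F.proj (dil F.weight lam a) = dil σ lam (F.proj a) := by
  obtain ⟨M, hM⟩ := exists_nat_gt_weights σ hσ
  have key : ∀ k : ℕ, ∀ f : smoothFun n, (op (F.field a) ^ k) (compDil σ lam f) =
      compDil σ lam ((op (F.field (dil F.weight lam a)) ^ k) f) := by
    intro k
    induction k with
    | zero => intro f; rfl
    | succ k ih =>
      intro f
      rw [pow_succ, pow_succ, Module.End.mul_apply, Module.End.mul_apply,
        F.dilRel_field hX hlam a, ih]
  funext j
  rw [dil_apply, F.proj_apply hσ hX hM, F.proj_apply hσ hX hM, expSum, expSum, Finset.mul_sum]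
  refine Finset.sum_congr rfl fun k _ => ?_
  have h1 : compDil σ lam (coordFun j) = lam ^ σ j • coordFun j := rfl
  have h2 := congrFun (congrArg Subtype.val (key k (coordFun j))) 0
  rw [h1, map_smul] at h2
  have h3 : (compDil σ lam ((op (F.field (dil F.weight lam a)) ^ k) (coordFun j))).1 0 =
      ((op (F.field (dil F.weight lam a)) ^ k) (coordFun j)).1 (dil σ lam 0) := rfl
  rw [h3, dil_zero] at h2
  rw [← h2]
  change _ = lam ^ σ j * (_ * _)
  have h4 : ∀ (c : ℝ) (f : smoothFun n), (c • f).1 0 = c * f.1 0 := fun _ _ => rfl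
  rw [h4]; ring

include hσ hX in
/-- The fields `J_i`, `i ≤ m`, are homogeneous of degree one. -/
theorem J_dil {lam : ℝ} (hlam : 0 < lam) (k : Fin m) (a : Fin (n + p) → ℝ) :
    dil F.weight lam (F.J (Fin.castLE F.le k) a) =
      lam • F.J (Fin.castLE F.le k) (dil F.weight lam a) := by
  obtain ⟨M, hM⟩ := exists_nat_gt_weights σ hσ
  set i := Fin.castLE F.le k with hi
  have hf : ∀ c, F.field (F.J i c) = (F.fieldJ M i c : smoothVF n) := by
    intro c
    rw [field_apply, F.J_eq hσ hX hM, LinearEquiv.apply_symm_apply]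
  have h1 := F.dilRel_field hX hlam (F.J i a)
  have hb : DilRel σ lam (F.basis i : smoothVF n) (lam • (F.basis i : smoothVF n)) := by
    rw [hi, F.basis_castLE]
    simpa using (hX k).dilRel hlam
  have had : ∀ q : ℕ, DilRel σ lam
      (((LieAlgebra.ad ℝ (lieHull X) (F.Phi a) ^ q) (F.basis i) : lieHull X) : smoothVF n)
      (lam • (((LieAlgebra.ad ℝ (lieHull X) (F.Phi (dil F.weight lam a)) ^ q) (F.basis i) :
        lieHull X) : smoothVF n)) := by
    -- Push-forwards respect brackets: the dilation turns a into its dilate inside ad, while X_k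
    -- contributes the single factor `lam`.
    intro q
    induction q with
    | zero => exact hb
    | succ q ih =>
      rw [pow_succ', pow_succ', Module.End.mul_apply, Module.End.mul_apply]
      have := (F.dilRel_field hX hlam a).lie ih
      rw [lie_smul] at this
      exact this
  have h2 : DilRel σ lam (F.field (F.J i a)) (lam • F.field (F.J i (dil F.weight lam a))) := by
    rw [hf, hf, fieldJ, fieldJ]
    push_cast
    rw [Finset.smul_sum]
    refine DilRel.sum _ fun q => ?_
    rw [smul_comm]
    exact (had q).smul _
  have h3 := h1.unique hlam h2
  rw [← map_smul] at h3
  exact F.Phi.injective (Subtype.ext h3)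

end Projection

end Frame

namespace Frame

variable {n m p : ℕ} {X : Fin m → smoothVF n} (F : Frame X p)

/-! ### T is a global diffeomorphism, and the Z_i inherit lifting and homogeneity. -/

section Diffeomorphism

variable {σ : Fin n → ℝ} (hσ : ∀ i, 0 < σ i) (hX : ∀ i, HomogVF σ 1 (X i))

theorem sigmaStar_pos (k : Fin p) : 0 < F.sigmaStar k := F.weight_pos _

include hσ in
theorem sigmaProd_pos (i : Fin n ⊕ Fin p) : 0 < F.sigmaProd σ i := by
  cases i with
  | inl i => exact hσ i
  | inr k => exact F.sigmaStar_pos k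

theorem T_inl (a : Fin (n + p) → ℝ) (j : Fin n) : F.T a (Sum.inl j) = F.proj a j := rfl

include hσ hX in
theorem contDiff_T : ContDiff ℝ ∞ F.T := by
  rw [contDiff_pi]
  rintro (j | k)
  · exact contDiff_pi.1 (F.contDiff_proj hσ hX) j
  · exact contDiff_apply ℝ ℝ _

include hσ hX in
theorem fderiv_T_inl (a c : Fin (n + p) → ℝ) (j : Fin n) :
    fderiv ℝ F.T a c (Sum.inl j) = fderiv ℝ F.proj a c j := by
  have h1 : DifferentiableAt ℝ F.T a := (F.contDiff_T hσ hX).differentiable (by simp) a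
  have h2 : DifferentiableAt ℝ F.proj a := (F.contDiff_proj hσ hX).differentiable (by simp) a
  have h3 := (hasFDerivAt_pi'.1 h1.hasFDerivAt) (Sum.inl j)
  have h4 := (hasFDerivAt_pi'.1 h2.hasFDerivAt) j
  exact congrArg (fun L : (Fin (n + p) → ℝ) →L[ℝ] ℝ => L c) (h3.unique h4)

include hσ hX in
theorem fderiv_T_inr (a c : Fin (n + p) → ℝ) (k : Fin p) :
    fderiv ℝ F.T a c (Sum.inr k) = c (F.idx (Sum.inr k)) := by
  have h1 : DifferentiableAt ℝ F.T a := (F.contDiff_T hσ hX).differentiable (by simp) a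
  have h3 := (hasFDerivAt_pi'.1 h1.hasFDerivAt) (Sum.inr k)
  have h4 : HasFDerivAt (fun a : Fin (n + p) → ℝ => a (F.idx (Sum.inr k)))
      (ContinuousLinearMap.proj (R := ℝ) (φ := fun _ : Fin (n + p) => ℝ) (F.idx (Sum.inr k))) a :=
    (ContinuousLinearMap.proj (R := ℝ) (φ := fun _ : Fin (n + p) => ℝ)
      (F.idx (Sum.inr k))).hasFDerivAt
  exact congrArg (fun L : (Fin (n + p) → ℝ) →L[ℝ] ℝ => L c) (h3.unique h4)

include hσ hX in
theorem T_dil {lam : ℝ} (hlam : 0 < lam) (a : Fin (n + p) → ℝ) :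
    F.T (dil F.weight lam a) = dil (F.sigmaProd σ) lam (F.T a) := by
  funext i
  cases i with
  | inl j => rw [T_inl, F.proj_dil hσ hX hlam]; rfl
  | inr k => rfl

-- For a vector in the kernel, the coordinates kept by T vanish; what remains is a relation between
-- the X_{i_k}(0), which are independent.
include hσ hX in
theorem fderiv_T_zero_injective : Function.Injective (fderiv ℝ F.T 0) := by
  rw [injective_iff_map_eq_zero]
  intro c hc
  have hr : ∀ k, c (F.idx (Sum.inr k)) = 0 := fun k => by
    rw [← F.fderiv_T_inr hσ hX 0 c k, hc]; rfl
  have hl : (F.field c).1 0 = 0 := by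
    rw [← F.fderiv_proj_zero hσ hX]
    funext j
    rw [← F.fderiv_T_inl hσ hX, hc]; rfl
  have hs : (F.field c).1 0 =
      ∑ k, c (F.idx (Sum.inl k)) • (F.basis (F.idx (Sum.inl k)) : smoothVF n).1 0 := by
    have e : ∀ (V : Fin (n + p) → smoothVF n), (∑ q, V q).1 0 = ∑ q, (V q).1 0 := by
      intro V
      rw [AddSubmonoidClass.coe_finsetSum, Finset.sum_apply]
    rw [field_eq_sum, e, ← F.idx.sum_comp, Fintype.sum_sum_type]
    simp only [hr, zero_smul]
    have z : ∑ _x : Fin p, (0 : smoothVF n).1 (0 : Fin n → ℝ) = 0 :=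
      Finset.sum_eq_zero fun _ _ => rfl
    rw [z, add_zero]
    rfl
  rw [hs] at hl
  have hz := Fintype.linearIndependent_iff.1 F.linearIndependent_zero _ hl
  funext i
  obtain ⟨i, rfl⟩ := F.idx.surjective i
  cases i with
  | inl k => exact hz k
  | inr k => exact hr k

/-- The differential of `T` at the origin. -/
def dTzero : (Fin (n + p) → ℝ) ≃L[ℝ] (Fin n ⊕ Fin p → ℝ) :=
  (LinearEquiv.ofInjectiveOfFinrankEq
    (fderiv ℝ F.T 0).toLinearMap (F.fderiv_T_zero_injective hσ hX) (by simp)).toContinuousLinearEquiv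

include hσ hX in
theorem hasFDerivAt_T_zero :
    HasFDerivAt F.T (F.dTzero hσ hX : (Fin (n + p) → ℝ) →L[ℝ] (Fin n ⊕ Fin p → ℝ)) 0 := by
  have h1 : DifferentiableAt ℝ F.T 0 := (F.contDiff_T hσ hX).differentiable (by simp) 0
  exact h1.hasFDerivAt

open Filter Topology

include hσ hX in
theorem T_zero : F.T 0 = 0 := by
  have h : Tendsto (fun lam : ℝ => F.T (dil F.weight lam 0)) (𝓝[>] 0) (𝓝 0) := by
    refine (tendsto_dil_zero (F.sigmaProd_pos hσ) (F.T 0)).congr' ?_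
    filter_upwards [self_mem_nhdsWithin] with lam hlam
    exact (F.T_dil hσ hX hlam 0).symm
  simp only [dil_zero] at h
  exact tendsto_nhds_unique tendsto_const_nhds h

include hσ hX in
/-- `T` is injective. -/
theorem T_injective : Function.Injective F.T := by
  have hc : ContDiffAt ℝ ∞ F.T 0 := (F.contDiff_T hσ hX).contDiffAt
  set e := hc.toOpenPartialHomeomorph F.T (F.hasFDerivAt_T_zero hσ hX) (by simp) with he
  have he' : ∀ a, e a = F.T a := fun a => by
    rw [he, ContDiffAt.toOpenPartialHomeomorph_coe]
  have hsrc : e.source ∈ 𝓝 (0 : Fin (n + p) → ℝ) :=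
    e.open_source.mem_nhds (hc.mem_toOpenPartialHomeomorph_source (F.hasFDerivAt_T_zero hσ hX)
      (by simp))
  intro a b hab
  -- A small dilation brings a and b together into the neighbourhood of 0 where T is injective.
  have h1 := (tendsto_dil_zero F.weight_pos a).eventually hsrc
  have h2 := (tendsto_dil_zero F.weight_pos b).eventually hsrc
  obtain ⟨lam, hla, hlb, hlam⟩ := (h1.and (h2.and self_mem_nhdsWithin)).exists
  have hlam : (0 : ℝ) < lam := hlam
  have h3 : dil F.weight lam a = dil F.weight lam b := by
    refine e.injOn hla hlb ?_
    rw [he', he', F.T_dil hσ hX hlam, F.T_dil hσ hX hlam, hab]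
  rw [← dil_inv_dil F.weight hlam a, h3, dil_inv_dil F.weight hlam]

include hσ hX in
theorem invFun_T (a : Fin (n + p) → ℝ) : Function.invFun F.T (F.T a) = a :=
  Function.leftInverse_invFun (F.T_injective hσ hX) a

-- The inverse function theorem at 0, phrased for the global `Function.invFun`, which near 0 must
-- agree with the local inverse because T is injective.
include hσ hX in
theorem exists_local_inverse : ∃ U ∈ 𝓝 (0 : Fin n ⊕ Fin p → ℝ),
    ∀ u ∈ U, ContDiffAt ℝ ∞ (Function.invFun F.T) u ∧ F.T (Function.invFun F.T u) = u := by
  have hc : ContDiffAt ℝ ∞ F.T 0 := (F.contDiff_T hσ hX).contDiffAt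
  set e := hc.toOpenPartialHomeomorph F.T (F.hasFDerivAt_T_zero hσ hX) (by simp) with he
  have he' : ∀ a, e a = F.T a := fun a => by
    rw [he, ContDiffAt.toOpenPartialHomeomorph_coe]
  have h0 : (0 : Fin (n + p) → ℝ) ∈ e.source :=
    hc.mem_toOpenPartialHomeomorph_source (F.hasFDerivAt_T_zero hσ hX) (by simp)
  have h0' : (0 : Fin n ⊕ Fin p → ℝ) ∈ e.target := by
    have := e.map_source h0
    rwa [he', F.T_zero hσ hX] at this
  have hinv : ∀ u ∈ e.target, Function.invFun F.T u = e.symm u := by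
    intro u hu
    have : u = F.T (e.symm u) := by rw [← he', e.right_inv hu]
    conv_lhs => rw [this]
    exact F.invFun_T hσ hX _
  have hs0 : e.symm 0 = 0 := by
    rw [← hinv 0 h0', ← F.T_zero hσ hX, F.invFun_T hσ hX]
  -- Smoothness of the inverse is needed on a whole neighbourhood; invertibility of the differential
  -- is an open condition.
  have hreg : ∀ᶠ a in 𝓝 (0 : Fin (n + p) → ℝ), ∃ L : (Fin (n + p) → ℝ) ≃L[ℝ] (Fin n ⊕ Fin p → ℝ),
      (L : (Fin (n + p) → ℝ) →L[ℝ] (Fin n ⊕ Fin p → ℝ)) = fderiv ℝ F.T a := by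
    have h1 : ContinuousAt (fderiv ℝ F.T) 0 :=
      ((F.contDiff_T hσ hX).continuous_fderiv (by simp)).continuousAt
    exact h1.eventually (ContinuousLinearEquiv.nhds (F.dTzero hσ hX))
  have hcs : Tendsto e.symm (𝓝 0) (𝓝 0) := by
    have := (e.continuousAt_symm h0').tendsto
    rwa [hs0] at this
  refine ⟨{u | u ∈ e.target ∧ ∃ L : (Fin (n + p) → ℝ) ≃L[ℝ] (Fin n ⊕ Fin p → ℝ),
      (L : (Fin (n + p) → ℝ) →L[ℝ] (Fin n ⊕ Fin p → ℝ)) = fderiv ℝ F.T (e.symm u)},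
    (e.open_target.eventually_mem h0').and (hcs.eventually hreg), ?_⟩
  rintro u ⟨hu, L, hL⟩
  constructor
  · refine ContDiffAt.congr_of_eventuallyEq (f := e.symm) ?_ (by
      filter_upwards [e.open_target.mem_nhds hu] with u hu using hinv u hu)
    refine e.contDiffAt_symm hu (f₀' := L) ?_ ?_
    · rw [hL]
      exact (((F.contDiff_T hσ hX).differentiable (by simp)) _).hasFDerivAt.congr_of_eventuallyEq
        (Eventually.of_forall he')
    · exact (F.contDiff_T hσ hX).contDiffAt.congr_of_eventuallyEq (Eventually.of_forall he')
  · rw [hinv u hu, ← he', e.right_inv hu]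

include hσ hX in
theorem T_surjective : Function.Surjective F.T := by
  obtain ⟨U, hU, h⟩ := F.exists_local_inverse hσ hX
  intro u
  obtain ⟨lam, hl, hlam⟩ := (((tendsto_dil_zero (F.sigmaProd_pos hσ) u).eventually hU).and
    self_mem_nhdsWithin).exists
  have hlam : (0 : ℝ) < lam := hlam
  refine ⟨dil F.weight lam⁻¹ (Function.invFun F.T (dil (F.sigmaProd σ) lam u)), ?_⟩
  rw [F.T_dil hσ hX (inv_pos.2 hlam), (h _ hl).2, dil_inv_dil _ hlam]

include hσ hX in
theorem T_invFun (u : Fin n ⊕ Fin p → ℝ) : F.T (Function.invFun F.T u) = u :=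
  Function.rightInverse_invFun (F.T_surjective hσ hX) u

include hσ hX in
theorem invFun_T_dil {lam : ℝ} (hlam : 0 < lam) (u : Fin n ⊕ Fin p → ℝ) :
    Function.invFun F.T (dil (F.sigmaProd σ) lam u) =
      dil F.weight lam (Function.invFun F.T u) := by
  apply F.T_injective hσ hX
  rw [F.T_invFun hσ hX, F.T_dil hσ hX hlam, F.T_invFun hσ hX]

-- Conjugation by a dilation reduces smoothness at u to smoothness near 0.
include hσ hX in
theorem contDiff_invFun_T : ContDiff ℝ ∞ (Function.invFun F.T) := by
  obtain ⟨U, hU, h⟩ := F.exists_local_inverse hσ hX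
  rw [contDiff_iff_contDiffAt]
  intro u
  obtain ⟨lam, hl, hlam⟩ := (((tendsto_dil_zero (F.sigmaProd_pos hσ) u).eventually hU).and
    self_mem_nhdsWithin).exists
  have hlam : (0 : ℝ) < lam := hlam
  have e : Function.invFun F.T = fun u => dil F.weight lam⁻¹
      (Function.invFun F.T (dil (F.sigmaProd σ) lam u)) := by
    funext u
    rw [F.invFun_T_dil hσ hX hlam, dil_inv_dil _ hlam]
  rw [e]
  exact (contDiff_dil _ _).contDiffAt.comp u
    (((h _ hl).1).comp u (contDiff_dil _ _).contDiffAt)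

/-! ### The lifted vector fields -/

include hσ hX in
theorem Z_T (i : Fin (n + p)) (a : Fin (n + p) → ℝ) :
    F.Z i (F.T a) = fderiv ℝ F.T a (F.J i a) := by
  rw [Z, F.invFun_T hσ hX]

include hσ hX in
theorem contDiff_Z (i : Fin (n + p)) : ContDiff ℝ ∞ (F.Z i) :=
  (((F.contDiff_T hσ hX).fderiv_right (m := ∞) (by simp)).comp
    (F.contDiff_invFun_T hσ hX)).clm_apply
    ((F.contDiff_J hσ hX i).comp (F.contDiff_invFun_T hσ hX))

-- The relation dπ(J_k) = X_k ∘ π, read through T, is the lifting property.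
include hσ hX in
theorem Z_inl (k : Fin m) (u : Fin n ⊕ Fin p → ℝ) (j : Fin n) :
    F.Z (Fin.castLE F.le k) u (Sum.inl j) = (X k).1 (u ∘ Sum.inl) j := by
  obtain ⟨a, rfl⟩ := F.T_surjective hσ hX u
  rw [F.Z_T hσ hX, F.fderiv_T_inl hσ hX, F.fderiv_proj_J hσ hX, F.basis_castLE]
  rfl

-- Differentiating the equivariance of T along J_k transfers the homogeneity of J_k to Z_k.
include hσ hX in
theorem Z_dil {lam : ℝ} (hlam : 0 < lam) (k : Fin m) (u : Fin n ⊕ Fin p → ℝ) :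
    dil (F.sigmaProd σ) lam (F.Z (Fin.castLE F.le k) u) =
      lam • F.Z (Fin.castLE F.le k) (dil (F.sigmaProd σ) lam u) := by
  obtain ⟨a, rfl⟩ := F.T_surjective hσ hX u
  rw [← F.T_dil hσ hX hlam, F.Z_T hσ hX, F.Z_T hσ hX]
  have hd : Differentiable ℝ F.T := (F.contDiff_T hσ hX).differentiable (by simp)
  have h1 : HasFDerivAt (fun a => F.T (dil F.weight lam a))
      ((fderiv ℝ F.T (dil F.weight lam a)).comp (dilL F.weight lam)) a :=
    (hd (dil F.weight lam a)).hasFDerivAt.comp a (hasFDerivAt_dil F.weight lam a)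
  have h2 : HasFDerivAt (fun a => dil (F.sigmaProd σ) lam (F.T a))
      ((dilL (F.sigmaProd σ) lam).comp (fderiv ℝ F.T a)) a :=
    (hasFDerivAt_dil _ lam (F.T a)).comp a (hd a).hasFDerivAt
  have h3 : (fun a => F.T (dil F.weight lam a)) = fun a => dil (F.sigmaProd σ) lam (F.T a) :=
    funext fun a => F.T_dil hσ hX hlam a
  rw [h3] at h1
  have h4 := congrArg (fun L : (Fin (n + p) → ℝ) →L[ℝ] (Fin n ⊕ Fin p → ℝ) =>
    L (F.J (Fin.castLE F.le k) a)) (h2.unique h1)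
  simp only [ContinuousLinearMap.comp_apply, dilL_apply] at h4
  rw [h4, F.J_dil hσ hX hlam, map_smul]

include hσ hX in
theorem Z_homog (k : Fin m) (i : Fin n ⊕ Fin p) :
    Homog (F.sigmaProd σ) (F.sigmaProd σ i - 1) fun u => F.Z (Fin.castLE F.le k) u i := by
  intro lam hlam u
  have := congrFun (F.Z_dil hσ hX hlam k u) i
  rw [dil_apply, Pi.smul_apply, smul_eq_mul] at this
  rw [Real.rpow_sub hlam, Real.rpow_one]
  field_simp
  linarith

include hσ hX in
theorem generatesFirstLayer : F.GeneratesFirstLayer σ := by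
  intro k
  constructor
  · intro u
    have hd : Differentiable ℝ F.T := (F.contDiff_T hσ hX).differentiable (by simp)
    have h1 := F.hasDerivAt_mul_J hσ hX (Fin.castLE F.le k) (Function.invFun F.T u)
    have e : F.mul (Function.invFun F.T u) ((0 : ℝ) • Pi.single (Fin.castLE F.le k) 1) =
        Function.invFun F.T u := by rw [zero_smul, mul_zero_right]
    have h2 : HasFDerivAt F.T (fderiv ℝ F.T (Function.invFun F.T u))
        (F.mul (Function.invFun F.T u) ((0 : ℝ) • Pi.single (Fin.castLE F.le k) 1)) := by
      rw [e]; exact (hd _).hasFDerivAt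
    have h3 := h2.comp_hasDerivAt 0 h1
    have h4 : (fun t : ℝ => F.star u (F.T (t • Pi.single (Fin.castLE F.le k) 1))) =
        F.T ∘ fun t : ℝ => F.mul (Function.invFun F.T u) (t • Pi.single (Fin.castLE F.le k) 1) := by
      funext t
      rw [star, F.invFun_T hσ hX]; rfl
    rw [h4]
    exact h3
  · intro lam hlam f hf u
    have hfd : Differentiable ℝ f := hf.differentiable (by simp)
    have h1 : HasFDerivAt (f ∘ dil (F.sigmaProd σ) lam)
        ((fderiv ℝ f (dil (F.sigmaProd σ) lam u)).comp (dilL (F.sigmaProd σ) lam)) u :=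
      (hfd _).hasFDerivAt.comp u (hasFDerivAt_dil _ lam u)
    rw [act, h1.fderiv, ContinuousLinearMap.comp_apply, dilL_apply, F.Z_dil hσ hX hlam, map_smul]
    rfl

end Diffeomorphism

end Frame

/-! ## The calculus of partial differential operators -/

section Multiindices

variable {ι : Type} [Fintype ι] [DecidableEq ι]

theorem pd_comm {f : (ι → ℝ) → ℝ} (hf : ContDiff ℝ ∞ f) (i j : ι) :
    pd i (pd j f) = pd j (pd i f) := by
  funext x
  have hf2 : DifferentiableAt ℝ (fderiv ℝ f) x :=
    ((hf.fderiv_right (m := 1) (by norm_cast)).differentiable (by simp)) x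
  have e : ∀ a b : ι, pd a (pd b f) x =
      fderiv ℝ (fderiv ℝ f) x (Pi.single a 1) (Pi.single b 1) := by
    intro a b
    change fderiv ℝ (fun y => fderiv ℝ f y (Pi.single b 1)) x (Pi.single a 1) = _
    rw [fderiv_clm_apply hf2 (differentiableAt_const _)]
    simp
  have hs := hf.contDiffAt (x := x) |>.isSymmSndFDerivAt (by
      rw [minSmoothness_of_isRCLikeNormedField]; exact WithTop.coe_le_coe.2 le_top)
  rw [e, e]
  exact hs _ _

theorem pd_add {f g : (ι → ℝ) → ℝ} (hf : ContDiff ℝ ∞ f) (hg : ContDiff ℝ ∞ g) (i : ι) :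
    pd i (fun x => f x + g x) = fun x => pd i f x + pd i g x := by
  funext x
  have := fderiv_fun_add (hf.differentiable (by simp) x) (hg.differentiable (by simp) x)
  simp only [pd]
  rw [this]; rfl

theorem pd_mul {f g : (ι → ℝ) → ℝ} (hf : ContDiff ℝ ∞ f) (hg : ContDiff ℝ ∞ g) (i : ι) :
    pd i (fun x => f x * g x) = fun x => f x * pd i g x + pd i f x * g x := by
  funext x
  have := fderiv_fun_mul (hf.differentiable (by simp) x) (hg.differentiable (by simp) x)
  simp only [pd]
  rw [this]
  simp [mul_comm]

omit [Fintype ι] in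
theorem pd_zero (i : ι) : pd i (fun _ => (0 : ℝ)) = fun _ => 0 := by
  funext x; simp [pd]

omit [Fintype ι] in
theorem iterate_pd_induction {P : ((ι → ℝ) → ℝ) → Prop} (hP : ∀ i f, P f → P (pd i f)) (i : ι)
    (k : ℕ) {f : (ι → ℝ) → ℝ} (hf : P f) : P ((pd i)^[k] f) := by
  induction k with
  | zero => exact hf
  | succ k ih => rw [Function.iterate_succ_apply']; exact hP _ _ ih

omit [Fintype ι] in
theorem foldr_pd_induction {P : ((ι → ℝ) → ℝ) → Prop} (hP : ∀ i f, P f → P (pd i f)) (α : ι → ℕ)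
    (l : List ι) {f : (ι → ℝ) → ℝ} (hf : P f) : P (l.foldr (fun i g => (pd i)^[α i] g) f) := by
  induction l with
  | nil => exact hf
  | cons i l ih => exact iterate_pd_induction hP i _ ih

theorem mderiv_induction {P : ((ι → ℝ) → ℝ) → Prop} (hP : ∀ i f, P f → P (pd i f)) (α : ι → ℕ)
    {f : (ι → ℝ) → ℝ} (hf : P f) : P (mderiv α f) :=
  foldr_pd_induction hP α _ hf

theorem contDiff_mderiv {f : (ι → ℝ) → ℝ} (hf : ContDiff ℝ ∞ f) (α : ι → ℕ) :
    ContDiff ℝ ∞ (mderiv α f) :=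
  mderiv_induction (P := ContDiff ℝ ∞) (fun i _ hf => contDiff_pd hf i) α hf

theorem hasCompactSupport_mderiv {f : (ι → ℝ) → ℝ} (hf : HasCompactSupport f) (α : ι → ℕ) :
    HasCompactSupport (mderiv α f) :=
  mderiv_induction (P := HasCompactSupport) (fun _ _ hf => hf.fderiv_apply ℝ _) α hf

theorem mderiv_zero_fun (α : ι → ℕ) : mderiv α (fun _ => (0 : ℝ)) = fun _ => 0 :=
  mderiv_induction (P := fun f => f = fun _ => 0) (fun i f hf => by rw [hf, pd_zero]) α rfl

theorem mderiv_zero (f : (ι → ℝ) → ℝ) : mderiv 0 f = f := by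
  have : ∀ l : List ι, l.foldr (fun i g => (pd i)^[(0 : ι → ℕ) i] g) f = f := by
    intro l
    induction l with
    | nil => rfl
    | cons i l ih => rw [List.foldr_cons, ih]; rfl
  exact this _

theorem mderiv_add_fun {f g : (ι → ℝ) → ℝ} (hf : ContDiff ℝ ∞ f) (hg : ContDiff ℝ ∞ g)
    (α : ι → ℕ) : mderiv α (fun x => f x + g x) = fun x => mderiv α f x + mderiv α g x := by
  have hit : ∀ (i : ι) (k : ℕ) (f g : (ι → ℝ) → ℝ), ContDiff ℝ ∞ f → ContDiff ℝ ∞ g →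
      (pd i)^[k] (fun x => f x + g x) = fun x => (pd i)^[k] f x + (pd i)^[k] g x := by
    intro i k
    induction k with
    | zero => intro f g _ _; rfl
    | succ k ih =>
      intro f g hf hg
      rw [Function.iterate_succ_apply, pd_add hf hg, ih _ _ (contDiff_pd hf i) (contDiff_pd hg i)]
      rfl
  have : ∀ l : List ι, l.foldr (fun i g => (pd i)^[α i] g) (fun x => f x + g x) = fun x =>
      l.foldr (fun i g => (pd i)^[α i] g) f x + l.foldr (fun i g => (pd i)^[α i] g) g x := by
    intro l
    induction l with
    | nil => rfl
    | cons i l ih =>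
      rw [List.foldr_cons, ih, hit]
      · rfl
      · exact foldr_pd_induction (P := ContDiff ℝ ∞) (fun i _ hf => contDiff_pd hf i) α l hf
      · exact foldr_pd_induction (P := ContDiff ℝ ∞) (fun i _ hf => contDiff_pd hf i) α l hg
  exact this _

theorem iterate_pd_comm {f : (ι → ℝ) → ℝ} (hf : ContDiff ℝ ∞ f) (i j : ι) (k : ℕ) :
    (pd j)^[k] (pd i f) = pd i ((pd j)^[k] f) := by
  induction k with
  | zero => rfl
  | succ k ih =>
    rw [Function.iterate_succ_apply', ih, Function.iterate_succ_apply', pd_comm]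
    exact iterate_pd_induction (P := ContDiff ℝ ∞) (fun i _ hf => contDiff_pd hf i) j k hf

/-- `mderiv` takes derivatives in a fixed order of the variables, in which i occurs exactly once;
the extra derivative is commuted to the front. -/
theorem mderiv_add_single {f : (ι → ℝ) → ℝ} (hf : ContDiff ℝ ∞ f) (α : ι → ℕ) (i : ι) :
    mderiv (α + Pi.single i 1) f = pd i (mderiv α f) := by
  have hne : ∀ l : List ι, i ∉ l →
      l.foldr (fun j g => (pd j)^[(α + Pi.single i 1 : ι → ℕ) j] g) f =
        l.foldr (fun j g => (pd j)^[α j] g) f := by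
    intro l hl
    induction l with
    | nil => rfl
    | cons j l ih =>
      rw [List.mem_cons, not_or] at hl
      rw [List.foldr_cons, ih hl.2, List.foldr_cons]
      congr 2
      simp [Ne.symm hl.1]
  have : ∀ l : List ι, l.Nodup → i ∈ l →
      l.foldr (fun j g => (pd j)^[(α + Pi.single i 1 : ι → ℕ) j] g) f =
        pd i (l.foldr (fun j g => (pd j)^[α j] g) f) := by
    intro l hl hi
    induction l with
    | nil => simp at hi
    | cons j l ih =>
      rw [List.nodup_cons] at hl
      rw [List.foldr_cons, List.foldr_cons]
      by_cases hij : i = j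
      · subst hij
        rw [hne l hl.1, ← Function.iterate_succ_apply' (pd i)]
        congr 2
        simp
      · have hi' : i ∈ l := by
          rcases List.mem_cons.1 hi with h | h
          · exact absurd h hij
          · exact h
        rw [ih hl.2 hi']
        have e : (α + Pi.single i 1 : ι → ℕ) j = α j := by
          simp [Ne.symm hij]
        rw [e, iterate_pd_comm]
        exact foldr_pd_induction (P := ContDiff ℝ ∞) (fun i _ hf => contDiff_pd hf i) α l hf
  exact this _ (Finset.nodup_toList _) (Finset.mem_toList.2 (Finset.mem_univ i))

theorem mderiv_single {f : (ι → ℝ) → ℝ} (hf : ContDiff ℝ ∞ f) (i : ι) :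
    mderiv (Pi.single i 1) f = pd i f := by
  have := mderiv_add_single hf 0 i
  rwa [zero_add, mderiv_zero] at this

theorem mderiv_single_add_single {f : (ι → ℝ) → ℝ} (hf : ContDiff ℝ ∞ f) (i j : ι) :
    mderiv (Pi.single i 1 + Pi.single j 1) f = pd i (pd j f) := by
  rw [mderiv_add_single hf, mderiv_single hf, pd_comm hf]

theorem mderiv_comp_dil (w : ι → ℝ) {lam : ℝ} (hlam : 0 < lam) {f : (ι → ℝ) → ℝ}
    (hf : ContDiff ℝ ∞ f) (α : ι → ℕ) : mderiv α (fun x => f (dil w lam x)) =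
      fun x => lam ^ (∑ i, w i * α i) * mderiv α f (dil w lam x) := by
  have hpd : ∀ (i : ι) (c : ℝ) (g : (ι → ℝ) → ℝ), ContDiff ℝ ∞ g →
      pd i (fun x => c * g (dil w lam x)) = fun x => (lam ^ w i * c) * pd i g (dil w lam x) := by
    intro i c g hg
    have hd : Differentiable ℝ fun x => g (dil w lam x) :=
      (hg.comp (contDiff_dil w lam)).differentiable (by simp)
    rw [pd_const_mul hd]
    funext x
    rw [pd_comp_dil w lam (hg.differentiable (by simp))]
    ring
  have hit : ∀ (i : ι) (k : ℕ) (c : ℝ) (g : (ι → ℝ) → ℝ), ContDiff ℝ ∞ g →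
      (pd i)^[k] (fun x => c * g (dil w lam x)) =
        fun x => (lam ^ (w i * k) * c) * (pd i)^[k] g (dil w lam x) := by
    intro i k
    induction k with
    | zero => intro c g _; simp
    | succ k ih =>
      intro c g hg
      rw [Function.iterate_succ_apply, hpd i c g hg, ih _ _ (contDiff_pd hg i)]
      funext x
      rw [← mul_assoc, ← Real.rpow_add hlam, Function.iterate_succ_apply]
      push_cast
      ring_nf
  have : ∀ l : List ι, l.foldr (fun i g => (pd i)^[α i] g) (fun x => f (dil w lam x)) =
      fun x => lam ^ (l.map fun i => w i * α i).sum *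
        l.foldr (fun i g => (pd i)^[α i] g) f (dil w lam x) := by
    intro l
    induction l with
    | nil => simp
    | cons i l ih =>
      rw [List.foldr_cons, ih, hit]
      · rw [List.map_cons, List.sum_cons, Real.rpow_add hlam]; rfl
      · exact foldr_pd_induction (P := ContDiff ℝ ∞) (fun i _ hf => contDiff_pd hf i) α l hf
  have h := this (Finset.univ : Finset ι).toList
  rw [Finset.sum_map_toList] at h
  exact h

namespace PDO

/-- The operator `g D^α`. -/
def single (α : ι → ℕ) (g : (ι → ℝ) → ℝ) (hg : ContDiff ℝ ∞ g) : PDO ι where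
  coeff := Finsupp.single α g
  smooth β := by
    classical
    by_cases h : α = β
    · subst h; rwa [Finsupp.single_eq_same]
    · rw [Finsupp.single_apply, if_neg h]; exact contDiff_const

/-- The sum of two operators. -/
def add (P Q : PDO ι) : PDO ι where
  coeff := P.coeff + Q.coeff
  smooth α := (P.smooth α).add (Q.smooth α)

/-- The zero operator. -/
def zero : PDO ι where
  coeff := 0
  smooth _ := contDiff_const

theorem single_apply (α : ι → ℕ) {g : (ι → ℝ) → ℝ} (hg : ContDiff ℝ ∞ g) (f : (ι → ℝ) → ℝ) :
    (single α g hg).apply f = fun x => g x * mderiv α f x := by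
  funext x
  simp only [PDO.apply, single]
  rw [Finsupp.sum_single_index]; simp

theorem add_apply (P Q : PDO ι) (f : (ι → ℝ) → ℝ) :
    (P.add Q).apply f = fun x => P.apply f x + Q.apply f x := by
  funext x
  simp only [PDO.apply, add]
  rw [Finsupp.sum_add_index']
  · simp
  · intro α a b; rw [Pi.add_apply, add_mul]

theorem single_adjointApply (α : ι → ℕ) {g : (ι → ℝ) → ℝ} (hg : ContDiff ℝ ∞ g)
    (f : (ι → ℝ) → ℝ) : (single α g hg).adjointApply f =
      fun x => (-1) ^ (∑ i, α i) * mderiv α (fun y => g y * f y) x := by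
  funext x
  simp only [PDO.adjointApply, single]
  rw [Finsupp.sum_single_index]
  simp [mderiv_zero_fun]

theorem add_adjointApply (P Q : PDO ι) {f : (ι → ℝ) → ℝ} (hf : ContDiff ℝ ∞ f) :
    (P.add Q).adjointApply f = fun x => P.adjointApply f x + Q.adjointApply f x := by
  classical
  funext x
  simp only [PDO.adjointApply, add]
  have h0 : ∀ α : ι → ℕ, (-1 : ℝ) ^ (∑ i, α i) *
      mderiv α (fun y => (0 : (ι → ℝ) → ℝ) y * f y) x = 0 := by
    intro α; simp [mderiv_zero_fun]
  rw [Finsupp.sum_of_support_subset _ (s := P.coeff.support ∪ Q.coeff.support)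
      Finsupp.support_add _ (fun α _ => h0 α),
    Finsupp.sum_of_support_subset P.coeff (s := P.coeff.support ∪ Q.coeff.support)
      Finset.subset_union_left _ (fun α _ => h0 α),
    Finsupp.sum_of_support_subset Q.coeff (s := P.coeff.support ∪ Q.coeff.support)
      Finset.subset_union_right _ (fun α _ => h0 α), ← Finset.sum_add_distrib]
  refine Finset.sum_congr rfl fun α _ => ?_
  rw [← mul_add]
  congr 1
  have e : (fun y => (P.coeff + Q.coeff) α y * f y) =
      fun y => P.coeff α y * f y + Q.coeff α y * f y := by
    funext y; rw [Finsupp.add_apply, Pi.add_apply, add_mul]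
  rw [e, mderiv_add_fun ((P.smooth α).mul hf) ((Q.smooth α).mul hf)]

end PDO

theorem IsPDO.congr {A B : ((ι → ℝ) → ℝ) → ((ι → ℝ) → ℝ)} (hA : IsPDO A)
    (h : ∀ f, ContDiff ℝ ∞ f → B f = A f) : IsPDO B := by
  obtain ⟨P, hP⟩ := hA
  exact ⟨P, fun f hf => (h f hf).trans (hP f hf)⟩

theorem IsPDO.add {A B : ((ι → ℝ) → ℝ) → ((ι → ℝ) → ℝ)} (hA : IsPDO A) (hB : IsPDO B) :
    IsPDO fun f x => A f x + B f x := by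
  obtain ⟨P, hP⟩ := hA
  obtain ⟨Q, hQ⟩ := hB
  refine ⟨P.add Q, fun f hf => ?_⟩
  rw [PDO.add_apply, ← hP f hf, ← hQ f hf]

theorem IsPDO.sum {κ : Type*} (s : Finset κ) {A : κ → ((ι → ℝ) → ℝ) → ((ι → ℝ) → ℝ)}
    (hA : ∀ k, IsPDO (A k)) : IsPDO fun f x => ∑ k ∈ s, A k f x := by
  classical
  induction s using Finset.induction_on with
  | empty => exact ⟨PDO.zero, fun f _ => by funext x; simp [PDO.apply, PDO.zero]⟩
  | insert a s ha ih =>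
    simp only [Finset.sum_insert ha]
    exact (hA a).add ih

theorem isPDO_mul_pd {g : (ι → ℝ) → ℝ} (hg : ContDiff ℝ ∞ g) (i : ι) :
    IsPDO fun f x => g x * pd i f x :=
  ⟨PDO.single (Pi.single i 1) g hg, fun f hf => by rw [PDO.single_apply, mderiv_single hf]⟩

theorem isPDO_mul_pd_pd {g : (ι → ℝ) → ℝ} (hg : ContDiff ℝ ∞ g) (i j : ι) :
    IsPDO fun f x => g x * pd i (pd j f) x :=
  ⟨PDO.single (Pi.single i 1 + Pi.single j 1) g hg, fun f hf => by
    rw [PDO.single_apply, mderiv_single_add_single hf]⟩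

/-- The contribution `c_i ∂_i (c_j ∂_j ·)` of a pair of variables to the square of the vector field
with the components `c`. -/
def pairTerm (V : (ι → ℝ) → (ι → ℝ)) (i j : ι) (f : (ι → ℝ) → ℝ) (x : ι → ℝ) : ℝ :=
  (V x i * pd i (fun y => V y j) x) * pd j f x + (V x i * V x j) * pd i (pd j f) x

theorem act_eq_sum (V : (ι → ℝ) → (ι → ℝ)) (f : (ι → ℝ) → ℝ) :
    act V f = fun x => ∑ i, V x i * pd i f x :=
  funext fun x => fderiv_eq_sum_pd f x (V x)

theorem pd_sum {κ : Type*} (s : Finset κ) {f : κ → (ι → ℝ) → ℝ} (hf : ∀ k, ContDiff ℝ ∞ (f k))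
    (i : ι) : pd i (fun x => ∑ k ∈ s, f k x) = fun x => ∑ k ∈ s, pd i (f k) x := by
  funext x
  simp only [pd]
  rw [fderiv_fun_sum fun k _ => (hf k).differentiable (by simp) x]
  simp

theorem act_act_eq_sum {V : (ι → ℝ) → (ι → ℝ)} (hV : ContDiff ℝ ∞ V) {f : (ι → ℝ) → ℝ}
    (hf : ContDiff ℝ ∞ f) : act V (act V f) = fun x => ∑ i, ∑ j, pairTerm V i j f x := by
  have hVi : ∀ i, ContDiff ℝ ∞ fun x => V x i := fun i => contDiff_pi.1 hV i
  rw [act_eq_sum, act_eq_sum]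
  funext x
  refine Finset.sum_congr rfl fun i _ => ?_
  rw [pd_sum _ fun j => (hVi j).mul (contDiff_pd hf j), Finset.mul_sum]
  refine Finset.sum_congr rfl fun j _ => ?_
  rw [pd_mul (hVi j) (contDiff_pd hf j), pairTerm]
  ring

theorem isPDO_pairTerm {V : (ι → ℝ) → (ι → ℝ)} (hV : ContDiff ℝ ∞ V) (i j : ι) :
    IsPDO (pairTerm V i j) := by
  have hVi : ∀ i, ContDiff ℝ ∞ fun x => V x i := fun i => contDiff_pi.1 hV i
  exact (isPDO_mul_pd ((hVi i).mul (contDiff_pd (hVi j) i)) j).add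
    (isPDO_mul_pd_pd ((hVi i).mul (hVi j)) i j)

theorem isPDO_sumSq {m : ℕ} {V : Fin m → (ι → ℝ) → (ι → ℝ)} (hV : ∀ k, ContDiff ℝ ∞ (V k)) :
    IsPDO (sumSq V) := by
  refine IsPDO.congr (IsPDO.sum Finset.univ fun k => IsPDO.sum Finset.univ fun i =>
    IsPDO.sum Finset.univ fun j => isPDO_pairTerm (hV k) i j) fun f hf => ?_
  funext x
  refine Finset.sum_congr rfl fun k _ => ?_
  rw [act_act_eq_sum (hV k) hf]

end Multiindices

/-! ## Saturable liftings of sums of squares -/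

section Saturable

variable {n p : ℕ}

/-- The bound of a single coefficient along the cut-offs. -/
def TermBound (θ : ℕ → (Fin p → ℝ) → ℝ) (γ : Fin n ⊕ Fin p → ℕ)
    (g : (Fin n ⊕ Fin p → ℝ) → ℝ) : Prop :=
  ∀ K : Set (Fin n → ℝ), IsCompact K → ∃ C : ℝ, ∀ x ∈ K, ∀ (ξ : Fin p → ℝ) (j : ℕ),
    |g (Sum.elim x ξ) * mderiv (γ ∘ Sum.inr) (θ j) ξ| ≤ C

theorem TermBound.zero (θ : ℕ → (Fin p → ℝ) → ℝ) (γ : Fin n ⊕ Fin p → ℕ) :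
    TermBound θ γ (fun _ : Fin n ⊕ Fin p → ℝ => 0) :=
  fun _ _ => ⟨0, fun _ _ _ _ => by simp⟩

theorem TermBound.neg {θ : ℕ → (Fin p → ℝ) → ℝ} {γ : Fin n ⊕ Fin p → ℕ}
    {g : (Fin n ⊕ Fin p → ℝ) → ℝ} (h : TermBound θ γ g) : TermBound θ γ fun z => -g z := by
  intro K hK
  obtain ⟨C, hC⟩ := h K hK
  exact ⟨C, fun x hx ξ j => by rw [neg_mul, abs_neg]; exact hC x hx ξ j⟩

theorem TermBound.add {θ : ℕ → (Fin p → ℝ) → ℝ} {γ : Fin n ⊕ Fin p → ℕ}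
    {g h : (Fin n ⊕ Fin p → ℝ) → ℝ} (hg : TermBound θ γ g) (hh : TermBound θ γ h) :
    TermBound θ γ fun z => g z + h z := by
  intro K hK
  obtain ⟨C, hC⟩ := hg K hK
  obtain ⟨D, hD⟩ := hh K hK
  refine ⟨C + D, fun x hx ξ j => ?_⟩
  rw [add_mul]
  exact (abs_add_le _ _).trans (add_le_add (hC x hx ξ j) (hD x hx ξ j))

theorem uniformBounds_iff {R : PDO (Fin n ⊕ Fin p)} {θ : ℕ → (Fin p → ℝ) → ℝ} :
    UniformBounds R θ ↔ ∀ γ, TermBound θ γ (R.coeff γ) :=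
  ⟨fun h γ K hK => h K hK γ, fun h K hK γ => h γ K hK⟩

theorem uniformBounds_single {θ : ℕ → (Fin p → ℝ) → ℝ} {γ : Fin n ⊕ Fin p → ℕ}
    {g : (Fin n ⊕ Fin p → ℝ) → ℝ} (hg : ContDiff ℝ ∞ g) (h : TermBound θ γ g) :
    UniformBounds (PDO.single γ g hg) θ := by
  rw [uniformBounds_iff]
  intro γ'
  by_cases e : γ = γ'
  · subst e
    simpa [PDO.single] using h
  · have : (PDO.single γ g hg).coeff γ' = fun _ => 0 := by
      simp only [PDO.single]
      rw [Finsupp.single_apply, if_neg e]; rfl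
    rw [this]
    exact TermBound.zero θ γ'

theorem uniformBounds_add {θ : ℕ → (Fin p → ℝ) → ℝ} {P Q : PDO (Fin n ⊕ Fin p)}
    (hP : UniformBounds P θ) (hQ : UniformBounds Q θ) : UniformBounds (P.add Q) θ := by
  rw [uniformBounds_iff] at *
  exact fun γ => (hP γ).add (hQ γ)

theorem actsInXi_single {γ : Fin n ⊕ Fin p → ℕ} {g : (Fin n ⊕ Fin p → ℝ) → ℝ}
    (hg : ContDiff ℝ ∞ g) (h : γ ∘ Sum.inr ≠ 0 ∨ g = 0) : ActsInXi (PDO.single γ g hg) := by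
  intro γ' hγ'
  simp only [PDO.single] at hγ'
  rw [Finsupp.single_apply] at hγ'
  split_ifs at hγ' with e
  · subst e
    exact h.resolve_right hγ'
  · exact absurd rfl hγ'

theorem actsInXi_add {P Q : PDO (Fin n ⊕ Fin p)} (hP : ActsInXi P) (hQ : ActsInXi Q) :
    ActsInXi (P.add Q) := by
  intro γ hγ
  by_cases h : P.coeff γ = 0
  · refine hQ γ fun h' => hγ ?_
    simp [PDO.add, h, h']
  · exact hP γ h

/-- The operator `A` and its formal adjoint act in the `ξ` variables, and the coefficients of the
adjoint satisfy the uniform bounds. -/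
def IsXiOperator (θ : ℕ → (Fin p → ℝ) → ℝ)
    (A : ((Fin n ⊕ Fin p → ℝ) → ℝ) → ((Fin n ⊕ Fin p → ℝ) → ℝ)) : Prop :=
  ∃ R Rstar : PDO (Fin n ⊕ Fin p), R.Represents A ∧ ActsInXi R ∧
    Rstar.IsFormalAdjoint R ∧ ActsInXi Rstar ∧ UniformBounds Rstar θ

theorem IsXiOperator.congr {θ : ℕ → (Fin p → ℝ) → ℝ}
    {A B : ((Fin n ⊕ Fin p → ℝ) → ℝ) → ((Fin n ⊕ Fin p → ℝ) → ℝ)} (h : IsXiOperator θ A)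
    (hAB : ∀ f, ContDiff ℝ ∞ f → B f = A f) : IsXiOperator θ B := by
  obtain ⟨R, Rs, h1, h2⟩ := h
  exact ⟨R, Rs, fun f hf => (hAB f hf).trans (h1 f hf), h2⟩

theorem IsXiOperator.add {θ : ℕ → (Fin p → ℝ) → ℝ}
    {A B : ((Fin n ⊕ Fin p → ℝ) → ℝ) → ((Fin n ⊕ Fin p → ℝ) → ℝ)} (hA : IsXiOperator θ A)
    (hB : IsXiOperator θ B) : IsXiOperator θ fun f z => A f z + B f z := by
  obtain ⟨P, Ps, h1, h2, h3, h4, h5⟩ := hA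
  obtain ⟨Q, Qs, k1, k2, k3, k4, k5⟩ := hB
  refine ⟨P.add Q, Ps.add Qs, fun f hf => ?_, actsInXi_add h2 k2, fun f hf => ?_,
    actsInXi_add h4 k4, uniformBounds_add h5 k5⟩
  · rw [PDO.add_apply, ← h1 f hf, ← k1 f hf]
  · rw [PDO.add_apply, PDO.add_adjointApply _ _ hf, h3 f hf, k3 f hf]

theorem IsXiOperator.zero (θ : ℕ → (Fin p → ℝ) → ℝ) :
    IsXiOperator θ fun (_ : (Fin n ⊕ Fin p → ℝ) → ℝ) _ => 0 := by
  refine ⟨PDO.zero, PDO.zero, fun f _ => ?_, fun γ h => absurd rfl h, fun f _ => ?_,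
    fun γ h => absurd rfl h, uniformBounds_iff.2 fun γ => TermBound.zero θ γ⟩
  · funext x; simp [PDO.apply, PDO.zero]
  · funext x; simp [PDO.apply, PDO.adjointApply, PDO.zero]

theorem IsXiOperator.sum {κ : Type*} {θ : ℕ → (Fin p → ℝ) → ℝ} (s : Finset κ)
    {A : κ → ((Fin n ⊕ Fin p → ℝ) → ℝ) → ((Fin n ⊕ Fin p → ℝ) → ℝ)}
    (hA : ∀ k, IsXiOperator θ (A k)) : IsXiOperator θ fun f z => ∑ k ∈ s, A k f z := by
  classical
  induction s using Finset.induction_on with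
  | empty => exact IsXiOperator.zero θ
  | insert a s ha ih =>
    simp only [Finset.sum_insert ha]
    exact (hA a).add ih

theorem single_inr_comp_ne_zero (j : Fin p) :
    (Pi.single (Sum.inr j) 1 : Fin n ⊕ Fin p → ℕ) ∘ Sum.inr ≠ 0 := by
  intro h
  have := congrFun h j
  simp at this

theorem add_single_inr_comp_ne_zero (γ : Fin n ⊕ Fin p → ℕ) (j : Fin p) :
    (γ + Pi.single (Sum.inr j) 1 : Fin n ⊕ Fin p → ℕ) ∘ Sum.inr ≠ 0 := by
  intro h
  have := congrFun h j
  simp at this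

/-- The adjoint is -∂_j(g ·); by `h0` no zero-order term appears. -/
theorem isXiOperator_mul_pd {θ : ℕ → (Fin p → ℝ) → ℝ} {g : (Fin n ⊕ Fin p → ℝ) → ℝ}
    (hg : ContDiff ℝ ∞ g) (j : Fin p) (h0 : pd (Sum.inr j) g = 0)
    (hb : TermBound θ (Pi.single (Sum.inr j) 1) g) :
    IsXiOperator θ fun f z => g z * pd (Sum.inr j) f z := by
  refine ⟨PDO.single (Pi.single (Sum.inr j) 1) g hg,
    PDO.single (Pi.single (Sum.inr j) 1) (fun z => -g z) hg.neg, fun f hf => ?_,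
    actsInXi_single _ (Or.inl (single_inr_comp_ne_zero j)), fun f hf => ?_,
    actsInXi_single _ (Or.inl (single_inr_comp_ne_zero j)), uniformBounds_single _ hb.neg⟩
  · rw [PDO.single_apply, mderiv_single hf]
  · rw [PDO.single_apply, PDO.single_adjointApply, mderiv_single (hg.mul hf), mderiv_single hf,
      pd_mul hg hf, h0]
    funext z
    simp

/-- By Leibniz the adjoint is g ∂_b∂_j + (∂_b g) ∂_j + (∂_j g) ∂_b + ∂_j∂_b g. The hypothesis `h0`
removes the last term, and `hb` deals with the third, which would be a pure x-derivative when b is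
an x variable. -/
theorem isXiOperator_mul_pd_pd {θ : ℕ → (Fin p → ℝ) → ℝ} {g : (Fin n ⊕ Fin p → ℝ) → ℝ}
    (hg : ContDiff ℝ ∞ g) (b : Fin n ⊕ Fin p) (j : Fin p) (h0 : pd (Sum.inr j) (pd b g) = 0)
    (hb1 : TermBound θ (Pi.single b 1 + Pi.single (Sum.inr j) 1) g)
    (hb2 : TermBound θ (Pi.single (Sum.inr j) 1) (pd b g))
    (hb3 : TermBound θ (Pi.single b 1) (pd (Sum.inr j) g))
    (hb : (Pi.single b 1 : Fin n ⊕ Fin p → ℕ) ∘ Sum.inr ≠ 0 ∨ pd (Sum.inr j) g = 0) :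
    IsXiOperator θ fun f z => g z * pd b (pd (Sum.inr j) f) z := by
  refine ⟨PDO.single (Pi.single b 1 + Pi.single (Sum.inr j) 1) g hg,
    (PDO.single (Pi.single b 1 + Pi.single (Sum.inr j) 1) g hg).add
      ((PDO.single (Pi.single (Sum.inr j) 1) (pd b g) (contDiff_pd hg b)).add
        (PDO.single (Pi.single b 1) (pd (Sum.inr j) g) (contDiff_pd hg _))), fun f hf => ?_,
    actsInXi_single _ (Or.inl (add_single_inr_comp_ne_zero _ j)), fun f hf => ?_,
    actsInXi_add (actsInXi_single _ (Or.inl (add_single_inr_comp_ne_zero _ j)))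
      (actsInXi_add (actsInXi_single _ (Or.inl (single_inr_comp_ne_zero j)))
        (actsInXi_single _ hb)),
    uniformBounds_add (uniformBounds_single _ hb1)
      (uniformBounds_add (uniformBounds_single _ hb2) (uniformBounds_single _ hb3))⟩
  · rw [PDO.single_apply, mderiv_single_add_single hf]
  · rw [PDO.add_apply, PDO.add_apply, PDO.single_apply, PDO.single_apply, PDO.single_apply,
      PDO.single_adjointApply, mderiv_single_add_single (hg.mul hf), mderiv_single_add_single hf,
      mderiv_single hf, mderiv_single hf, pd_comm (hg.mul hf), pd_mul hg hf,
      pd_add (hg.mul (contDiff_pd hf b)) ((contDiff_pd hg b).mul hf),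
      pd_mul hg (contDiff_pd hf b), pd_mul (contDiff_pd hg b) hf, h0, pd_comm hf b]
    funext z
    have hs : ∑ i, (Pi.single b 1 + Pi.single (Sum.inr j) 1 : Fin n ⊕ Fin p → ℕ) i = 2 := by
      have : ∀ c : Fin n ⊕ Fin p, ∑ i, (Pi.single c 1 : Fin n ⊕ Fin p → ℕ) i = 1 := fun c => by
        rw [Finset.sum_pi_single']; simp
      simp only [Pi.add_apply]
      rw [Finset.sum_add_distrib, this, this]
    rw [hs]
    simp
    ring

/-! ### Bounds along dilated cut-offs -/

theorem dil_sumElim (w : Fin n ⊕ Fin p → ℝ) (lam : ℝ) (x : Fin n → ℝ) (ξ : Fin p → ℝ) :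
    dil w lam (Sum.elim x ξ) =
      Sum.elim (dil (w ∘ Sum.inl) lam x) (dil (w ∘ Sum.inr) lam ξ) := by
  funext i; cases i <;> rfl

theorem continuous_sumElim :
    Continuous fun q : (Fin n → ℝ) × (Fin p → ℝ) => (Sum.elim q.1 q.2 : Fin n ⊕ Fin p → ℝ) := by
  refine continuous_pi fun i => ?_
  cases i with
  | inl i => exact (continuous_apply i).comp continuous_fst
  | inr i => exact (continuous_apply i).comp continuous_snd

/-- With (x', ξ') the dilate of (x, ξ), the product g·D^βθ_j is a nonnegative power of `lam j` ≤ 1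
times g(x', ξ') D^βθ(ξ'), which is bounded on a compact set. The factor a is bounded on K directly
and left unscaled: in mixed terms the degree of the full coefficient may exceed the weight of β. -/
theorem termBound_of_homog {w : Fin n ⊕ Fin p → ℝ} (hw : ∀ i, 0 < w i) {θ : (Fin p → ℝ) → ℝ}
    (hθ : ContDiff ℝ ∞ θ) (hθc : HasCompactSupport θ) {lam : ℕ → ℝ} (hlam : ∀ j, 0 < lam j)
    (hlam1 : ∀ j, lam j ≤ 1) {γ : Fin n ⊕ Fin p → ℕ} {d : ℝ}
    (hd : d ≤ ∑ k, w (Sum.inr k) * γ (Sum.inr k)) {a : (Fin n → ℝ) → ℝ} (ha : Continuous a)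
    {g : (Fin n ⊕ Fin p → ℝ) → ℝ} (hg : Continuous g) (hgh : Homog w d g) :
    TermBound (fun j ξ => θ (dil (w ∘ Sum.inr) (lam j) ξ)) γ
      fun z => a (z ∘ Sum.inl) * g z := by
  intro K hK
  set β := γ ∘ Sum.inr with hβ
  have hcs : IsCompact (tsupport (mderiv β θ)) := hasCompactSupport_mderiv hθc β
  -- All dilates of K by factors in [0,1] form one compact set; positivity of the weights gives
  -- continuity at the factor 0.
  have hK' : IsCompact ((fun q : ℝ × (Fin n → ℝ) => dil (w ∘ Sum.inl) q.1 q.2) ''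
      (Set.Icc 0 1 ×ˢ K)) := by
    refine (isCompact_Icc.prod hK).image (continuous_pi fun i => ?_)
    exact ((Real.continuous_rpow_const (hw _).le).comp continuous_fst).mul
      ((continuous_apply i).comp continuous_snd)
  set K' := (fun q : ℝ × (Fin n → ℝ) => dil (w ∘ Sum.inl) q.1 q.2) '' (Set.Icc 0 1 ×ˢ K)
  obtain ⟨A, hA⟩ := hK.exists_bound_of_continuousOn ha.continuousOn
  have hGc : Continuous fun q : (Fin n → ℝ) × (Fin p → ℝ) =>
      g (Sum.elim q.1 q.2) * mderiv β θ q.2 :=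
    (hg.comp continuous_sumElim).mul ((contDiff_mderiv hθ β).continuous.comp continuous_snd)
  obtain ⟨B, hB⟩ := (hK'.prod hcs).exists_bound_of_continuousOn hGc.continuousOn
  refine ⟨|A| * |B|, fun x hx ξ j => ?_⟩
  have hl := hlam j
  set x' := dil (w ∘ Sum.inl) (lam j) x
  set ξ' := dil (w ∘ Sum.inr) (lam j) ξ with hξ'
  have hg1 := hgh (lam j) hl (Sum.elim x ξ)
  rw [dil_sumElim] at hg1
  have hm : mderiv β (fun ξ => θ (dil (w ∘ Sum.inr) (lam j) ξ)) ξ =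
      lam j ^ (∑ k, w (Sum.inr k) * γ (Sum.inr k)) * mderiv β θ ξ' := by
    rw [mderiv_comp_dil _ hl hθ]; rfl
  have hpos : 0 < lam j ^ d := Real.rpow_pos_of_pos hl d
  have hg2 : g (Sum.elim x ξ) = (lam j ^ d)⁻¹ * g (Sum.elim x' ξ') := by
    rw [hg1]; field_simp
  have hGB : |g (Sum.elim x' ξ') * mderiv β θ ξ'| ≤ |B| := by
    by_cases hmem : ξ' ∈ tsupport (mderiv β θ)
    · have := hB (x', ξ') ⟨⟨(lam j, x), ⟨⟨hl.le, hlam1 j⟩, hx⟩, rfl⟩, hmem⟩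
      exact this.trans (le_abs_self B)
    · rw [image_eq_zero_of_notMem_tsupport hmem]; simp
  have hr : (lam j ^ d)⁻¹ * lam j ^ (∑ k, w (Sum.inr k) * γ (Sum.inr k)) ≤ 1 := by
    rw [← Real.rpow_neg hl.le, ← Real.rpow_add hl]
    exact Real.rpow_le_one hl.le (hlam1 j) (by linarith)
  have hr0 : 0 ≤ (lam j ^ d)⁻¹ * lam j ^ (∑ k, w (Sum.inr k) * γ (Sum.inr k)) := by positivity
  have ha1 : |a x| ≤ |A| := (hA x hx).trans (le_abs_self A)
  rw [hm]
  beta_reduce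
  rw [hg2]
  have e : a (Sum.elim x ξ ∘ Sum.inl) * ((lam j ^ d)⁻¹ * g (Sum.elim x' ξ')) *
      (lam j ^ (∑ k, w (Sum.inr k) * γ (Sum.inr k)) * mderiv β θ ξ') =
      a x * (((lam j ^ d)⁻¹ * lam j ^ (∑ k, w (Sum.inr k) * γ (Sum.inr k))) *
        (g (Sum.elim x' ξ') * mderiv β θ ξ')) := by
    rw [Sum.elim_comp_inl]; ring
  rw [e, abs_mul, abs_mul, abs_of_nonneg hr0]
  refine mul_le_mul ha1 ?_ (by positivity) (abs_nonneg A)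
  calc _ ≤ 1 * |B| := mul_le_mul hr hGB (abs_nonneg _) zero_le_one
    _ = |B| := one_mul _

theorem sum_weight_single (w : Fin n ⊕ Fin p → ℝ) (j : Fin p) :
    ∑ k, w (Sum.inr k) * ((Pi.single (Sum.inr j) 1 : Fin n ⊕ Fin p → ℕ) (Sum.inr k) : ℝ) =
      w (Sum.inr j) := by
  rw [Finset.sum_eq_single j]
  · simp
  · intro k _ hk
    rw [Pi.single_eq_of_ne (by simpa using hk)]; simp
  · simp

theorem sum_weight_single_inl (w : Fin n ⊕ Fin p → ℝ) (i : Fin n) :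
    ∑ k, w (Sum.inr k) * ((Pi.single (Sum.inl i) 1 : Fin n ⊕ Fin p → ℕ) (Sum.inr k) : ℝ) = 0 := by
  refine Finset.sum_eq_zero fun k _ => ?_
  rw [Pi.single_eq_of_ne (by simp)]; simp

theorem sum_weight_add (w : Fin n ⊕ Fin p → ℝ) (γ δ : Fin n ⊕ Fin p → ℕ) :
    ∑ k, w (Sum.inr k) * ((γ + δ) (Sum.inr k) : ℝ) =
      ∑ k, w (Sum.inr k) * (γ (Sum.inr k) : ℝ) + ∑ k, w (Sum.inr k) * (δ (Sum.inr k) : ℝ) := by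
  rw [← Finset.sum_add_distrib]
  refine Finset.sum_congr rfl fun k _ => ?_
  rw [Pi.add_apply]; push_cast; ring

/-! ### Lifted vector fields -/

/-- The linear map `x ↦ (x, 0)`. -/
def inlL (n p : ℕ) : (Fin n → ℝ) →L[ℝ] (Fin n ⊕ Fin p → ℝ) :=
  LinearMap.toContinuousLinearMap
    { toFun := fun x => Sum.elim x 0
      map_add' := fun x y => by funext i; cases i <;> simp
      map_smul' := fun c x => by funext i; cases i <;> simp }

theorem sumElim_eq_inlL (ξ : Fin p → ℝ) :
    (fun x : Fin n → ℝ => (Sum.elim x ξ : Fin n ⊕ Fin p → ℝ)) =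
      fun x => inlL n p x + Sum.elim (0 : Fin n → ℝ) ξ := by
  funext x i; cases i <;> simp [inlL]

theorem contDiff_sumElim_left (ξ : Fin p → ℝ) :
    ContDiff ℝ ∞ fun x : Fin n → ℝ => (Sum.elim x ξ : Fin n ⊕ Fin p → ℝ) := by
  rw [sumElim_eq_inlL]
  exact (inlL n p).contDiff.add contDiff_const

theorem pd_comp_sumElim {u : (Fin n ⊕ Fin p → ℝ) → ℝ} (hu : Differentiable ℝ u) (ξ : Fin p → ℝ)
    (i : Fin n) : pd i (fun x => u (Sum.elim x ξ)) = fun x => pd (Sum.inl i) u (Sum.elim x ξ) := by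
  funext x
  have h1 : HasFDerivAt (fun x : Fin n → ℝ => (Sum.elim x ξ : Fin n ⊕ Fin p → ℝ)) (inlL n p) x := by
    rw [sumElim_eq_inlL]
    exact (inlL n p).hasFDerivAt.add_const _
  have h2 := (hu (Sum.elim x ξ)).hasFDerivAt.comp x h1
  have h3 : inlL n p (Pi.single i 1) = Pi.single (Sum.inl i) 1 := by
    funext k
    cases k with
    | inl k => by_cases h : k = i <;> simp [inlL, h]
    | inr k => simp [inlL]
  have h4 : fderiv ℝ (fun x => u (Sum.elim x ξ)) x =
      (fderiv ℝ u (Sum.elim x ξ)).comp (inlL n p) := h2.fderiv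
  rw [pd, h4, ContinuousLinearMap.comp_apply, h3]; rfl

theorem comp_inl_eq (z : Fin n ⊕ Fin p → ℝ) : Sum.elim (z ∘ Sum.inl) (z ∘ Sum.inr) = z :=
  Sum.elim_comp_inl_inr z

theorem pd_inr_comp_inl (a : (Fin n → ℝ) → ℝ) (j : Fin p) :
    pd (Sum.inr j) (fun z : Fin n ⊕ Fin p → ℝ => a (z ∘ Sum.inl)) = 0 := by
  funext z
  have h : (fun t : ℝ => a ((z + t • Pi.single (Sum.inr j) 1) ∘ Sum.inl)) =
      fun _ => a (z ∘ Sum.inl) := by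
    funext t
    congr 1
    funext i; simp
  -- Without differentiability `fderiv` takes its default value 0, so no smoothness of a is
  -- required.
  by_cases hd : DifferentiableAt ℝ (fun z : Fin n ⊕ Fin p → ℝ => a (z ∘ Sum.inl)) z
  · have h1 : HasDerivAt (fun t : ℝ => z + t • (Pi.single (Sum.inr j) 1 : Fin n ⊕ Fin p → ℝ))
        (Pi.single (Sum.inr j) 1) 0 := by
      simpa using ((hasDerivAt_id (0 : ℝ)).smul_const
        (Pi.single (Sum.inr j) 1 : Fin n ⊕ Fin p → ℝ)).const_add z
    have hd' : HasFDerivAt (fun z : Fin n ⊕ Fin p → ℝ => a (z ∘ Sum.inl))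
        (fderiv ℝ (fun z : Fin n ⊕ Fin p → ℝ => a (z ∘ Sum.inl)) z)
        (z + (0 : ℝ) • (Pi.single (Sum.inr j) 1 : Fin n ⊕ Fin p → ℝ)) := by
      simpa using hd.hasFDerivAt
    have h2 := hd'.comp_hasDerivAt 0 h1
    have h3 : HasDerivAt (fun t : ℝ => a ((z + t • Pi.single (Sum.inr j) 1) ∘ Sum.inl))
        (pd (Sum.inr j) (fun z : Fin n ⊕ Fin p → ℝ => a (z ∘ Sum.inl)) z) 0 := h2
    rw [h] at h3
    exact h3.unique (hasDerivAt_const 0 _)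
  · rw [pd, fderiv_zero_of_not_differentiableAt hd]; rfl

end Saturable

/-! ### The remainder of the sum of squares of homogeneous lifts. -/

section LiftedFields

variable {n p : ℕ}

theorem termBound_of_homog_one {w : Fin n ⊕ Fin p → ℝ} (hw : ∀ i, 0 < w i) {θ : (Fin p → ℝ) → ℝ}
    (hθ : ContDiff ℝ ∞ θ) (hθc : HasCompactSupport θ) {lam : ℕ → ℝ} (hlam : ∀ j, 0 < lam j)
    (hlam1 : ∀ j, lam j ≤ 1) {γ : Fin n ⊕ Fin p → ℕ} {d : ℝ}
    (hd : d ≤ ∑ k, w (Sum.inr k) * γ (Sum.inr k))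
    {g : (Fin n ⊕ Fin p → ℝ) → ℝ} (hg : Continuous g) (hgh : Homog w d g) :
    TermBound (fun j ξ => θ (dil (w ∘ Sum.inr) (lam j) ξ)) γ g := by
  have := termBound_of_homog hw hθ hθc hlam hlam1 hd (a := fun _ => 1) continuous_const hg hgh
  simpa only [one_mul] using this

/-- The vector field `V` on `ℝ^n × ℝ^p` lifts `Y` and is homogeneous of degree one. -/
structure IsHomogeneousLift (w : Fin n ⊕ Fin p → ℝ) (Y : (Fin n → ℝ) → (Fin n → ℝ))
    (V : (Fin n ⊕ Fin p → ℝ) → (Fin n ⊕ Fin p → ℝ)) : Prop where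
  smooth_base : ContDiff ℝ ∞ Y
  smooth : ContDiff ℝ ∞ V
  homog : ∀ i, Homog w (w i - 1) fun z => V z i
  lift : ∀ z i, V z (Sum.inl i) = Y (z ∘ Sum.inl) i

namespace IsHomogeneousLift

variable {w : Fin n ⊕ Fin p → ℝ} {Y : (Fin n → ℝ) → (Fin n → ℝ)}
  {V : (Fin n ⊕ Fin p → ℝ) → (Fin n ⊕ Fin p → ℝ)}

theorem smooth_comp (h : IsHomogeneousLift w Y V) (i : Fin n ⊕ Fin p) :
    ContDiff ℝ ∞ fun z => V z i :=
  contDiff_pi.1 h.smooth i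

theorem pd_inr_inl (h : IsHomogeneousLift w Y V) (j : Fin p) (i : Fin n) :
    pd (Sum.inr j) (fun z => V z (Sum.inl i)) = 0 := by
  simp only [h.lift]
  exact pd_inr_comp_inl (fun x => Y x i) j

/-- The coefficient g = V_b V_j has degree w_b + w_j - 2. Hence ∂_b g and ∂_j g have degrees w_j - 2
and w_b - 2, and ∂_j∂_b g has degree -2, so it vanishes. -/
theorem isXiOperator_second (h : IsHomogeneousLift w Y V) (hw : ∀ i, 0 < w i)
    {θ : (Fin p → ℝ) → ℝ} (hθ : ContDiff ℝ ∞ θ) (hθc : HasCompactSupport θ) {lam : ℕ → ℝ}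
    (hlam : ∀ j, 0 < lam j) (hlam1 : ∀ j, lam j ≤ 1) (b : Fin n ⊕ Fin p) (j : Fin p) :
    IsXiOperator (fun j ξ => θ (dil (w ∘ Sum.inr) (lam j) ξ))
      fun f z => (V z b * V z (Sum.inr j)) * pd b (pd (Sum.inr j) f) z := by
  have hb := h.smooth_comp b
  have hj := h.smooth_comp (Sum.inr j)
  have hg : ContDiff ℝ ∞ fun z => V z b * V z (Sum.inr j) := hb.mul hj
  have hgh := (h.homog b).mul (h.homog (Sum.inr j))
  have hgb := hgh.pd (hg.differentiable (by simp)) b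
  have hgj := hgh.pd (hg.differentiable (by simp)) (Sum.inr j)
  have hgbj := hgb.pd ((contDiff_pd hg b).differentiable (by simp)) (Sum.inr j)
  have h2 : TermBound (fun j ξ => θ (dil (w ∘ Sum.inr) (lam j) ξ)) (Pi.single (Sum.inr j) 1)
      (pd b fun z => V z b * V z (Sum.inr j)) :=
    termBound_of_homog_one hw hθ hθc hlam hlam1 (by rw [sum_weight_single]; linarith)
      (contDiff_pd hg b).continuous hgb
  have h0 := hgbj.eq_zero_of_neg hw (by linarith) (contDiff_pd (contDiff_pd hg b) _).continuous
  cases b with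
  | inl i =>
    -- The component V_i is a function of x alone, and ∂_j V_j has degree -1.
    have hz : pd (Sum.inr j) (fun z => V z (Sum.inl i) * V z (Sum.inr j)) = fun _ => 0 := by
      have hjj := ((h.homog (Sum.inr j)).pd (hj.differentiable (by simp))
        (Sum.inr j)).eq_zero_of_neg hw (by linarith) (contDiff_pd hj _).continuous
      rw [pd_mul hb hj, hjj, h.pd_inr_inl]
      funext z; simp
    refine isXiOperator_mul_pd_pd hg (Sum.inl i) j h0 ?_ h2 ?_ (Or.inr hz)
    -- Only the weight of ξ_j is available here, so Y_i is bounded on K and just V_j, of degree w_j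
    -- - 1, is scaled.
    · simp only [h.lift]
      refine termBound_of_homog hw hθ hθc hlam hlam1 (a := fun x => Y x i) ?_
        ((continuous_apply i).comp h.smooth_base.continuous) hj.continuous (h.homog _)
      rw [sum_weight_add, sum_weight_single, sum_weight_single_inl]; linarith
    · rw [hz]; exact TermBound.zero _ _
  | inr i =>
    refine isXiOperator_mul_pd_pd hg (Sum.inr i) j h0 ?_ h2 ?_
      (Or.inl (single_inr_comp_ne_zero i))
    · refine termBound_of_homog_one hw hθ hθc hlam hlam1 ?_ hg.continuous hgh
      rw [sum_weight_add, sum_weight_single, sum_weight_single]; linarith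
    · refine termBound_of_homog_one hw hθ hθc hlam hlam1 ?_ (contDiff_pd hg _).continuous hgj
      rw [sum_weight_single]; linarith

/-- The first-order coefficient V_b ∂_b V_j has degree w_j - 2: bounded against ∂_j of the cut-off,
and free of ξ_j. -/
theorem isXiOperator_pairTerm_inr (h : IsHomogeneousLift w Y V) (hw : ∀ i, 0 < w i)
    {θ : (Fin p → ℝ) → ℝ} (hθ : ContDiff ℝ ∞ θ) (hθc : HasCompactSupport θ) {lam : ℕ → ℝ}
    (hlam : ∀ j, 0 < lam j) (hlam1 : ∀ j, lam j ≤ 1) (b : Fin n ⊕ Fin p) (j : Fin p) :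
    IsXiOperator (fun j ξ => θ (dil (w ∘ Sum.inr) (lam j) ξ)) (pairTerm V b (Sum.inr j)) := by
  have hb := h.smooth_comp b
  have hj := h.smooth_comp (Sum.inr j)
  have hg : ContDiff ℝ ∞ fun z => V z b * pd b (fun z => V z (Sum.inr j)) z :=
    hb.mul (contDiff_pd hj b)
  have hgh := (h.homog b).mul ((h.homog (Sum.inr j)).pd (hj.differentiable (by simp)) b)
  have h0 := (hgh.pd (hg.differentiable (by simp)) (Sum.inr j)).eq_zero_of_neg hw (by linarith)
    (contDiff_pd hg _).continuous
  refine IsXiOperator.add (isXiOperator_mul_pd hg j h0 ?_)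
    (h.isXiOperator_second hw hθ hθc hlam hlam1 b j)
  refine termBound_of_homog_one hw hθ hθc hlam hlam1 ?_ hg.continuous hgh
  rw [sum_weight_single]; linarith

theorem isXiOperator_pairTerm_inr_inl (h : IsHomogeneousLift w Y V) (hw : ∀ i, 0 < w i)
    {θ : (Fin p → ℝ) → ℝ} (hθ : ContDiff ℝ ∞ θ) (hθc : HasCompactSupport θ) {lam : ℕ → ℝ}
    (hlam : ∀ j, 0 < lam j) (hlam1 : ∀ j, lam j ≤ 1) (j : Fin p) (i : Fin n) :
    IsXiOperator (fun j ξ => θ (dil (w ∘ Sum.inr) (lam j) ξ))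
      (pairTerm V (Sum.inr j) (Sum.inl i)) := by
  refine (h.isXiOperator_second hw hθ hθc hlam hlam1 (Sum.inl i) j).congr fun f hf => ?_
  funext z
  rw [pairTerm, h.pd_inr_inl, pd_comm hf, Pi.zero_apply, mul_zero, zero_mul, zero_add,
    mul_comm (V z (Sum.inr j))]

theorem pairTerm_inl_inl (h : IsHomogeneousLift w Y V) (i i' : Fin n)
    {u : (Fin n ⊕ Fin p → ℝ) → ℝ} (hu : ContDiff ℝ ∞ u) (z : Fin n ⊕ Fin p → ℝ) :
    pairTerm V (Sum.inl i) (Sum.inl i') u z =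
      pairTerm Y i i' (fun x => u (Sum.elim x (z ∘ Sum.inr))) (z ∘ Sum.inl) := by
  have h1 : ∀ ξ : Fin p → ℝ, pd i (fun x => V (Sum.elim x ξ) (Sum.inl i')) =
      fun x => pd (Sum.inl i) (fun z => V z (Sum.inl i')) (Sum.elim x ξ) := fun ξ =>
    pd_comp_sumElim ((h.smooth_comp (Sum.inl i')).differentiable (by simp)) ξ i
  have h2 := congrFun (h1 (z ∘ Sum.inr)) (z ∘ Sum.inl)
  have h3 : (fun x => V (Sum.elim x (z ∘ Sum.inr)) (Sum.inl i')) = fun x => Y x i' := by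
    funext x; rw [h.lift, Sum.elim_comp_inl]
  rw [h3] at h2
  rw [comp_inl_eq] at h2
  rw [pairTerm, pairTerm, h2, pd_comp_sumElim (hu.differentiable (by simp)),
    pd_comp_sumElim ((contDiff_pd hu _).differentiable (by simp)), h.lift, h.lift]
  beta_reduce
  rw [comp_inl_eq]

end IsHomogeneousLift

theorem isXiOperator_remainder {m : ℕ} {w : Fin n ⊕ Fin p → ℝ}
    {Y : Fin m → (Fin n → ℝ) → (Fin n → ℝ)}
    {V : Fin m → (Fin n ⊕ Fin p → ℝ) → (Fin n ⊕ Fin p → ℝ)}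
    (h : ∀ k, IsHomogeneousLift w (Y k) (V k)) (hw : ∀ i, 0 < w i)
    {θ : (Fin p → ℝ) → ℝ} (hθ : ContDiff ℝ ∞ θ) (hθc : HasCompactSupport θ) {lam : ℕ → ℝ}
    (hlam : ∀ j, 0 < lam j) (hlam1 : ∀ j, lam j ≤ 1) :
    IsXiOperator (fun j ξ => θ (dil (w ∘ Sum.inr) (lam j) ξ))
      fun u z => sumSq V u z - inX (sumSq Y) u z := by
  have hgood : IsXiOperator (fun j ξ => θ (dil (w ∘ Sum.inr) (lam j) ξ)) fun u z =>
      ∑ k : Fin m, (∑ i : Fin n, ∑ j : Fin p, pairTerm (V k) (Sum.inl i) (Sum.inr j) u z +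
        ∑ j : Fin p, (∑ i : Fin n, pairTerm (V k) (Sum.inr j) (Sum.inl i) u z +
          ∑ j' : Fin p, pairTerm (V k) (Sum.inr j) (Sum.inr j') u z)) := by
    refine IsXiOperator.sum _ fun k => IsXiOperator.add ?_ ?_
    · exact IsXiOperator.sum _ fun i => IsXiOperator.sum _ fun j =>
        (h k).isXiOperator_pairTerm_inr hw hθ hθc hlam hlam1 _ j
    · refine IsXiOperator.sum _ fun j => IsXiOperator.add ?_ ?_
      · exact IsXiOperator.sum _ fun i =>
          (h k).isXiOperator_pairTerm_inr_inl hw hθ hθc hlam hlam1 j i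
      · exact IsXiOperator.sum _ fun j' =>
          (h k).isXiOperator_pairTerm_inr hw hθ hθc hlam hlam1 _ j'
  -- Of the four blocks of pairs of variables, the (x,x) block cancels against the operator on the
  -- base.
  refine hgood.congr fun u hu => ?_
  funext z
  have hux : ContDiff ℝ ∞ fun x => u (Sum.elim x (z ∘ Sum.inr)) :=
    hu.comp (contDiff_sumElim_left _)
  rw [inX, sumSq, sumSq, ← Finset.sum_sub_distrib]
  refine Finset.sum_congr rfl fun k _ => ?_
  rw [act_act_eq_sum (h k).smooth hu, act_act_eq_sum (h k).smooth_base hux]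
  simp only [Fintype.sum_sum_type, ← (h k).pairTerm_inl_inl _ _ hu z]
  rw [Finset.sum_add_distrib]
  ring

theorem act_lift {w : Fin n ⊕ Fin p → ℝ} {Y : (Fin n → ℝ) → (Fin n → ℝ)}
    {V : (Fin n ⊕ Fin p → ℝ) → (Fin n ⊕ Fin p → ℝ)} (h : IsHomogeneousLift w Y V)
    {f : (Fin n → ℝ) → ℝ} (hf : ContDiff ℝ ∞ f) :
    act V (fun z => f (z ∘ Sum.inl)) = fun z => act Y f (z ∘ Sum.inl) := by
  have hs : ContDiff ℝ ∞ fun z : Fin n ⊕ Fin p → ℝ => f (z ∘ Sum.inl) :=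
    hf.comp (contDiff_pi.2 fun i => contDiff_apply ℝ ℝ (Sum.inl i))
  funext z
  rw [act_eq_sum, act_eq_sum]
  beta_reduce
  rw [Fintype.sum_sum_type]
  have h0 : ∀ j : Fin p, pd (Sum.inr j) (fun z : Fin n ⊕ Fin p → ℝ => f (z ∘ Sum.inl)) z = 0 :=
    fun j => by rw [pd_inr_comp_inl]; rfl
  simp only [h0, mul_zero, Finset.sum_const_zero, add_zero, h.lift]
  refine Finset.sum_congr rfl fun i _ => ?_
  have h1 := pd_comp_sumElim (hs.differentiable (by simp)) (z ∘ Sum.inr) i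
  simp only [Sum.elim_comp_inl] at h1
  have h2 := congrFun h1 (z ∘ Sum.inl)
  rw [comp_inl_eq] at h2
  rw [← h2]

theorem isLifting_sumSq {m : ℕ} {w : Fin n ⊕ Fin p → ℝ}
    {Y : Fin m → (Fin n → ℝ) → (Fin n → ℝ)}
    {V : Fin m → (Fin n ⊕ Fin p → ℝ) → (Fin n ⊕ Fin p → ℝ)}
    (h : ∀ k, IsHomogeneousLift w (Y k) (V k)) : IsLifting (sumSq Y) (sumSq V) := by
  refine ⟨isPDO_sumSq fun k => (h k).smooth, fun f hf x ξ => ?_⟩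
  rw [sumSq, sumSq]
  refine Finset.sum_congr rfl fun k _ => ?_
  rw [act_lift (h k) hf, act_lift (h k) (contDiff_act hf (h k).smooth_base)]
  beta_reduce
  rw [Sum.elim_comp_inl]

end LiftedFields

/-! ## The cut-offs -/

namespace Frame

variable {n m p : ℕ} {X : Fin m → smoothVF n} (F : Frame X p)

theorem homNorm_nonneg (ξ : Fin p → ℝ) : 0 ≤ F.homNorm ξ :=
  Finset.sum_nonneg fun _ _ => Real.rpow_nonneg (abs_nonneg _) _

theorem homNorm_dil {lam : ℝ} (hlam : 0 < lam) (ξ : Fin p → ℝ) :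
    F.homNorm (dil F.sigmaStar lam ξ) = lam * F.homNorm ξ := by
  rw [homNorm, homNorm, Finset.mul_sum]
  refine Finset.sum_congr rfl fun k _ => ?_
  have hk := F.sigmaStar_pos k
  rw [dil_apply, abs_mul, abs_of_pos (Real.rpow_pos_of_pos hlam _),
    Real.mul_rpow (Real.rpow_pos_of_pos hlam _).le (abs_nonneg _), ← Real.rpow_mul hlam.le,
    mul_one_div_cancel hk.ne', Real.rpow_one]

theorem continuous_homNorm : Continuous F.homNorm :=
  continuous_finsetSum _ fun k _ =>
    (Real.continuous_rpow_const (one_div_pos.2 (F.sigmaStar_pos k)).le).comp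
      (continuous_apply k).abs

theorem isCompact_homNorm_le (r : ℝ) : IsCompact {ξ | F.homNorm ξ ≤ r} := by
  refine Metric.isCompact_of_isClosed_isBounded
    (isClosed_le F.continuous_homNorm continuous_const) ?_
  have hsub : {ξ | F.homNorm ξ ≤ r} ⊆ Set.pi Set.univ fun k : Fin p =>
      Set.Icc (-(|r| ^ F.sigmaStar k)) (|r| ^ F.sigmaStar k) := by
    intro ξ hξ k _
    have hk := F.sigmaStar_pos k
    have h1 : |ξ k| ^ (1 / F.sigmaStar k) ≤ F.homNorm ξ :=
      Finset.single_le_sum (f := fun k => |ξ k| ^ (1 / F.sigmaStar k))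
        (fun k _ => Real.rpow_nonneg (abs_nonneg _) _) (Finset.mem_univ k)
    have h2 : |ξ k| ^ (1 / F.sigmaStar k) ≤ |r| := (h1.trans hξ).trans (le_abs_self r)
    have h3 := Real.rpow_le_rpow (Real.rpow_nonneg (abs_nonneg _) _) h2 hk.le
    rw [← Real.rpow_mul (abs_nonneg _), one_div_mul_cancel hk.ne', Real.rpow_one] at h3
    exact abs_le.1 h3
  exact (isCompact_univ_pi fun _ => isCompact_Icc).isBounded.subset hsub

theorem exists_cutoffProfile : ∃ θ, F.IsCutoffProfile θ := by
  have hc1 : IsClosed {ξ : Fin p → ℝ | F.homNorm ξ ≤ 1} :=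
    isClosed_le F.continuous_homNorm continuous_const
  have hc2 : IsClosed {ξ : Fin p → ℝ | 2 ≤ F.homNorm ξ} :=
    isClosed_le continuous_const F.continuous_homNorm
  have hd : Disjoint {ξ : Fin p → ℝ | 2 ≤ F.homNorm ξ} {ξ | F.homNorm ξ ≤ 1} := by
    rw [Set.disjoint_left]
    intro ξ h1 h2
    have h1 : 2 ≤ F.homNorm ξ := h1
    have h2 : F.homNorm ξ ≤ 1 := h2
    linarith
  -- A smooth Urysohn function for the disjoint closed sets {N ≥ 2} and {N ≤ 1}.
  obtain ⟨f, hf0, hf1, hf⟩ := exists_contMDiffMap_zero_one_of_isClosed (n := (⊤ : ℕ∞))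
    (modelWithCornersSelf ℝ (Fin p → ℝ)) hc2 hc1 hd
  have hsupp : tsupport (f : (Fin p → ℝ) → ℝ) ⊆ {ξ | F.homNorm ξ ≤ 2} := by
    refine closure_minimal ?_ (isClosed_le F.continuous_homNorm continuous_const)
    intro ξ hξ
    by_contra h
    have h : ¬ F.homNorm ξ ≤ 2 := h
    exact hξ (hf0 (not_le.1 h).le)
  refine ⟨f, f.contMDiff.contDiff, (F.isCompact_homNorm_le 2).of_isClosed_subset
    (isClosed_tsupport _) hsupp, hf, hsupp, fun ξ hξ => hf1 hξ.le⟩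

theorem two_zpow_neg_pos (j : ℕ) : (0 : ℝ) < (2 : ℝ) ^ (-(j : ℤ)) := by positivity

theorem two_zpow_neg_le_one (j : ℕ) : (2 : ℝ) ^ (-(j : ℤ)) ≤ 1 := by
  rw [zpow_neg, zpow_natCast]
  exact inv_le_one_of_one_le₀ (one_le_pow₀ (by norm_num))

open Filter Topology in
theorem IsCutoffProfile.eq_one_of_le {θ : (Fin p → ℝ) → ℝ} (h : F.IsCutoffProfile θ)
    {ξ : Fin p → ℝ} (hξ : F.homNorm ξ ≤ 1) : θ ξ = 1 := by
  have h1 : Tendsto (fun lam : ℝ => θ (dil F.sigmaStar lam ξ)) (𝓝[<] 1) (𝓝 (θ ξ)) := by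
    have hc : ContinuousAt (fun lam : ℝ => θ (dil F.sigmaStar lam ξ)) 1 := by
      refine h.smooth.continuous.continuousAt.comp (continuousAt_pi.2 fun k => ?_)
      exact (Real.continuousAt_rpow_const 1 _ (Or.inl one_ne_zero)).mul continuousAt_const
    have := hc.tendsto
    rw [dil_one] at this
    exact this.mono_left nhdsWithin_le_nhds
  refine tendsto_nhds_unique h1 (tendsto_const_nhds.congr' ?_)
  filter_upwards [self_mem_nhdsWithin, Ioo_mem_nhdsLT (show (0 : ℝ) < 1 by norm_num)] with lam _ hl
  refine (h.eq_one _ ?_).symm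
  rw [F.homNorm_dil hl.1]
  have := F.homNorm_nonneg ξ
  nlinarith [hl.1, hl.2]

theorem isCutoffSeq_cutoff {θ : (Fin p → ℝ) → ℝ} (h : F.IsCutoffProfile θ) :
    IsCutoffSeq (F.cutoff θ) where
  smooth j := h.smooth.comp (contDiff_dil _ _)
  compact j := by
    have hK := (h.compact.isCompact.image
      (contDiff_dil F.sigmaStar ((2 : ℝ) ^ (-(j : ℤ)))⁻¹).continuous)
    refine HasCompactSupport.intro hK fun ξ hξ => ?_
    by_contra hne
    refine hξ ⟨dil F.sigmaStar ((2 : ℝ) ^ (-(j : ℤ))) ξ, subset_tsupport _ hne, ?_⟩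
    exact dil_inv_dil _ (two_zpow_neg_pos j) ξ
  mem_Icc j ξ := h.mem_Icc _
  mono j := by
    intro ξ hξ
    have hξ : θ (dil F.sigmaStar ((2 : ℝ) ^ (-(j : ℤ))) ξ) = 1 := hξ
    -- Where θ_j = 1 the dilated point has N ≤ 2. Halving the dilation gives N ≤ 1, with equality
    -- possible, which is why θ = 1 is needed on the closed ball.
    have h1 := h.support (subset_tsupport θ
      (show dil F.sigmaStar ((2 : ℝ) ^ (-(j : ℤ))) ξ ∈ Function.support θ by
        rw [Function.mem_support, hξ]; exact one_ne_zero))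
    have h1 : F.homNorm (dil F.sigmaStar ((2 : ℝ) ^ (-(j : ℤ))) ξ) ≤ 2 := h1
    refine IsCutoffProfile.eq_one_of_le F h ?_
    rw [F.homNorm_dil (two_zpow_neg_pos _)] at h1 ⊢
    have e : (2 : ℝ) ^ (-((j + 1 : ℕ) : ℤ)) = 2 ^ (-(j : ℤ)) / 2 := by
      push_cast
      rw [neg_add, zpow_add₀ (by norm_num)]; norm_num [div_eq_mul_inv]
    rw [e]; linarith
  exhaust := by
    refine Set.eq_univ_of_forall fun ξ => Set.mem_iUnion.2 ?_
    obtain ⟨j, hj⟩ := pow_unbounded_of_one_lt (F.homNorm ξ) (show (1 : ℝ) < 2 by norm_num)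
    refine ⟨j, h.eq_one _ ?_⟩
    rw [F.homNorm_dil (two_zpow_neg_pos _), zpow_neg, zpow_natCast, inv_mul_lt_iff₀ (by positivity),
      mul_one]
    exact hj

variable {σ : Fin n → ℝ} (hσ : ∀ i, 0 < σ i) (hX : ∀ i, HomogVF σ 1 (X i))

include hσ hX in
theorem isHomogeneousLift_Z (k : Fin m) :
    IsHomogeneousLift (F.sigmaProd σ) (X k).1 (F.Z (Fin.castLE F.le k)) where
  smooth_base := smoothVF_contDiff (X k)
  smooth := F.contDiff_Z hσ hX _
  homog i := F.Z_homog hσ hX k i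
  lift z i := F.Z_inl hσ hX k z i

include hσ hX in
theorem isSaturableLiftingVia {θ : (Fin p → ℝ) → ℝ} (h : F.IsCutoffProfile θ) :
    IsSaturableLiftingVia (sumSq fun i => (X i).1) F.subLaplacian (F.cutoff θ) := by
  have hZ := F.isHomogeneousLift_Z hσ hX
  obtain ⟨R, Rs, h1, h2, h3, h4, h5⟩ := isXiOperator_remainder hZ (F.sigmaProd_pos hσ) h.smooth
    h.compact two_zpow_neg_pos two_zpow_neg_le_one
  exact ⟨isPDO_sumSq fun k => smoothVF_contDiff (X k), isLifting_sumSq hZ, R, Rs, h1, h2, h3, h4,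
    F.isCutoffSeq_cutoff h, h5⟩

end Frame

/-! ## Existence of adapted bases -/

section Existence

variable {n m : ℕ} {X : Fin m → smoothVF n}

/-- The push-forward by the dilation `dil w 2`. -/
def pushTwo (w : Fin n → ℝ) : Module.End ℝ (smoothVF n) where
  toFun V := ⟨fun x => dil w 2 (V.1 (dil w 2⁻¹ x)),
    (contDiff_dil w 2).comp ((smoothVF_contDiff V).comp (contDiff_dil w 2⁻¹))⟩
  map_add' V W := by
    ext1; funext x; exact dil_add w 2 _ _
  map_smul' c V := by
    ext1; funext x; exact dil_smul w 2 c _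

theorem homogVF_le_eigenspace (w : Fin n → ℝ) (k : ℝ) :
    homogVF w k ≤ (pushTwo w).eigenspace ((2 : ℝ) ^ k) := by
  intro V hV
  rw [Module.End.mem_eigenspace_iff]
  ext1; funext x
  have h := HomogVF.dil_apply hV (lam := 2) (by norm_num) (dil w 2⁻¹ x)
  rw [dil_dil_inv w (by norm_num)] at h
  exact h

theorem two_rpow_natCast_injective : Function.Injective fun k : ℕ => (2 : ℝ) ^ (k : ℝ) := by
  intro a b h
  simp only [Real.rpow_natCast] at h
  exact Nat.cast_injective (R := ℝ)
    (by exact_mod_cast (pow_right_injective₀ (by norm_num : (0 : ℝ) < 2) (by norm_num) h))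

/-- Layer k lies in the eigenspace of `pushTwo` for 2^k, and eigenspaces for distinct eigenvalues
are independent. -/
theorem layer_disjoint {w : Fin n → ℝ} (hX : ∀ i, HomogVF w 1 (X i)) (K : ℕ) :
    Disjoint (⨆ k : Set.Iic K, layer X k) (layer X (K + 1)) := by
  have hind := (Module.End.eigenspaces_iSupIndep (pushTwo w)).comp two_rpow_natCast_injective
  have hle : ∀ k : ℕ, layer X k ≤ (pushTwo w).eigenspace ((2 : ℝ) ^ (k : ℝ)) := fun k =>
    (layer_le_homogVF hX k).trans (homogVF_le_eigenspace w k)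
  refine (hind (K + 1)).symm.mono ?_ (hle (K + 1))
  refine iSup_le fun k => (hle k).trans ?_
  refine le_iSup₂_of_le (k : ℕ) (by have : (k : ℕ) ≤ K := k.2; omega) le_rfl

theorem layer_finite (X : Fin m → smoothVF n) (k : ℕ) : FiniteDimensional ℝ (layer X k) := by
  have h1 : (Submodule.span ℝ (Set.range X)).FG := Submodule.fg_span (Set.finite_range X)
  have hsucc : ∀ k, (layer X (k + 1)).FG := by
    intro k
    induction k with
    | zero => exact h1
    | succ k ih =>
      have : layer X (k + 1 + 1) = Submodule.map₂
          ((LieAlgebra.ad ℝ (smoothVF n)) : smoothVF n →ₗ[ℝ] Module.End ℝ (smoothVF n))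
          (Submodule.span ℝ (Set.range X)) (layer X (k + 1)) := by
        rw [Submodule.map₂_eq_span_image2, layer]
        congr 1
        ext W
        simp [Set.image2, eq_comm]
      rw [this]
      exact h1.map₂ _ ih
  cases k with
  | zero => rw [layer]; infer_instance
  | succ k => exact Module.Finite.iff_fg.2 (hsucc k)

/-- Induction on i: the Jacobi identity rewrites [[U, V'], W] through brackets in which U, from the
first layer, is the outer or the inner left factor. -/
theorem lie_mem_layer (X : Fin m → smoothVF n) (i : ℕ) : ∀ j, ∀ V ∈ layer X i, ∀ W ∈ layer X j,
    ⁅V, W⁆ ∈ layer X (i + j) := by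
  have hone : ∀ j, ∀ V ∈ Submodule.span ℝ (Set.range X), ∀ W ∈ layer X j,
      ⁅V, W⁆ ∈ layer X (j + 1) := by
    intro j V hV W hW
    cases j with
    | zero =>
      rw [layer, Submodule.mem_bot] at hW
      rw [hW, lie_zero]; exact zero_mem _
    | succ j => exact Submodule.subset_span ⟨V, hV, W, hW, rfl⟩
  have hsucc : ∀ i j, ∀ V ∈ layer X (i + 1), ∀ W ∈ layer X j, ⁅V, W⁆ ∈ layer X (i + 1 + j) := by
    intro i
    induction i with
    | zero =>
      intro j V hV W hW
      have := hone j V hV W hW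
      rwa [add_comm] at this
    | succ i ih =>
      intro j V hV W hW
      rw [layer] at hV
      induction hV using Submodule.span_induction with
      | mem V hV =>
        obtain ⟨U, hU, V', hV', rfl⟩ := hV
        rw [lie_lie]
        refine sub_mem ?_ ?_
        · have := hone _ U hU _ (ih j V' hV' W hW)
          have e : i + 1 + j + 1 = i + 1 + 1 + j := by ring
          rwa [e] at this
        · have := ih (j + 1) V' hV' _ (hone j U hU W hW)
          have e : i + 1 + (j + 1) = i + 1 + 1 + j := by ring
          rwa [e] at this
      | zero => rw [zero_lie]; exact zero_mem _
      | add V V' _ _ h h' => rw [add_lie]; exact add_mem h h'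
      | smul c V _ h => rw [smul_lie]; exact Submodule.smul_mem _ c h
  intro j V hV W hW
  cases i with
  | zero =>
    rw [layer, Submodule.mem_bot] at hV
    rw [hV, zero_lie]; exact zero_mem _
  | succ i => exact hsucc i j V hV W hW

/-- The Lie algebra generated by the first layer is the sum of the layers. -/
theorem lieHull_toSubmodule (X : Fin m → smoothVF n) :
    (lieHull X).toSubmodule = ⨆ k, layer X k := by
  apply le_antisymm
  · let A : LieSubalgebra ℝ (smoothVF n) :=
      { (⨆ k, layer X k : Submodule ℝ (smoothVF n)) with
        lie_mem' := by
          intro U V hU hV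
          change U ∈ ⨆ k, layer X k at hU
          change V ∈ ⨆ k, layer X k at hV
          change ⁅U, V⁆ ∈ ⨆ k, layer X k
          induction hU using Submodule.iSup_induction' with
          | mem i U hU =>
            induction hV using Submodule.iSup_induction' with
            | mem j V hV => exact Submodule.mem_iSup_of_mem _ (lie_mem_layer X i j U hU V hV)
            | zero => rw [lie_zero]; exact zero_mem _
            | add V V' _ _ h h' => rw [lie_add]; exact add_mem h h'
          | zero => rw [zero_lie]; exact zero_mem _
          | add U U' _ _ h h' => rw [add_lie]; exact add_mem h h' }
    have : lieHull X ≤ A := by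
      refine LieSubalgebra.lieSpan_le.2 ?_
      rintro _ ⟨i, rfl⟩
      exact Submodule.mem_iSup_of_mem 1 (Submodule.subset_span ⟨i, rfl⟩)
    exact this
  · refine iSup_le fun k => ?_
    have h1 : Submodule.span ℝ (Set.range X) ≤ (lieHull X).toSubmodule :=
      Submodule.span_le.2 LieSubalgebra.subset_lieSpan
    have hsucc : ∀ k, layer X (k + 1) ≤ (lieHull X).toSubmodule := by
      intro k
      induction k with
      | zero => exact h1
      | succ k ih =>
        rw [layer, Submodule.span_le]
        rintro _ ⟨U, hU, V, hV, rfl⟩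
        exact (lieHull X).lie_mem (h1 hU) (ih hV)
    cases k with
    | zero => exact bot_le
    | succ k => exact hsucc k

theorem layer_eq_bot {w : Fin n → ℝ} (hw : ∀ i, 0 < w i) (hX : ∀ i, HomogVF w 1 (X i)) {k : ℕ}
    (hk : ∀ i, w i < k) : layer X k = ⊥ := by
  rw [eq_bot_iff]
  intro V hV
  exact filVF_eq_zero hw hk (layer_le_homogVF hX k hV).mem_filVF

/-- Bases of the first `K` layers, ordered by degree. -/
theorem exists_adapted_family {w : Fin n → ℝ} (hX : ∀ i, HomogVF w 1 (X i))
    (hli : LinearIndependent ℝ X) (K : ℕ) :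
    ∃ (N : ℕ) (hm : m ≤ N) (v : Fin N → smoothVF n) (deg : Fin N → ℕ),
      (∀ i, v (Fin.castLE hm i) = X i) ∧ Monotone deg ∧ (∀ i, deg i ≤ K + 1) ∧
      LinearIndependent ℝ v ∧
      ∀ k ≤ K + 1, Submodule.span ℝ {W | ∃ i, deg i = k ∧ W = v i} = layer X k := by
  induction K with
  | zero =>
    refine ⟨m, le_rfl, X, fun _ => 1, fun i => rfl, monotone_const, fun _ => le_rfl, hli, ?_⟩
    intro k hk
    rcases Nat.le_one_iff_eq_zero_or_eq_one.1 hk with rfl | rfl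
    · simp [layer]
    · rw [layer]
      congr 1
      ext W
      simp [eq_comm]
  | succ K ih =>
    obtain ⟨N, hm, v, deg, h1, h2, h3, h4, h5⟩ := ih
    have := layer_finite X (K + 1 + 1)
    set d := Module.finrank ℝ (layer X (K + 1 + 1))
    let b := Module.finBasis ℝ (layer X (K + 1 + 1))
    let u : Fin d → smoothVF n := fun i => (b i : smoothVF n)
    have hu : LinearIndependent ℝ u :=
      b.linearIndependent.map' (Submodule.subtype _) (Submodule.ker_subtype _)
    have hus : Submodule.span ℝ (Set.range u) = layer X (K + 1 + 1) := by
      have : Set.range u = (layer X (K + 1 + 1)).subtype '' Set.range b := by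
        rw [← Set.range_comp]; rfl
      rw [this, Submodule.span_image, b.span_eq, Submodule.map_top, Submodule.range_subtype]
    have hdeg : ∀ i : Fin (N + d), Fin.append deg (fun _ => K + 1 + 1) i ≤ K + 1 + 1 := by
      intro i
      refine Fin.addCases (fun i => ?_) (fun i => ?_) i
      · rw [Fin.append_left]; exact (h3 i).trans (Nat.le_succ _)
      · rw [Fin.append_right]
    refine ⟨N + d, hm.trans (Nat.le_add_right _ _), Fin.append v u,
      Fin.append deg (fun _ => K + 1 + 1), ?_, ?_, hdeg, ?_, ?_⟩
    · intro i
      have : Fin.castLE (hm.trans (Nat.le_add_right N d)) i = Fin.castAdd d (Fin.castLE hm i) := rfl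
      rw [this, Fin.append_left, h1]
    · intro i
      refine Fin.addCases (fun i => ?_) (fun i => ?_) i
      · intro j
        refine Fin.addCases (fun j hij => ?_) (fun j _ => ?_) j
        · rw [Fin.append_left, Fin.append_left]; exact h2 hij
        · rw [Fin.append_left, Fin.append_right]; exact (h3 i).trans (Nat.le_succ _)
      · intro j
        refine Fin.addCases (fun j hij => ?_) (fun j _ => ?_) j
        · exfalso
          have : N + (i : ℕ) ≤ (j : ℕ) := hij
          omega
        · rw [Fin.append_right, Fin.append_right]
    -- The earlier vectors lie in layers of smaller degree, so the new layer meets their span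
    -- trivially.
    · have hdisj : Disjoint (Submodule.span ℝ (Set.range v)) (Submodule.span ℝ (Set.range u)) := by
        rw [hus]
        refine (layer_disjoint hX (K + 1)).mono_left ?_
        rw [Submodule.span_le]
        rintro _ ⟨i, rfl⟩
        have hi : v i ∈ layer X (deg i) := by
          rw [← h5 (deg i) (h3 i)]; exact Submodule.subset_span ⟨i, rfl, rfl⟩
        exact Submodule.mem_iSup_of_mem (⟨deg i, h3 i⟩ : Set.Iic (K + 1)) hi
      have := (h4.sum_type hu hdisj).comp finSumFinEquiv.symm finSumFinEquiv.symm.injective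
      have e : Fin.append v u = Sum.elim v u ∘ finSumFinEquiv.symm := by
        funext i
        refine Fin.addCases (fun i => ?_) (fun i => ?_) i <;> simp
      rw [e]
      exact this
    · intro k hk
      rcases Nat.lt_or_ge k (K + 1 + 1) with h | h
      · rw [← h5 k (by omega)]
        congr 1
        ext W
        constructor
        · rintro ⟨i, hi, rfl⟩
          revert hi
          refine Fin.addCases (fun i hi => ?_) (fun i hi => ?_) i
          · rw [Fin.append_left] at hi ⊢; exact ⟨i, hi, rfl⟩
          · rw [Fin.append_right] at hi; omega
        · rintro ⟨i, hi, rfl⟩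
          exact ⟨Fin.castAdd d i, by rw [Fin.append_left]; exact hi, by rw [Fin.append_left]⟩
      · have hk' : k = K + 1 + 1 := le_antisymm hk h
        subst hk'
        rw [← hus]
        congr 1
        ext W
        constructor
        · rintro ⟨i, hi, rfl⟩
          revert hi
          refine Fin.addCases (fun i hi => ?_) (fun i hi => ?_) i
          · rw [Fin.append_left] at hi; have := h3 i; omega
          · rw [Fin.append_right]; exact ⟨i, rfl⟩
        · rintro ⟨i, rfl⟩
          exact ⟨Fin.natAdd N i, by rw [Fin.append_right], by rw [Fin.append_right]⟩

/-- A spanning family indexed by `Fin N` contains a basis; its indices can be enumerated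
increasingly, and so can the others. -/
theorem exists_index_splitting {N : ℕ} (ev : Fin N → Fin n → ℝ)
    (hev : Submodule.span ℝ (Set.range ev) = ⊤) :
    ∃ s : Finset (Fin N), ∃ hs : s.card = n,
      LinearIndependent ℝ fun k => ev (s.orderEmbOfFin hs k) := by
  obtain ⟨κ, a, ha, hspan, hli⟩ := exists_linearIndependent' ℝ ev
  have : Finite κ := Finite.of_injective a ha
  have := Fintype.ofFinite κ
  classical
  let s : Finset (Fin N) := Finset.univ.image a
  have hs : s.card = n := by
    rw [Finset.card_image_of_injective _ ha, Finset.card_univ]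
    have hb := Module.finrank_eq_card_basis (Module.Basis.mk hli (by rw [hspan, hev]))
    rw [← hb]; simp
  refine ⟨s, hs, ?_⟩
  have hmem : ∀ k, ∃ c, a c = s.orderEmbOfFin hs k := by
    intro k
    have := s.orderEmbOfFin_mem hs k
    obtain ⟨c, -, hc⟩ := Finset.mem_image.1 this
    exact ⟨c, hc⟩
  choose e he using hmem
  have hinj : Function.Injective e := fun i j hij =>
    (s.orderEmbOfFin hs).injective (by rw [← he, ← he, hij])
  have := hli.comp e hinj
  simpa only [Function.comp_def, he] using this

theorem exists_frame {w : Fin n → ℝ} (hw : ∀ i, 0 < w i) (hX : ∀ i, HomogVF w 1 (X i))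
    (hli : LinearIndependent ℝ X) (hrank : ∀ v : Fin n → ℝ, ∃ V ∈ lieHull X, V.1 0 = v) :
    ∃ p : ℕ, Nonempty (Frame X p) := by
  obtain ⟨M, hM⟩ := exists_nat_gt_weights w hw
  obtain ⟨N, hm, v, deg, h1, h2, h3, h4, h5⟩ := exists_adapted_family hX hli M
  have h5' : ∀ k, Submodule.span ℝ {W | ∃ i, deg i = k ∧ W = v i} = layer X k := by
    intro k
    -- Beyond the largest weight the layers are zero, and no chosen vector has such a degree.
    rcases Nat.lt_or_ge (M + 1) k with h | h
    · have hk : ∀ i, w i < k := fun i => (hM i).trans (by exact_mod_cast (by omega : M < k))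
      rw [layer_eq_bot hw hX hk, Submodule.span_eq_bot]
      rintro W ⟨i, hi, -⟩
      have := h3 i; omega
    · exact h5 k h
  have hspan : Submodule.span ℝ (Set.range v) = (lieHull X).toSubmodule := by
    rw [lieHull_toSubmodule]
    apply le_antisymm
    · rw [Submodule.span_le]
      rintro _ ⟨i, rfl⟩
      refine Submodule.mem_iSup_of_mem (deg i) ?_
      rw [← h5']; exact Submodule.subset_span ⟨i, rfl, rfl⟩
    · refine iSup_le fun k => ?_
      rw [← h5']
      refine Submodule.span_mono ?_
      rintro _ ⟨i, -, rfl⟩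
      exact ⟨i, rfl⟩
  have hev : Submodule.span ℝ (Set.range fun i => (v i).1 0) = ⊤ := by
    rw [eq_top_iff]
    intro y _
    obtain ⟨V, hV, rfl⟩ := hrank y
    have hV' : V ∈ Submodule.span ℝ (Set.range v) := by rw [hspan]; exact hV
    let ev : smoothVF n →ₗ[ℝ] (Fin n → ℝ) :=
      { toFun := fun V => V.1 0
        map_add' := fun _ _ => rfl
        map_smul' := fun _ _ => rfl }
    have h := Submodule.mem_map_of_mem (f := ev) hV'
    rw [Submodule.map_span, ← Set.range_comp] at h
    exact h
  obtain ⟨s, hs, hsli⟩ := exists_index_splitting (fun i => (v i).1 0) hev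
  have hn : n ≤ N := by
    rw [← hs]; simpa using s.card_le_univ
  -- The number p is the dimension of 𝔞 minus n, nonnegative because n of the basis vectors are
  -- selected.
  obtain ⟨p, rfl⟩ := Nat.exists_eq_add_of_le hn
  have hsc : sᶜ.card = p := by
    rw [Finset.card_compl, hs]; simp
  have hmem : ∀ i, v i ∈ lieHull X := fun i => by
    have : v i ∈ (lieHull X).toSubmodule := by
      rw [← hspan]; exact Submodule.subset_span ⟨i, rfl⟩
    exact this
  let b : Module.Basis (Fin (n + p)) ℝ (lieHull X) :=
    ((Module.Basis.span h4).map (LinearEquiv.ofEq _ _ hspan))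
  have hb : ∀ i, (b i : smoothVF n) = v i := by
    intro i
    simp only [b, Module.Basis.map_apply]
    exact (congrArg Subtype.val (Module.Basis.span_apply h4 i))
  refine ⟨p, ⟨{ basis := b
                le := hm
                basis_castLE := fun i => by rw [hb, h1]
                deg := deg
                deg_mono := h2
                span_layer := fun k => by simp only [hb]; exact h5' k
                idx := finSumEquivOfFinset hs hsc
                idx_inl_strictMono := ?_
                idx_inr_strictMono := ?_
                linearIndependent_zero := ?_ }⟩⟩
  · simp only [finSumEquivOfFinset_inl]
    exact (s.orderEmbOfFin hs).strictMono
  · simp only [finSumEquivOfFinset_inr]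
    exact (sᶜ.orderEmbOfFin hsc).strictMono
  · simp only [finSumEquivOfFinset_inl, hb]
    exact hsli

end Existence

end Saturation
end

/-- `X_1, …, X_m` are linearly independent smooth vector fields on `ℝ^n`, homogeneous of degree `1`
for the dilations `dil σ`, `1 = σ_1 ≤ ⋯ ≤ σ_n`, and of full rank at `0`. -/
theorem theorem3p4 {n m : ℕ} [NeZero n] (σ : Fin n → ℝ) (hσ_one : σ 0 = 1) (hσ_mono : Monotone σ)
    (X : Fin m → Saturation.smoothVF n) (hX_indep : LinearIndependent ℝ X)
    (hX_hom : ∀ i, Saturation.IsHomogeneousOne σ (X i).1)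
    (hX_rank : ∀ v : Fin n → ℝ, ∃ V ∈ Saturation.lieHull X, V.1 0 = v) :
    (∃ p : ℕ, Nonempty (Saturation.Frame X p)) ∧
    ∀ (p : ℕ) (F : Saturation.Frame X p),
      F.GeneratesFirstLayer σ ∧
      Saturation.IsSaturableLifting (Saturation.sumSq fun i => (X i).1) F.subLaplacian ∧
      (∃ θ, F.IsCutoffProfile θ) ∧
      ∀ θ, F.IsCutoffProfile θ →
        Saturation.IsSaturableLiftingVia (Saturation.sumSq fun i => (X i).1) F.subLaplacian
          (F.cutoff θ) := by
  have hσ : ∀ i, 0 < σ i := fun i =>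
    lt_of_lt_of_le (by rw [hσ_one]; exact one_pos) (hσ_mono (Fin.zero_le i))
  have hX : ∀ i, Saturation.HomogVF σ 1 (X i) := fun i => (hX_hom i).homogVF
  refine ⟨Saturation.exists_frame hσ hX hX_indep hX_rank, fun p F => ?_⟩
  obtain ⟨θ, hθ⟩ := F.exists_cutoffProfile
  exact ⟨F.generatesFirstLayer hσ hX, ⟨F.cutoff θ, F.isSaturableLiftingVia hσ hX hθ⟩, ⟨θ, hθ⟩,
    fun θ hθ => F.isSaturableLiftingVia hσ hX hθ⟩
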